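/- **Setting.** Let $k$ be an algebraically closed field, $n\ge 3$ and $N$ integers; indices of vertices are taken modulo $n$, with representatives $1,\dots,n$. Let $R_n$ be the path algebra over $k$ of the quiver with vertices $1,\dots,n$ and arrows $(i|i+1)$ and $(i+1|i)$ for all $i$ (paths are read from left to right, so $(i)$ is the idempotent of the vertex $i$ and $(i)R_n$ is spanned by the paths starting at $i$), modulo the relations $$(i|i-1|i)=(i|i+1|i),\qquad (i-1|i|i+1)=0=(i+1|i|i-1)\qquad\text{for all } i .$$ It is bigraded: the first degree is $\deg(i)=0$, $\deg(i|i+1)=d_i$, $\deg(i+1|i)=N-d_i$, where $d_i=N/2$ if $N$ is even and $d_i=\frac12(N+(-1)^i)$ for $1\le i\le n$ if $N$ is odd; the second degree is $1$ on $(1|n)$, $-1$ on $(n|1)$ and $0$ on all other arrows and on the idempotents. $R_n$ is regarded as a differential bigraded algebra with zero differential. A bigraded dg module is a bigraded right $R_n$-module $M=\bigoplus M^{p,q}$ with an $R_n$-linear differential of bidegree $(1,0)$, and $D(R_n\text{-mod})$ is the localization of the category of bigraded dg modules (with morphisms of bidegree $0$) at the quasi-isomorphisms. It has the shifts $M[1]^{p,q}=M^{p+1,q}$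 (with differential $-d$) and $M\langle 1\rangle^{p,q}=M^{p,q-1}$, and the distinguished triangles are those isomorphic to $X\xrightarrow{f}Y\to\mathrm{Cone}(f)\to X[1]$ for a morphism $f$ of dg modules. With ${}_iP=R_n(i)$ and $P_i=(i)R_n$, let $T_i$ be the functor induced on $D(R_n\text{-mod})$ by $$T_i(M)=\mathrm{Cone}\big(M\otimes_{R_n}{}_iP\otimes_kP_i\to M\big),\qquad m\otimes p\mapsto mp,$$ where $M\otimes_{R_n}{}_iP=M(i)$. Let $t_\rho$ be the automorphism $(i_1|\cdots|i_m)\mapsto(i_1+1|\cdots|i_m+1)$ of the algebra $R_n$, let $\epsilon_n=1$ and $\epsilon_i=0$ for $1\le i<n$, and let $s_i=\lfloor N/2\rfloor-d_i$ (so that $s_i=0$ if $N$ is even). Let $F_\rho$ be the functor induced by $M\mapsto F_\rho(M)$, where $F_\rho(M)=M$ as a vector space with the same differential, with the action $m\cdot r=m\,t_\rho^{-1}(r)$, and with the bigrading for which $F_\rho(M)^{p,q}=\bigoplus_i \big(M^{p+s_i,\,q+\epsilon_i}\cap M(i)\big)$; thus, for even $N$, $F_\rho(P_i)\cong P_{i+1}$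 for $i<n$ and $F_\rho(P_n)\cong P_1\langle-1\rangle$. Let $F'_\rho$ be the functor defined by the inverse construction (action $m\cdot r=m\,t_\rho(r)$ and the opposite shifts of the bigrading). A functor commuting with $[1]$ (through a specified isomorphism) is exact if it sends distinguished triangles to distinguished triangles. A natural isomorphism is graded if it is compatible with the isomorphisms by which the functors commute with the shifts $[a]$ and $\langle b\rangle$. The functors $T_i$, $F_\rho$, $F'_\rho$ commute with the shifts through the evident isomorphisms (for $T_i$ and $[a]$: multiplication by $(-1)^a$ on the summand $M\otimes_{R_n}{}_iP\otimes_kP_i$ of the cone and the identity on $M$). **Proposition.** The functors $T_i$ $(i=1,\dots,n)$, $F_\rho$ and $F'_\rho$ are exact equivalences of $D(R_n\text{-mod})$, and there are graded natural isomorphisms $$F_\rho F'_\rho\simeq\mathrm{Id}\simeq F'_\rho F_\rho,$$ $$T_iT_{i+1}T_i\simeq T_{i+1}T_iT_{i+1}\quad\text{for all } i,$$ $$T_iT_j\simeq T_jT_i\quad\text{for all } i,j \text{ with } j\not\equiv i,\,i\pm1 \pmod n,$$ $$F_\rho T_iF'_\rho\simeq T_{i+1}\quad\text{for all } i .$$ 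-/

import Mathlib

open CategoryTheory TensorProduct

universe u

noncomputable section

namespace AffineZigzag

section LinearAlgebra

variable {k : Type*} [Field k]

/-- The bidegrees: the first (cohomological) and the second (internal) degree. -/
abbrev Bideg : Type := ℤ × ℤ

section Internal

variable {V W X : Type*} [AddCommGroup V] [Module k V] [AddCommGroup W] [Module k W]
  [AddCommGroup X] [Module k X]

/-- A spanning family of submodules whose elements are separated by their degree
is a grading. -/
theorem isInternal_of_coaction (gr : Bideg → Submodule k V)
    (δ : V →ₗ[k] (Bideg →₀ V)) (h : ∀ c, ∀ x ∈ gr c, δ x = Finsupp.single c x)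
    (top : ∀ x, x ∈ ⨆ c, gr c) : DirectSum.IsInternal gr := by
  refine ⟨?_, ?_⟩
  · have key : ∀ (v : DirectSum Bideg fun c => gr c) (c : Bideg),
        δ (DirectSum.coeLinearMap gr v) c = v c := by
      intro v c
      induction v using DirectSum.induction_on with
      | zero => simp
      | of a x =>
        rw [DirectSum.coeLinearMap_of, h a _ x.2, DirectSum.coe_of_apply]
        by_cases hac : a = c
        · subst hac; simp
        · simp [hac]
      | add x y hx hy =>
        rw [map_add, map_add, Finsupp.add_apply, hx, hy, DirectSum.add_apply]; rfl
    intro v w hvw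
    ext c
    rw [← key v c, ← key w c]
    exact congrArg (fun z => δ z c) hvw
  · intro x
    have hx := top x
    rw [← DirectSum.range_coeLinearMap] at hx
    exact hx

theorem mem_iSup_of_isInternal {gr : Bideg → Submodule k V} (h : DirectSum.IsInternal gr)
    (x : V) : x ∈ ⨆ c, gr c := by
  rw [h.submodule_iSup_eq_top]; trivial

theorem exists_coaction {gr : Bideg → Submodule k V} (h : DirectSum.IsInternal gr) :
    ∃ δ : V →ₗ[k] (Bideg →₀ V), ∀ c, ∀ x ∈ gr c, δ x = Finsupp.single c x := by
  refine ⟨(DirectSum.toModule k Bideg (Bideg →₀ V)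
    (fun c => (Finsupp.lsingle c).comp (gr c).subtype)).comp
    (LinearEquiv.ofBijective (DirectSum.coeLinearMap gr) h).symm.toLinearMap, ?_⟩
  intro c x hx
  have : (LinearEquiv.ofBijective (DirectSum.coeLinearMap gr) h).symm x =
      DirectSum.lof k Bideg (fun c => gr c) c ⟨x, hx⟩ := by
    rw [LinearEquiv.symm_apply_eq]
    exact (DirectSum.coeLinearMap_lof gr c ⟨x, hx⟩).symm
  rw [LinearMap.comp_apply, LinearEquiv.coe_coe, this, DirectSum.toModule_lof]
  rfl

theorem isInternal_comap {gr : Bideg → Submodule k V} (h : DirectSum.IsInternal gr)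
    (ι : W →ₗ[k] V) (π : V →ₗ[k] W) (hπ : ∀ w, π (ι w) = w)
    (hgr : ∀ c, ∀ x ∈ gr c, ι (π x) ∈ gr c) :
    DirectSum.IsInternal fun c => (gr c).comap ι := by
  obtain ⟨δ, hδ⟩ := exists_coaction h
  refine isInternal_of_coaction _ ((Finsupp.mapRange.linearMap π).comp (δ.comp ι)) ?_ ?_
  · intro c x hx
    simp [hδ c _ hx, hπ]
  · intro w
    rw [← hπ w]
    generalize ι w = v
    induction mem_iSup_of_isInternal h v using Submodule.iSup_induction' with
    | mem c x hx => exact Submodule.mem_iSup_of_mem c (hgr c x hx)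
    | zero => simp
    | add x y _ _ hx hy => rw [map_add]; exact add_mem hx hy

theorem zsmul_mem_submodule (S : Submodule k V) (c : ℤ) (x : V) (hx : x ∈ S) : c • x ∈ S :=
  zsmul_mem hx c

/-- The grading of a tensor product. -/
def tensorGrading (gr : Bideg → Submodule k V) (gr' : Bideg → Submodule k W) (c : Bideg) :
    Submodule k (V ⊗[k] W) :=
  Submodule.span k {t | ∃ a b : Bideg, a + b = c ∧ ∃ v ∈ gr a, ∃ w ∈ gr' b, v ⊗ₜ[k] w = t}

theorem isInternal_tensorGrading {gr : Bideg → Submodule k V} {gr' : Bideg → Submodule k W}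
    (h : DirectSum.IsInternal gr) (h' : DirectSum.IsInternal gr') :
    DirectSum.IsInternal (tensorGrading gr gr') := by
  obtain ⟨δ, hδ⟩ := exists_coaction h
  obtain ⟨δ', hδ'⟩ := exists_coaction h'
  refine isInternal_of_coaction _ ((Finsupp.lmapDomain (V ⊗[k] W) k
      (fun p : Bideg × Bideg => p.1 + p.2)).comp
    ((finsuppTensorFinsupp k k V W Bideg Bideg).toLinearMap.comp
      (TensorProduct.map δ δ'))) ?_ ?_
  · intro c x hx
    induction hx using Submodule.span_induction with
    | mem t ht =>
      obtain ⟨a, b, rfl, v, hv, w, hw, rfl⟩ := ht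
      simp [hδ a v hv, hδ' b w hw, Finsupp.mapDomain_single]
    | zero => simp
    | add x y _ _ hx hy => rw [map_add, hx, hy, Finsupp.single_add]
    | smul r x _ hx => rw [map_smul, hx, Finsupp.smul_single]
  · intro x
    induction x using TensorProduct.induction_on with
    | zero => simp
    | add x y hx hy => exact add_mem hx hy
    | tmul v w =>
      induction mem_iSup_of_isInternal h v using Submodule.iSup_induction' with
      | zero => simp
      | add x y _ _ hx hy => rw [TensorProduct.add_tmul]; exact add_mem hx hy
      | mem a v hv =>
        induction mem_iSup_of_isInternal h' w using Submodule.iSup_induction' with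
        | zero => simp
        | add x y _ _ hx hy => rw [TensorProduct.tmul_add]; exact add_mem hx hy
        | mem b w hw =>
          exact Submodule.mem_iSup_of_mem (a + b)
            (Submodule.subset_span ⟨a, b, rfl, v, hv, w, hw, rfl⟩)

theorem isInternal_prod {gr : Bideg → Submodule k V} {gr' : Bideg → Submodule k W}
    (h : DirectSum.IsInternal gr) (h' : DirectSum.IsInternal gr') (s : Bideg) :
    DirectSum.IsInternal fun c => (gr (c + s)).prod (gr' c) := by
  obtain ⟨δ, hδ⟩ := exists_coaction h
  obtain ⟨δ', hδ'⟩ := exists_coaction h'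
  refine isInternal_of_coaction _
    (LinearMap.coprod
      ((Finsupp.lmapDomain (V × W) k (fun c : Bideg => c - s)).comp
        ((Finsupp.mapRange.linearMap (LinearMap.inl k V W)).comp δ))
      ((Finsupp.mapRange.linearMap (LinearMap.inr k V W)).comp δ')) ?_ ?_
  · rintro c ⟨x, y⟩ ⟨hx, hy⟩
    simp only [SetLike.mem_coe] at hx hy
    simp [hδ _ _ hx, hδ' _ _ hy, Finsupp.mapDomain_single, ← Finsupp.single_add]
  · rintro ⟨x, y⟩
    have hxy : (x, y) = LinearMap.inl k V W x + LinearMap.inr k V W y := by simp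
    rw [hxy]
    refine add_mem ?_ ?_
    · induction mem_iSup_of_isInternal h x using Submodule.iSup_induction' with
      | zero => rw [map_zero]; exact zero_mem _
      | add x y _ _ hx hy => rw [map_add]; exact add_mem (hx (by simp)) (hy (by simp))
      | mem a v hv =>
        exact Submodule.mem_iSup_of_mem (a - s) (by simpa using hv)
    · induction mem_iSup_of_isInternal h' y using Submodule.iSup_induction' with
      | zero => rw [map_zero]; exact zero_mem _
      | add x y _ _ hx hy => rw [map_add]; exact add_mem (hx (by simp)) (hy (by simp))
      | mem a v hv =>
        exact Submodule.mem_iSup_of_mem a (by simpa using hv)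

theorem isInternal_shift {gr : Bideg → Submodule k V}
    (h : DirectSum.IsInternal gr) (s : Bideg) :
    DirectSum.IsInternal fun c => gr (c + s) := by
  obtain ⟨δ, hδ⟩ := exists_coaction h
  refine isInternal_of_coaction _
    ((Finsupp.lmapDomain V k (fun c : Bideg => c - s)).comp δ) ?_ ?_
  · intro c x hx
    simp [hδ _ _ hx, Finsupp.mapDomain_single]
  · intro x
    induction mem_iSup_of_isInternal h x using Submodule.iSup_induction' with
    | zero => exact zero_mem _
    | add x y _ _ hx hy => exact add_mem hx hy
    | mem a v hv => exact Submodule.mem_iSup_of_mem (a - s) (by simpa using hv)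

/-- Changing the grading by a separate shift on every summand of a decomposition
given by homogeneous orthogonal idempotents. -/
theorem isInternal_regrade {ι : Type*} [Fintype ι] {gr : Bideg → Submodule k V}
    (h : DirectSum.IsInternal gr) (e : ι → V →ₗ[k] V)
    (he : ∀ i x, e i (e i x) = e i x) (he' : ∀ i j x, i ≠ j → e j (e i x) = 0)
    (hsum : ∀ x, ∑ i, e i x = x) (hgr : ∀ i c, ∀ x ∈ gr c, e i x ∈ gr c) (s : ι → Bideg) :
    DirectSum.IsInternal fun c => ⨅ i, (gr (c + s i)).comap (e i) := by
  obtain ⟨δ, hδ⟩ := exists_coaction h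
  refine isInternal_of_coaction _
    (∑ i, (Finsupp.lmapDomain V k (fun c : Bideg => c - s i)).comp (δ.comp (e i))) ?_ ?_
  · intro c x hx
    rw [Submodule.mem_iInf] at hx
    have : ∀ i, Finsupp.lmapDomain V k (fun c : Bideg => c - s i) (δ (e i x)) =
        Finsupp.single c (e i x) := by
      intro i
      rw [hδ _ _ (hx i)]
      simp [Finsupp.mapDomain_single]
    simp only [LinearMap.sum_apply, LinearMap.comp_apply, this]
    rw [← Finsupp.single_finsetSum, hsum]
  · intro x
    rw [← hsum x]
    refine sum_mem fun i _ => ?_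
    induction mem_iSup_of_isInternal h x using Submodule.iSup_induction' with
    | zero => rw [map_zero]; exact zero_mem _
    | add x y _ _ hx hy => rw [map_add]; exact add_mem hx hy
    | mem a v hv =>
      refine Submodule.mem_iSup_of_mem (a - s i) ?_
      rw [Submodule.mem_iInf]
      intro j
      rw [Submodule.mem_comap]
      by_cases hij : i = j
      · subst hij
        rw [he]
        simpa using hgr i a v hv
      · rw [he' i j v hij]
        exact zero_mem _

end Internal

section QuasiIso

variable {V W V' W' X : Type*} [AddCommGroup V] [Module k V] [AddCommGroup W] [Module k W]
  [AddCommGroup V'] [Module k V'] [AddCommGroup W'] [Module k W'] [AddCommGroup X] [Module k X]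

/-- `f` induces a bijection between the homologies of `d` and `d'`, elementwise. -/
def ElemQuasiIso (d : V →ₗ[k] V) (d' : W →ₗ[k] W) (f : V →ₗ[k] W) : Prop :=
  (∀ x, d x = 0 → (∃ y, f x = d' y) → ∃ z, x = d z) ∧
    ∀ y, d' y = 0 → ∃ x, d x = 0 ∧ ∃ z, y = f x + d' z

theorem ElemQuasiIso.retract {d : V →ₗ[k] V} {d' : W →ₗ[k] W} {f : V →ₗ[k] W}
    (h : ElemQuasiIso d d' f) {dV : V' →ₗ[k] V'} {dW : W' →ₗ[k] W'} {g : V' →ₗ[k] W'}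
    (ι : V' →ₗ[k] V) (π : V →ₗ[k] V') (ι' : W' →ₗ[k] W) (π' : W →ₗ[k] W')
    (hπ : ∀ x, π (ι x) = x) (hπ' : ∀ x, π' (ι' x) = x)
    (hι : ∀ x, d (ι x) = ι (dV x)) (hι' : ∀ x, d' (ι' x) = ι' (dW x))
    (hd : ∀ x, π (d x) = dV (π x)) (hd' : ∀ x, π' (d' x) = dW (π' x))
    (hf : ∀ x, f (ι x) = ι' (g x)) (hf' : ∀ x, π' (f x) = g (π x)) :
    ElemQuasiIso dV dW g := by
  constructor
  · rintro x hx ⟨y, hy⟩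
    obtain ⟨z, hz⟩ := h.1 (ι x) (by rw [hι, hx, map_zero]) ⟨ι' y, by rw [hf, hy, hι']⟩
    exact ⟨π z, by rw [← hd, ← hz, hπ]⟩
  · intro y hy
    obtain ⟨x, hx, z, hz⟩ := h.2 (ι' y) (by rw [hι', hy, map_zero])
    exact ⟨π x, by rw [← hd, hx, map_zero], π' z, by rw [← hf', ← hd', ← map_add, ← hz, hπ']⟩

theorem ElemQuasiIso.finsupp {d : V →ₗ[k] V} {d' : W →ₗ[k] W} {f : V →ₗ[k] W}
    (h : ElemQuasiIso d d' f) (ι : Type*) :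
    ElemQuasiIso (Finsupp.mapRange.linearMap (α := ι) d) (Finsupp.mapRange.linearMap d')
      (Finsupp.mapRange.linearMap f) := by
  classical
  constructor
  · rintro x hx ⟨y, hy⟩
    have hx' : ∀ b, d (x b) = 0 := fun b => by simpa using DFunLike.congr_fun hx b
    have hy' : ∀ b, f (x b) = d' (y b) := fun b => by simpa using DFunLike.congr_fun hy b
    choose z hz using fun b => h.1 (x b) (hx' b) ⟨y b, hy' b⟩
    refine ⟨Finsupp.onFinset x.support (fun b => if x b = 0 then 0 else z b) ?_, ?_⟩
    · intro b hb
      by_contra hb'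
      simp at hb'
      simp [hb'] at hb
    · ext b
      by_cases hb : x b = 0
      · simp [hb]
      · simp [hb, ← hz]
  · intro y hy
    have hy' : ∀ b, d' (y b) = 0 := fun b => by simpa using DFunLike.congr_fun hy b
    choose x hx z hz using fun b => h.2 (y b) (hy' b)
    refine ⟨Finsupp.onFinset y.support (fun b => if y b = 0 then 0 else x b) ?_, ?_,
      Finsupp.onFinset y.support (fun b => if y b = 0 then 0 else z b) ?_, ?_⟩
    · intro b hb
      by_contra hb'
      simp at hb'
      simp [hb'] at hb
    · ext b
      by_cases hb : y b = 0
      · simp [hb]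
      · simp [hb, hx]
    · intro b hb
      by_contra hb'
      simp at hb'
      simp [hb'] at hb
    · ext b
      by_cases hb : y b = 0
      · simp [hb]
      · simp [hb, ← hz]

theorem equivFinsupp_lTensor {X ι : Type*} [AddCommGroup X] [Module k X] [DecidableEq ι]
    (B : Module.Basis ι k X) (g : V →ₗ[k] W) (x : X ⊗[k] V) :
    TensorProduct.equivFinsuppOfBasisLeft B (g.lTensor X x) =
      Finsupp.mapRange.linearMap g (TensorProduct.equivFinsuppOfBasisLeft B x) := by
  induction x using TensorProduct.induction_on with
  | zero => simp
  | add x y hx hy => simp only [map_add, hx, hy]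
  | tmul x v => ext b; simp

theorem ElemQuasiIso.lTensor {d : V →ₗ[k] V} {d' : W →ₗ[k] W} {f : V →ₗ[k] W}
    (h : ElemQuasiIso d d' f) (X : Type*) [AddCommGroup X] [Module k X] :
    ElemQuasiIso (d.lTensor X) (d'.lTensor X) (f.lTensor X) := by
  classical
  let B := Module.Basis.ofVectorSpace k X
  refine (h.finsupp _).retract
    (TensorProduct.equivFinsuppOfBasisLeft B).toLinearMap
    (TensorProduct.equivFinsuppOfBasisLeft B).symm.toLinearMap
    (TensorProduct.equivFinsuppOfBasisLeft B).toLinearMap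
    (TensorProduct.equivFinsuppOfBasisLeft B).symm.toLinearMap ?_ ?_ ?_ ?_ ?_ ?_ ?_ ?_
  · intro x; simp
  · intro x; simp
  · intro x; exact (equivFinsupp_lTensor B d x).symm
  · intro x; exact (equivFinsupp_lTensor B d' x).symm
  · intro x
    simp only [LinearEquiv.coe_coe]
    rw [LinearEquiv.symm_apply_eq,
      equivFinsupp_lTensor, LinearEquiv.apply_symm_apply]
  · intro x
    simp only [LinearEquiv.coe_coe]
    rw [LinearEquiv.symm_apply_eq,
      equivFinsupp_lTensor, LinearEquiv.apply_symm_apply]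
  · intro x; exact (equivFinsupp_lTensor B f x).symm
  · intro x
    simp only [LinearEquiv.coe_coe]
    rw [LinearEquiv.symm_apply_eq,
      equivFinsupp_lTensor, LinearEquiv.apply_symm_apply]

theorem ElemQuasiIso.smul {d e : V →ₗ[k] V} {d' e' : W →ₗ[k] W} {f : V →ₗ[k] W}
    (h : ElemQuasiIso d d' f) (c : ℤ) (hc : c * c = 1) (he : ∀ x, e x = c • d x)
    (he' : ∀ x, e' x = c • d' x) : ElemQuasiIso e e' f := by
  have hs : ∀ x : V, c • c • x = x := fun x => by rw [smul_smul, hc, one_smul]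
  have hs' : ∀ x : W, c • c • x = x := fun x => by rw [smul_smul, hc, one_smul]
  have hd : ∀ x, e x = 0 ↔ d x = 0 := fun x =>
    ⟨fun h => by rw [← hs (d x), ← he, h, smul_zero], fun h => by rw [he, h, smul_zero]⟩
  have hd' : ∀ x, e' x = 0 ↔ d' x = 0 := fun x =>
    ⟨fun h => by rw [← hs' (d' x), ← he', h, smul_zero], fun h => by rw [he', h, smul_zero]⟩
  constructor
  · rintro x hx ⟨y, hy⟩
    obtain ⟨z, hz⟩ := h.1 x ((hd _).1 hx) ⟨c • y, by rw [map_zsmul, hy, he']⟩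
    exact ⟨c • z, by rw [he, map_zsmul, hs, hz]⟩
  · intro y hy
    obtain ⟨x, hx, z, hz⟩ := h.2 y ((hd' _).1 hy)
    exact ⟨x, (hd _).2 hx, c • z, by rw [he', map_zsmul, hs', hz]⟩

/-- The differential of the mapping cone. -/
def coneD (dV : V →ₗ[k] V) (dW : W →ₗ[k] W) (f : V →ₗ[k] W) : V × W →ₗ[k] V × W :=
  LinearMap.prod (-(dV.comp (LinearMap.fst k V W))) (f.coprod dW)

theorem ElemQuasiIso.cone {dV : V →ₗ[k] V} {dW : W →ₗ[k] W} {f : V →ₗ[k] W}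
    {dV' : V' →ₗ[k] V'} {dW' : W' →ₗ[k] W'} {f' : V' →ₗ[k] W'}
    {g : V →ₗ[k] V'} {h : W →ₗ[k] W'} (hg : ElemQuasiIso dV dV' g) (hh : ElemQuasiIso dW dW' h)
    (cf : ∀ x, f (dV x) = dW (f x)) (cf' : ∀ x, f' (dV' x) = dW' (f' x))
    (cg : ∀ x, g (dV x) = dV' (g x)) (ch : ∀ x, h (dW x) = dW' (h x))
    (sq : ∀ x, h (f x) = f' (g x)) :
    ElemQuasiIso (coneD dV dW f) (coneD dV' dW' f') (g.prodMap h) := by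
  have cd : ∀ x, coneD dV dW f x = (-dV x.1, f x.1 + dW x.2) := fun _ => rfl
  have cd' : ∀ x, coneD dV' dW' f' x = (-dV' x.1, f' x.1 + dW' x.2) := fun _ => rfl
  constructor
  · rintro ⟨a, b⟩ hab ⟨⟨a', b'⟩, h2⟩
    simp only [cd, cd', LinearMap.prodMap_apply, Prod.mk.injEq, Prod.mk_eq_zero] at hab h2
    obtain ⟨ha, hb⟩ := hab
    obtain ⟨ha', hb'⟩ := h2
    obtain ⟨a1, rfl⟩ := hg.1 a (by simpa using ha) ⟨-a', by rw [ha', map_neg]⟩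
    obtain ⟨a2, ha2, a3, ha3⟩ := hg.2 (g a1 + a') (by rw [map_add, ← cg, ha']; simp)
    obtain ⟨b1, hb1⟩ := hh.1 (f (a1 - a2) + b) (by
        rw [map_add, ← cf, map_sub, ha2, sub_zero]; exact hb)
      ⟨f' a3 + b', by
        have : g a1 = g a2 + dV' a3 - a' := by rw [← ha3]; abel
        rw [map_add, sq, hb', map_sub, this, map_add, ← cf']
        simp only [map_sub, map_add]
        abel⟩
    refine ⟨(-(a1 - a2), b1), ?_⟩
    rw [cd]
    ext
    · simp [ha2]
    · simp only [← hb1, map_neg]; abel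
  · rintro ⟨a', b'⟩ hab
    simp only [cd', Prod.mk_eq_zero] at hab
    obtain ⟨ha', hb'⟩ := hab
    obtain ⟨a, ha, z', rfl⟩ := hg.2 a' (by simpa using ha')
    obtain ⟨b0, hb0⟩ := hh.1 (f a) (by rw [← cf, ha, map_zero]) ⟨-(b' + f' z'), by
      rw [map_add, cf'] at hb'
      rw [sq, map_neg, map_add, eq_neg_iff_add_eq_zero, ← hb']
      abel⟩
    obtain ⟨b1, hb1, z1, hz1⟩ := hh.2 (b' + h b0 + f' z') (by
      rw [map_add, cf'] at hb'
      rw [map_add, map_add, ← ch, ← hb0, sq, ← hb']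
      abel)
    refine ⟨(a, b1 - b0), ?_, (-z', z1), ?_⟩
    · rw [cd]; simp [ha, hb1, ← hb0]
    · rw [cd']
      ext
      · simp
      · have : b' = h b1 + dW' z1 - h b0 - f' z' := by rw [← hz1]; abel
        simp only [LinearMap.prodMap_apply, Prod.snd_add, map_sub, map_neg, this]
        abel

theorem lTensor_zsmul {A : Type*} [Ring A] [Algebra k A] [Module A V] [IsScalarTower k A V]
    (f g : W →ₗ[k] W') (c : ℤ) (h : ∀ w, g w = c • f w) (x : V ⊗[k] W) :
    TensorProduct.AlgebraTensorModule.lTensor A V g x =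
      c • TensorProduct.AlgebraTensorModule.lTensor A V f x := by
  induction x using TensorProduct.induction_on with
  | zero => simp
  | add x y hx hy => rw [map_add, map_add, hx, hy, smul_add]
  | tmul v w => simp [h]

theorem lTensor_eq_self {A : Type*} [Ring A] [Algebra k A] [Module A V] [IsScalarTower k A V]
    (g : W →ₗ[k] W) (h : ∀ w, g w = w) (x : V ⊗[k] W) :
    TensorProduct.AlgebraTensorModule.lTensor A V g x = x := by
  induction x using TensorProduct.induction_on with
  | zero => simp
  | add x y hx hy => rw [map_add, hx, hy]
  | tmul v w => simp [h]

end QuasiIso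

end LinearAlgebra

section Algebra

/-- The generators of the path algebra of the cyclic quiver with `n` vertices: the
idempotents `(i)` and the arrows `(i|i+1)`, `(i+1|i)`. -/
inductive Gen (n : ℕ) : Type
  | vertex (i : ZMod n)
  | up (i : ZMod n)
  | down (i : ZMod n)

/-- The representative in `{1, …, n}` of a residue class modulo `n`. -/
def label (n : ℕ) (i : ZMod n) : ℕ := if i = 0 then n else i.val

/-- The number `d_i`: it is `N / 2` for `N` even and `(N + (-1)^i) / 2` for `N` odd,
where `1 ≤ i ≤ n`. -/
def upDeg (n : ℕ) (N : ℤ) (i : ZMod n) : ℤ :=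
  if Even N then N / 2 else (N + (-1) ^ label n i) / 2

/-- The bidegree of a generator. Vertex `n` is `0 : ZMod n`, so that `up 0` is `(n|1)` and
`down 0` is `(1|n)`. -/
def Gen.deg {n : ℕ} (N : ℤ) : Gen n → Bideg
  | .vertex _ => 0
  | .up i => (upDeg n N i, if i = 0 then -1 else 0)
  | .down i => (N - upDeg n N i, if i = 0 then 1 else 0)

variable (k : Type u) [Field k] (n : ℕ) [NeZero n]

open Gen in
/-- The relations of `R_n`: those of the path algebra (paths are composed from left to
right), then the zigzag relations
`(i+1|i|i+1) = (i+1|i+2|i+1)` and `(i|i+1|i+2) = 0 = (i+2|i+1|i)`. -/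
inductive Rel : FreeAlgebra k (Gen n) → FreeAlgebra k (Gen n) → Prop
  | vertex_mul_self (i : ZMod n) :
      Rel (FreeAlgebra.ι k (vertex i) * FreeAlgebra.ι k (vertex i)) (FreeAlgebra.ι k (vertex i))
  | vertex_mul_vertex (i j : ZMod n) (h : i ≠ j) :
      Rel (FreeAlgebra.ι k (vertex i) * FreeAlgebra.ι k (vertex j)) 0
  | sum_vertex : Rel (∑ i : ZMod n, FreeAlgebra.ι k (vertex i)) 1
  | vertex_mul_up (i : ZMod n) :
      Rel (FreeAlgebra.ι k (vertex i) * FreeAlgebra.ι k (up i)) (FreeAlgebra.ι k (up i))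
  | up_mul_vertex (i : ZMod n) :
      Rel (FreeAlgebra.ι k (up i) * FreeAlgebra.ι k (vertex (i + 1))) (FreeAlgebra.ι k (up i))
  | vertex_mul_down (i : ZMod n) :
      Rel (FreeAlgebra.ι k (vertex (i + 1)) * FreeAlgebra.ι k (down i)) (FreeAlgebra.ι k (down i))
  | down_mul_vertex (i : ZMod n) :
      Rel (FreeAlgebra.ι k (down i) * FreeAlgebra.ι k (vertex i)) (FreeAlgebra.ι k (down i))
  | loop (i : ZMod n) :
      Rel (FreeAlgebra.ι k (down i) * FreeAlgebra.ι k (up i))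
        (FreeAlgebra.ι k (up (i + 1)) * FreeAlgebra.ι k (down (i + 1)))
  | up_mul_up (i : ZMod n) :
      Rel (FreeAlgebra.ι k (up i) * FreeAlgebra.ι k (up (i + 1))) 0
  | down_mul_down (i : ZMod n) :
      Rel (FreeAlgebra.ι k (down (i + 1)) * FreeAlgebra.ι k (down i)) 0

/-- The algebra `R_n`; its differential is zero. -/
def Zigzag : Type u := RingQuot (Rel k n)

instance : Ring (Zigzag k n) := inferInstanceAs (Ring (RingQuot (Rel k n)))

instance : Algebra k (Zigzag k n) := inferInstanceAs (Algebra k (RingQuot (Rel k n)))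

/-- The quotient map. -/
def zigzagMk : FreeAlgebra k (Gen n) →ₐ[k] Zigzag k n := RingQuot.mkAlgHom k (Rel k n)

variable {n}

theorem zigzagMk_rel {x y : FreeAlgebra k (Gen n)} (h : Rel k n x y) :
    zigzagMk k n x = zigzagMk k n y :=
  RingQuot.mkAlgHom_rel k h

/-- The image of a generator in `R_n`. -/
def gen (g : Gen n) : Zigzag k n := zigzagMk k n (FreeAlgebra.ι k g)

/-- The idempotent `(i)`. -/
abbrev idem (i : ZMod n) : Zigzag k n := gen k (Gen.vertex i)

/-- The bigrading of `R_n`: the piece of bidegree `c` is spanned by the words in the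
generators of total bidegree `c`. -/
def bigrading (N : ℤ) (c : Bideg) : Submodule k (Zigzag k n) :=
  Submodule.span k
    {x | ∃ w : List (Gen n), (w.map (Gen.deg N)).sum = c ∧ (w.map (gen k)).prod = x}

open Gen

theorem gen_vertex_mul_self (i : ZMod n) : idem k i * idem k i = idem k i := by
  simpa [gen] using zigzagMk_rel k (Rel.vertex_mul_self (k := k) i)

theorem gen_vertex_mul_vertex (i j : ZMod n) (h : i ≠ j) : idem k i * idem k j = 0 := by
  simpa [gen] using zigzagMk_rel k (Rel.vertex_mul_vertex (k := k) i j h)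

theorem sum_gen_vertex : ∑ i : ZMod n, idem k i = 1 := by
  simpa [gen] using zigzagMk_rel k (Rel.sum_vertex (k := k) (n := n))

theorem gen_vertex_mul_up (i : ZMod n) : idem k i * gen k (up i) = gen k (up i) := by
  simpa [gen] using zigzagMk_rel k (Rel.vertex_mul_up (k := k) i)

theorem gen_up_mul_vertex (i : ZMod n) : gen k (up i) * idem k (i + 1) = gen k (up i) := by
  simpa [gen] using zigzagMk_rel k (Rel.up_mul_vertex (k := k) i)

theorem gen_vertex_mul_down (i : ZMod n) :
    idem k (i + 1) * gen k (down i) = gen k (down i) := by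
  simpa [gen] using zigzagMk_rel k (Rel.vertex_mul_down (k := k) i)

theorem gen_down_mul_vertex (i : ZMod n) : gen k (down i) * idem k i = gen k (down i) := by
  simpa [gen] using zigzagMk_rel k (Rel.down_mul_vertex (k := k) i)

theorem gen_loop (i : ZMod n) :
    gen k (down i) * gen k (up i) = gen k (up (i + 1)) * gen k (down (i + 1)) := by
  simpa [gen] using zigzagMk_rel k (Rel.loop (k := k) i)

theorem gen_up_mul_up (i : ZMod n) : gen k (up i) * gen k (up (i + 1)) = 0 := by
  simpa [gen] using zigzagMk_rel k (Rel.up_mul_up (k := k) i)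

theorem gen_down_mul_down (i : ZMod n) : gen k (down (i + 1)) * gen k (down i) = 0 := by
  simpa [gen] using zigzagMk_rel k (Rel.down_mul_down (k := k) i)

/-- Algebra homomorphisms out of `R_n`. -/
def liftHom {A : Type*} [Ring A] [Algebra k A] (f : Gen n → A)
    (h : ∀ ⦃x y⦄, Rel k n x y → FreeAlgebra.lift k f x = FreeAlgebra.lift k f y) :
    Zigzag k n →ₐ[k] A :=
  RingQuot.liftAlgHom k ⟨FreeAlgebra.lift k f, h⟩

theorem liftHom_gen {A : Type*} [Ring A] [Algebra k A] (f : Gen n → A)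
    (h : ∀ ⦃x y⦄, Rel k n x y → FreeAlgebra.lift k f x = FreeAlgebra.lift k f y) (g : Gen n) :
    liftHom k f h (gen k g) = f g := by
  have : liftHom k f h (gen k g) = FreeAlgebra.lift k f (FreeAlgebra.ι k g) :=
    RingQuot.liftAlgHom_mkAlgHom_apply k _ h _
  rw [this, FreeAlgebra.lift_ι_apply]

theorem mem_span_words (x : Zigzag k n) :
    x ∈ Submodule.span k (Set.range fun w : List (Gen n) => (w.map (gen k)).prod) := by
  obtain ⟨y, rfl⟩ : ∃ y, zigzagMk k n y = x := RingQuot.mkAlgHom_surjective k (Rel k n) x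
  have mul : ∀ a b : Zigzag k n,
      a ∈ Submodule.span k (Set.range fun w : List (Gen n) => (w.map (gen k)).prod) →
      b ∈ Submodule.span k (Set.range fun w : List (Gen n) => (w.map (gen k)).prod) →
      a * b ∈ Submodule.span k (Set.range fun w : List (Gen n) => (w.map (gen k)).prod) := by
    intro a b ha hb
    induction ha, hb using Submodule.span_induction₂ with
    | mem_mem x y hx hy =>
      obtain ⟨w, rfl⟩ := hx
      obtain ⟨w', rfl⟩ := hy
      exact Submodule.subset_span ⟨w ++ w', by simp⟩
    | zero_left => simp
    | zero_right => simp
    | add_left x y z _ _ _ h1 h2 => rw [add_mul]; exact add_mem h1 h2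
    | add_right x y z _ _ _ h1 h2 => rw [mul_add]; exact add_mem h1 h2
    | smul_left r x y _ _ h => rw [smul_mul_assoc]; exact Submodule.smul_mem _ _ h
    | smul_right r x y _ _ h => rw [mul_smul_comm]; exact Submodule.smul_mem _ _ h
  have one : (1 : Zigzag k n) ∈
      Submodule.span k (Set.range fun w : List (Gen n) => (w.map (gen k)).prod) :=
    Submodule.subset_span ⟨[], by simp⟩
  induction y using FreeAlgebra.induction with
  | grade0 r =>
    rw [AlgHom.commutes, Algebra.algebraMap_eq_smul_one]
    exact Submodule.smul_mem _ _ one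
  | grade1 g => exact Submodule.subset_span ⟨[g], by simp [gen]⟩
  | mul a b ha hb => rw [map_mul]; exact mul _ _ ha hb
  | add a b ha hb => rw [map_add]; exact add_mem ha hb

theorem deg_up_add_deg_down {n : ℕ} (N : ℤ) (i j : ZMod n) :
    deg N (up i) + deg N (down i) = deg N (up j) + deg N (down j) := by
  simp only [deg, Prod.mk_add_mk]
  ext
  · simp
  · simp only; split_ifs <;> simp

/-- The coaction `x ↦ x t^c` (for `x` of bidegree `c`) that describes the bigrading. -/
def coaction (N : ℤ) : Zigzag k n →ₐ[k] AddMonoidAlgebra (Zigzag k n) Bideg :=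
  liftHom k (fun g => AddMonoidAlgebra.single (deg N g) (gen k g)) (by
    intro x y h
    cases h with
    | vertex_mul_self i => simp [AddMonoidAlgebra.single_mul_single, gen_vertex_mul_self, deg]
    | vertex_mul_vertex i j h =>
      simp [AddMonoidAlgebra.single_mul_single, gen_vertex_mul_vertex k i j h]
    | sum_vertex =>
      simp only [map_sum, FreeAlgebra.lift_ι_apply, deg, map_one]
      rw [AddMonoidAlgebra.one_def, ← sum_gen_vertex k]
      exact (map_sum (AddMonoidAlgebra.singleAddHom (R := Zigzag k n) (0 : Bideg)) _ _).symm
    | vertex_mul_up i =>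
      simp [AddMonoidAlgebra.single_mul_single, gen_vertex_mul_up,
        show deg N (vertex i) = 0 from rfl]
    | up_mul_vertex i =>
      simp [AddMonoidAlgebra.single_mul_single, gen_up_mul_vertex,
        show deg N (vertex (i + 1)) = 0 from rfl]
    | vertex_mul_down i =>
      simp [AddMonoidAlgebra.single_mul_single, gen_vertex_mul_down,
        show deg N (vertex (i + 1)) = 0 from rfl]
    | down_mul_vertex i =>
      simp [AddMonoidAlgebra.single_mul_single, gen_down_mul_vertex,
        show deg N (vertex i) = 0 from rfl]
    | loop i =>
      simp only [map_mul, FreeAlgebra.lift_ι_apply, AddMonoidAlgebra.single_mul_single, gen_loop]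
      rw [add_comm, deg_up_add_deg_down N i (i + 1)]
    | up_mul_up i => simp [AddMonoidAlgebra.single_mul_single, gen_up_mul_up]
    | down_mul_down i => simp [AddMonoidAlgebra.single_mul_single, gen_down_mul_down])

theorem coaction_word (N : ℤ) (w : List (Gen n)) :
    coaction k N (w.map (gen k)).prod =
      AddMonoidAlgebra.single (w.map (deg N)).sum (w.map (gen k)).prod := by
  induction w with
  | nil => simp [AddMonoidAlgebra.one_def]
  | cons g w ih =>
    rw [List.map_cons, List.prod_cons, map_mul, ih, coaction, liftHom_gen,
      AddMonoidAlgebra.single_mul_single]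
    simp

theorem coaction_of_mem (N : ℤ) (c : Bideg) (x : Zigzag k n) (hx : x ∈ bigrading k N c) :
    coaction k N x = AddMonoidAlgebra.single c x := by
  induction hx using Submodule.span_induction with
  | mem x hx => obtain ⟨w, rfl, rfl⟩ := hx; exact coaction_word k N w
  | zero => simp
  | add x y _ _ hx hy => rw [map_add, hx, hy, AddMonoidAlgebra.single_add]
  | smul r x _ hx => rw [map_smul, hx, AddMonoidAlgebra.smul_single]

theorem isInternal_bigrading (N : ℤ) :
    DirectSum.IsInternal (bigrading (n := n) k N) := by
  refine isInternal_of_coaction _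
    ((AddMonoidAlgebra.coeffLinearEquiv k).toLinearMap.comp (coaction k N).toLinearMap) ?_ ?_
  · intro c x hx
    simp [coaction_of_mem k N c x hx]
  · intro x
    induction mem_span_words k x using Submodule.span_induction with
    | mem x hx =>
      obtain ⟨w, rfl⟩ := hx
      exact Submodule.mem_iSup_of_mem _ (Submodule.subset_span ⟨w, rfl, rfl⟩)
    | zero => exact zero_mem _
    | add x y _ _ hx hy => exact add_mem hx hy
    | smul r x _ hx => exact Submodule.smul_mem _ _ hx

theorem gen_mem (N : ℤ) (g : Gen n) : gen k g ∈ bigrading k N (deg N g) :=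
  Submodule.subset_span ⟨[g], by simp, by simp⟩

theorem idem_mem (N : ℤ) (i : ZMod n) : idem k i ∈ bigrading k N 0 :=
  gen_mem k N (vertex i)

theorem mul_mem_bigrading (N : ℤ) {a b : Bideg} {x y : Zigzag k n}
    (hx : x ∈ bigrading k N a) (hy : y ∈ bigrading k N b) : x * y ∈ bigrading k N (a + b) := by
  induction hx, hy using Submodule.span_induction₂ with
  | mem_mem x y hx hy =>
    obtain ⟨w, rfl, rfl⟩ := hx
    obtain ⟨w', rfl, rfl⟩ := hy
    exact Submodule.subset_span ⟨w ++ w', by simp, by simp⟩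
  | zero_left => simp
  | zero_right => simp
  | add_left x y z _ _ _ h1 h2 => rw [add_mul]; exact add_mem h1 h2
  | add_right x y z _ _ _ h1 h2 => rw [mul_add]; exact add_mem h1 h2
  | smul_left r x y _ _ h => rw [smul_mul_assoc]; exact Submodule.smul_mem _ _ h
  | smul_right r x y _ _ h => rw [mul_smul_comm]; exact Submodule.smul_mem _ _ h

/-- The rotation of a generator by `a`. -/
def Gen.rot (a : ZMod n) : Gen n → Gen n
  | .vertex i => .vertex (i + a)
  | .up i => .up (i + a)
  | .down i => .down (i + a)

/-- The endomorphism `(i₁|…|i_m) ↦ (i₁ + a|…|i_m + a)` of `R_n`; for `a = 1` it is the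
automorphism `t_ρ`, and for `a = -1` its inverse. -/
def rotHom (a : ZMod n) : Zigzag k n →ₐ[k] Zigzag k n :=
  liftHom k (fun g => gen k (g.rot a)) (by
    intro x y h
    cases h with
    | vertex_mul_self i => simp [Gen.rot, gen_vertex_mul_self]
    | vertex_mul_vertex i j h =>
      simpa [Gen.rot] using gen_vertex_mul_vertex k (i + a) (j + a) (by simpa using h)
    | sum_vertex =>
      simp only [map_sum, FreeAlgebra.lift_ι_apply, Gen.rot, map_one]
      rw [← sum_gen_vertex k]
      exact Fintype.sum_equiv (Equiv.addRight a) _ _ (fun _ => rfl)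
    | vertex_mul_up i => simpa [Gen.rot] using gen_vertex_mul_up k (i + a)
    | up_mul_vertex i =>
      simpa [Gen.rot, add_right_comm] using gen_up_mul_vertex k (i + a)
    | vertex_mul_down i => simpa [Gen.rot, add_right_comm] using gen_vertex_mul_down k (i + a)
    | down_mul_vertex i => simpa [Gen.rot] using gen_down_mul_vertex k (i + a)
    | loop i => simpa [Gen.rot, add_right_comm] using gen_loop k (i + a)
    | up_mul_up i => simpa [Gen.rot, add_right_comm] using gen_up_mul_up k (i + a)
    | down_mul_down i => simpa [Gen.rot, add_right_comm] using gen_down_mul_down k (i + a))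

theorem rotHom_gen (a : ZMod n) (g : Gen n) : rotHom k a (gen k g) = gen k (g.rot a) :=
  liftHom_gen k _ _ g

end Algebra

section DGModules

open MulOpposite

/-- A bigraded differential graded right module over `R_n` (whose differential is zero). -/
structure DGMod (k : Type u) [Field k] (n : ℕ) [NeZero n] (N : ℤ) : Type (u + 1) where
  /-- the underlying module -/
  carrier : Type u
  [addCommGroup : AddCommGroup carrier]
  [module : Module k carrier]
  [rightModule : Module (Zigzag k n)ᵐᵒᵖ carrier]
  [isScalarTower : IsScalarTower k (Zigzag k n)ᵐᵒᵖ carrier]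
  /-- the bigrading -/
  gr : Bideg → Submodule k carrier
  isInternal : DirectSum.IsInternal gr
  smul_mem : ∀ (a b : Bideg) (m : carrier) (r : Zigzag k n), m ∈ gr a →
    r ∈ bigrading k N b → op r • m ∈ gr (a + b)
  /-- the differential, of bidegree `(1, 0)`; as the differential of `R_n` is zero and the
  modules are right modules, the Leibniz rule says that it is linear over `R_n` -/
  d : carrier →ₗ[(Zigzag k n)ᵐᵒᵖ] carrier
  d_mem : ∀ (a : Bideg) (m : carrier), m ∈ gr a → d m ∈ gr (a + (1, 0))
  d_d : ∀ m, d (d m) = 0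

attribute [instance] DGMod.addCommGroup DGMod.module DGMod.rightModule DGMod.isScalarTower

variable {k : Type u} [Field k] {n : ℕ} [NeZero n] {N : ℤ}

namespace DGMod

/-- A morphism of bigraded dg modules: linear over `R_n`, of bidegree zero, and commuting with
the differentials. -/
@[ext]
structure Hom (X Y : DGMod k n N) : Type u where
  /-- the underlying linear map -/
  lin : X.carrier →ₗ[(Zigzag k n)ᵐᵒᵖ] Y.carrier
  map_mem : ∀ (a : Bideg) (x : X.carrier), x ∈ X.gr a → lin x ∈ Y.gr a
  comm : ∀ x, lin (X.d x) = Y.d (lin x)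

instance : Category (DGMod k n N) where
  Hom X Y := Hom X Y
  id X := ⟨LinearMap.id, fun _ _ h => h, fun _ => rfl⟩
  comp f g := ⟨g.lin.comp f.lin, fun a x h => g.map_mem a _ (f.map_mem a x h), fun x => by
    simp [f.comm, g.comm]⟩

@[ext]
theorem hom_ext {X Y : DGMod k n N} (f g : X ⟶ Y) (h : ∀ x, f.lin x = g.lin x) : f = g :=
  Hom.ext (LinearMap.ext h)

theorem id_lin (X : DGMod k n N) (x : X.carrier) : Hom.lin (𝟙 X) x = x := rfl

theorem comp_lin {X Y Z : DGMod k n N} (f : X ⟶ Y) (g : Y ⟶ Z) (x : X.carrier) :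
    Hom.lin (f ≫ g) x = g.lin (f.lin x) := rfl

/-- The total homology `H(X) = ker d / im d`. -/
abbrev homology (X : DGMod k n N) : Type u :=
  LinearMap.ker X.d ⧸ (LinearMap.range X.d).submoduleOf (LinearMap.ker X.d)

/-- The map induced on homology by a morphism. -/
def homologyMap {X Y : DGMod k n N} (f : X ⟶ Y) :
    X.homology →ₗ[(Zigzag k n)ᵐᵒᵖ] Y.homology :=
  Submodule.mapQ _ _ (f.lin.restrict (p := LinearMap.ker X.d) (q := LinearMap.ker Y.d)
    (fun x hx => by
      rw [LinearMap.mem_ker] at hx ⊢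
      rw [← f.comm, hx, map_zero])) (by
    rintro ⟨x, hx⟩ ⟨z, hz⟩
    exact ⟨f.lin z, by rw [← f.comm, hz]; rfl⟩)

/-- The quasi-isomorphisms. -/
def quasiIso (k : Type u) [Field k] (n : ℕ) [NeZero n] (N : ℤ) :
    MorphismProperty (DGMod k n N) :=
  fun _ _ f => Function.Bijective (homologyMap f)

/-- The differential as a `k`-linear map. -/
abbrev dk (X : DGMod k n N) : X.carrier →ₗ[k] X.carrier := X.d.restrictScalars k

/-- The underlying `k`-linear map of a morphism. -/
abbrev Hom.link {X Y : DGMod k n N} (f : X ⟶ Y) : X.carrier →ₗ[k] Y.carrier :=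
  (Hom.lin f).restrictScalars k

theorem quasiIso_iff {X Y : DGMod k n N} (f : X ⟶ Y) :
    quasiIso k n N f ↔ ElemQuasiIso X.dk Y.dk (Hom.link f) := by
  have mkX : ∀ x : LinearMap.ker X.d,
      (Submodule.Quotient.mk x : X.homology) = 0 ↔ ∃ z, (x : X.carrier) = X.d z := by
    intro x
    rw [Submodule.Quotient.mk_eq_zero]
    exact ⟨fun ⟨z, hz⟩ => ⟨z, hz.symm⟩, fun ⟨z, hz⟩ => ⟨z, hz.symm⟩⟩
  have mkY : ∀ x : LinearMap.ker Y.d,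
      (Submodule.Quotient.mk x : Y.homology) = 0 ↔ ∃ z, (x : Y.carrier) = Y.d z := by
    intro x
    rw [Submodule.Quotient.mk_eq_zero]
    exact ⟨fun ⟨z, hz⟩ => ⟨z, hz.symm⟩, fun ⟨z, hz⟩ => ⟨z, hz.symm⟩⟩
  refine and_congr ?_ ?_
  · rw [injective_iff_map_eq_zero]
    constructor
    · intro h x hx hy
      exact (mkX ⟨x, hx⟩).1 (h (Submodule.Quotient.mk ⟨x, hx⟩) ((mkY _).2 hy))
    · intro h a
      obtain ⟨⟨x, hx⟩, rfl⟩ := Submodule.Quotient.mk_surjective _ a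
      intro ha
      exact (mkX ⟨x, hx⟩).2 (h x hx ((mkY _).1 ha))
  · constructor
    · intro h y hy
      obtain ⟨a, ha⟩ := h (Submodule.Quotient.mk ⟨y, hy⟩)
      obtain ⟨⟨x, hx⟩, rfl⟩ := Submodule.Quotient.mk_surjective _ a
      have h2 := (Submodule.Quotient.eq _).1 ha
      obtain ⟨z, hz⟩ := h2
      have hz : Y.d z = f.lin x - y := hz
      exact ⟨x, hx, -z, by
        change y = f.lin x + Y.d (-z)
        rw [map_neg, hz]; abel⟩
    · intro h b
      obtain ⟨⟨y, hy⟩, rfl⟩ := Submodule.Quotient.mk_surjective _ b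
      obtain ⟨x, hx, z, hz⟩ := h y hy
      have hz : y = f.lin x + Y.d z := hz
      refine ⟨Submodule.Quotient.mk ⟨x, hx⟩, (Submodule.Quotient.eq _).2 ⟨-z, ?_⟩⟩
      change Y.d (-z) = f.lin x - y
      rw [map_neg, hz]; abel

/-- An isomorphism of bigraded dg modules from a linear equivalence. -/
def isoMk {X Y : DGMod k n N} (e : X.carrier ≃ₗ[(Zigzag k n)ᵐᵒᵖ] Y.carrier)
    (h : ∀ (a : Bideg) (x : X.carrier), x ∈ X.gr a → e x ∈ Y.gr a)
    (h' : ∀ (a : Bideg) (y : Y.carrier), y ∈ Y.gr a → e.symm y ∈ X.gr a)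
    (hd : ∀ x, e (X.d x) = Y.d (e x)) : X ≅ Y where
  hom := (⟨e.toLinearMap, h, hd⟩ : Hom X Y)
  inv := (⟨e.symm.toLinearMap, h', fun y => by
    simp only [LinearEquiv.coe_coe]
    rw [LinearEquiv.symm_apply_eq, hd, LinearEquiv.apply_symm_apply]⟩ : Hom Y X)
  hom_inv_id := by
    apply hom_ext; intro x
    exact e.symm_apply_apply x
  inv_hom_id := by
    apply hom_ext; intro x
    exact e.apply_symm_apply x

section Shift

/-- The sign `(-1)^p` of a bidegree `(p, q)`. -/
def sgn (s : Bideg) : ℤ := ((s.1.negOnePow : ℤˣ) : ℤ)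

theorem sgn_mul_self (s : Bideg) : sgn s * sgn s = 1 := by
  unfold sgn
  rw [← Units.val_mul, ← Int.negOnePow_add, Int.negOnePow_even _ ⟨s.1, rfl⟩]
  rfl

theorem sgn_add (s t : Bideg) : sgn (s + t) = sgn s * sgn t := by
  simp [sgn, Int.negOnePow_add]

theorem sgn_zero : sgn 0 = 1 := by simp [sgn]

/-- The shift by a bidegree `s`: the piece of bidegree `c` of the shift of `X` is the piece of
bidegree `c + s` of `X`, and the differential is multiplied by the sign of `s`. -/
@[reducible]
def shiftObj (s : Bideg) (X : DGMod k n N) : DGMod k n N where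
  carrier := X.carrier
  gr c := X.gr (c + s)
  isInternal := isInternal_shift X.isInternal s
  smul_mem a b m r hm hr := by
    have := X.smul_mem _ b m r hm hr
    rwa [add_right_comm] at this
  d := sgn s • X.d
  d_mem a m hm := by
    have := X.d_mem _ m hm
    rw [add_right_comm] at this
    exact zsmul_mem this _
  d_d m := by simp [X.d_d]

/-- The functor given by the shift by a bidegree. -/
def shiftBy (k : Type u) [Field k] (n : ℕ) [NeZero n] (N : ℤ) (s : Bideg) :
    DGMod k n N ⥤ DGMod k n N where
  obj X := shiftObj s X
  map {X Y} f := (⟨f.lin, fun a x h => f.map_mem _ x h, fun x => by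
    change f.lin (sgn s • X.d x) = sgn s • Y.d (f.lin x)
    rw [map_zsmul, f.comm]⟩ : Hom (shiftObj s X) (shiftObj s Y))

/-- The identity map, as a morphism between two shifts of `X` that agree. -/
def shiftHom (X : DGMod k n N) {Y Z : DGMod k n N} (s t : Bideg) (h : s = t)
    (hY : Y = shiftObj s X) (hZ : Z = shiftObj t X) : Y ⟶ Z := eqToHom (by rw [hY, hZ, h])

theorem eqToHom_shift_lin (X : DGMod k n N) (s t : Bideg) (h : s = t)
    (h' : shiftObj s X = shiftObj t X) (x : X.carrier) : Hom.lin (eqToHom h') x = x := by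
  subst h; rfl

/-- The identity map as an isomorphism between the shift by `0` and the identity. -/
def shiftByZero (s : Bideg) (hs : s = 0) : shiftBy k n N s ≅ 𝟭 _ :=
  NatIso.ofComponents (fun X => isoMk (X := shiftObj s X) (Y := X) (LinearEquiv.refl _ _)
    (fun a x h => by subst hs; simpa using h) (fun a x h => by subst hs; simpa using h)
    (fun x => by subst hs; simp [sgn_zero])) (fun f => rfl)

/-- The identity map as an isomorphism between a shift and an iterated shift. -/
def shiftByAdd (s t r : Bideg) (hr : r = s + t) :
    shiftBy k n N r ≅ shiftBy k n N s ⋙ shiftBy k n N t :=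
  NatIso.ofComponents (fun X => isoMk (X := shiftObj r X) (Y := shiftObj t (shiftObj s X))
    (LinearEquiv.refl _ _)
    (fun a x h => by
      subst hr
      change x ∈ X.gr (a + t + s)
      rw [add_assoc, add_comm t s]; exact h)
    (fun a x h => by
      subst hr
      change x ∈ X.gr (a + (s + t))
      rw [add_comm s t, ← add_assoc]; exact h)
    (fun x => by
      subst hr
      change sgn (s + t) • X.d x = sgn t • sgn s • X.d x
      rw [smul_smul, sgn_add, mul_comm])) (fun f => rfl)

/-- The shifts by the bidegrees in the image of a homomorphism. -/
def shiftCore (k : Type u) [Field k] (n : ℕ) [NeZero n] (N : ℤ) {A : Type} [AddGroup A]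
    (φ : A →+ Bideg) : ShiftMkCore (DGMod k n N) A where
  F a := shiftBy k n N (φ a)
  zero := shiftByZero _ φ.map_zero
  add a b := shiftByAdd _ _ _ (φ.map_add a b)
  assoc_hom_app a b c X := by
    apply hom_ext; intro x
    refine Eq.trans ?_ (comp_lin _ _ _).symm
    refine Eq.trans ?_ (congrArg _ (eqToHom_shift_lin X (φ (a + b + c)) (φ (a + (b + c)))
      (by rw [add_assoc]) _ x).symm)
    rfl
  zero_add_hom_app a X := by
    apply hom_ext; intro x
    refine Eq.trans ?_ (comp_lin _ _ _).symm
    refine Eq.trans ?_ (congrArg _ (eqToHom_shift_lin X (φ (0 + a)) (φ a)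
      (by rw [zero_add]) _ x).symm)
    rfl
  add_zero_hom_app a X := by
    apply hom_ext; intro x
    refine Eq.trans ?_ (comp_lin _ _ _).symm
    refine Eq.trans ?_ (congrArg _ (eqToHom_shift_lin X (φ (a + 0)) (φ a)
      (by rw [add_zero]) _ x).symm)
    rfl

/-- The group of the shifts of the second degree; a copy of `ℤ`. -/
def Second : Type := ℤ

instance : AddCommGroup Second := inferInstanceAs (AddCommGroup ℤ)

/-- The shift `[a]` of the first degree: `X[a]^{p,q} = X^{p+a,q}`. -/
def firstHom : ℤ →+ Bideg := AddMonoidHom.inl ℤ ℤ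

/-- The shift `⟨b⟩` of the second degree: `X⟨b⟩^{p,q} = X^{p,q-b}`. -/
def secondHom : Second →+ Bideg := -(AddMonoidHom.inr ℤ ℤ)

instance : HasShift (DGMod k n N) ℤ := hasShiftMk _ _ (shiftCore k n N firstHom)

instance : HasShift (DGMod k n N) Second := hasShiftMk _ _ (shiftCore k n N secondHom)

theorem quasiIso_shift_iff {X Y : DGMod k n N} (f : X ⟶ Y) (s : Bideg) :
    quasiIso k n N ((shiftBy k n N s).map f) ↔ quasiIso k n N f := by
  rw [quasiIso_iff, quasiIso_iff]
  have hs : ∀ {V : Type u} [AddCommGroup V] (x : V), sgn s • sgn s • x = x := by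
    intro V _ x
    rw [smul_smul, sgn_mul_self, one_smul]
  exact ⟨fun h => h.smul (d := (shiftObj s X).dk) (sgn s) (sgn_mul_self s)
      (fun x => (hs (X.d x)).symm) (fun x => (hs (Y.d x)).symm),
    fun h => h.smul (sgn s) (sgn_mul_self s) (fun _ => rfl) (fun _ => rfl)⟩

instance : (quasiIso k n N).IsCompatibleWithShift ℤ where
  condition a := by
    ext X Y f
    exact quasiIso_shift_iff f (firstHom a)

instance : (quasiIso k n N).IsCompatibleWithShift Second where
  condition a := by
    ext X Y f
    exact quasiIso_shift_iff f (secondHom a)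

end Shift

end DGMod

end DGModules

section Functors

open MulOpposite

variable {k : Type u} [Field k] {n : ℕ} [NeZero n] {N : ℤ}

namespace DGMod

/-- The mapping cone of a morphism `f : X ⟶ Y`: it is `X[1] ⊕ Y`, with the differential
`(x, y) ↦ (-d x, f x + d y)`. -/
@[reducible]
def cone {X Y : DGMod k n N} (f : X ⟶ Y) : DGMod k n N where
  carrier := X.carrier × Y.carrier
  gr c := (X.gr (c + (1, 0))).prod (Y.gr c)
  isInternal := isInternal_prod X.isInternal Y.isInternal (1, 0)
  smul_mem a b m r hm hr := by
    refine ⟨?_, Y.smul_mem _ _ _ _ hm.2 hr⟩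
    have := X.smul_mem _ _ _ _ hm.1 hr
    rwa [add_right_comm] at this
  d := LinearMap.prod (-(X.d.comp (LinearMap.fst _ X.carrier Y.carrier)))
    ((Hom.lin f).coprod Y.d)
  d_mem a m hm := by
    refine ⟨neg_mem (X.d_mem _ _ hm.1), add_mem (f.map_mem _ _ hm.1) (Y.d_mem _ _ hm.2)⟩
  d_d m := by
    simp [X.d_d, Y.d_d, ← f.comm]

/-- The map between mapping cones induced by a commutative square. -/
def coneMap {X Y X' Y' : DGMod k n N} {f : X ⟶ Y} {f' : X' ⟶ Y'} (g : X ⟶ X') (h : Y ⟶ Y')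
    (sq : f ≫ h = g ≫ f') : cone f ⟶ cone f' :=
  (⟨(Hom.lin g).prodMap (Hom.lin h),
    fun a x hx => ⟨g.map_mem _ _ hx.1, h.map_mem _ _ hx.2⟩, fun x => by
      have := congrArg (fun t => Hom.lin t x.1) sq
      simp only [comp_lin] at this
      simp [g.comm, h.comm, this]⟩ : Hom (cone f) (cone f'))

theorem quasiIso_coneMap {X Y X' Y' : DGMod k n N} {f : X ⟶ Y} {f' : X' ⟶ Y'} (g : X ⟶ X')
    (h : Y ⟶ Y') (sq : f ≫ h = g ≫ f') (hg : quasiIso k n N g) (hh : quasiIso k n N h) :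
    quasiIso k n N (coneMap g h sq) := by
  rw [quasiIso_iff] at hg hh ⊢
  exact ElemQuasiIso.cone (f := Hom.link f) (f' := Hom.link f') hg hh f.comm f'.comm g.comm h.comm
    (fun x => congrArg (fun t => Hom.lin t x) sq)

/-- The standard triangle `X ⟶ Y ⟶ cone f ⟶ X[1]`. -/
def coneTriangle {X Y : DGMod k n N} (f : X ⟶ Y) : Pretriangulated.Triangle (DGMod k n N) :=
  Pretriangulated.Triangle.mk f
    (⟨LinearMap.inr _ X.carrier Y.carrier, fun a y hy => ⟨zero_mem _, hy⟩, fun y => by simp⟩ :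
      Hom Y (cone f))
    (⟨LinearMap.fst _ X.carrier Y.carrier, fun a y hy => hy.1, fun y => by
      simp [sgn, firstHom]⟩ : Hom (cone f) (shiftObj (firstHom 1) X))

/-- The subspace `X (i)` of a right dg module; it is the tensor product `X ⊗ R_n (i)` over
`R_n` with the left projective module `R_n (i)`. -/
def corner (X : DGMod k n N) (i : ZMod n) : Submodule k X.carrier where
  carrier := {m | op (idem k i) • m = m}
  add_mem' {a b} ha hb := by
    simp only [Set.mem_ofPred_eq] at ha hb ⊢
    rw [smul_add, ha, hb]
  zero_mem' := smul_zero _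
  smul_mem' c m hm := by
    simp only [Set.mem_ofPred_eq] at hm ⊢
    rw [smul_comm, hm]

/-- The indecomposable right projective module `P_i = (i) R_n`. -/
def proj (k : Type u) [Field k] {n : ℕ} [NeZero n] (i : ZMod n) :
    Submodule (Zigzag k n)ᵐᵒᵖ (Zigzag k n) where
  carrier := {x | idem k i * x = x}
  add_mem' {a b} ha hb := by
    simp only [Set.mem_ofPred_eq] at ha hb ⊢
    rw [mul_add, ha, hb]
  zero_mem' := mul_zero _
  smul_mem' c m hm := by
    simp only [Set.mem_ofPred_eq] at hm ⊢
    rw [← op_unop c, op_smul_eq_mul, ← mul_assoc, hm]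

/-- The bigrading of `X (i)`. -/
def cornerGr (X : DGMod k n N) (i : ZMod n) (c : Bideg) : Submodule k (X.corner i) :=
  (X.gr c).comap (X.corner i).subtype

/-- The bigrading of `P_i`. -/
def projGr (N : ℤ) (i : ZMod n) (c : Bideg) : Submodule k (proj k i) :=
  (bigrading k N c).comap ((proj k i).subtype.restrictScalars k)

/-- The action of an element of `R_n` on the right as a `k`-linear map. -/
def actK (X : DGMod k n N) (r : Zigzag k n) : X.carrier →ₗ[k] X.carrier where
  toFun m := op r • m
  map_add' := smul_add _
  map_smul' _ _ := smul_comm _ _ _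

theorem actK_idem (X : DGMod k n N) (i : ZMod n) (m : X.carrier) :
    X.actK (idem k i) (X.actK (idem k i) m) = X.actK (idem k i) m := by
  change op (idem k i) • op (idem k i) • m = op (idem k i) • m
  rw [smul_smul, ← op_mul, gen_vertex_mul_self]

theorem isInternal_cornerGr (X : DGMod k n N) (i : ZMod n) :
    DirectSum.IsInternal (X.cornerGr i) := by
  refine isInternal_comap X.isInternal (X.corner i).subtype
    ((X.actK (idem k i)).codRestrict (X.corner i) (fun m => X.actK_idem i m)) ?_ ?_
  · intro w
    exact Subtype.ext w.2
  · intro c x hx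
    have := X.smul_mem c 0 x _ hx (idem_mem k N i)
    rwa [add_zero] at this

theorem isInternal_projGr (N : ℤ) (i : ZMod n) :
    DirectSum.IsInternal (projGr (k := k) N i) := by
  refine isInternal_comap (isInternal_bigrading k N) ((proj k i).subtype.restrictScalars k)
    ((LinearMap.mulLeft k (idem k i)).codRestrict ((proj k i).restrictScalars k) (fun m => ?_))
    ?_ ?_
  · change idem k i * (idem k i * m) = idem k i * m
    rw [← mul_assoc, gen_vertex_mul_self]
  · intro w
    exact Subtype.ext w.2
  · intro c x hx
    have := mul_mem_bigrading k N (idem_mem k N i) hx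
    rwa [zero_add] at this

/-- The differential of `X (i)`. -/
def cornerD (X : DGMod k n N) (i : ZMod n) : X.corner i →ₗ[k] X.corner i :=
  X.dk.restrict (fun m hm => by
    change op (idem k i) • X.d m = X.d m
    rw [← map_smul, show op (idem k i) • m = m from hm])

/-- The total bigrading of `P_i ⊗ X (i)`. -/
def twistGr (X : DGMod k n N) (i : ZMod n) :
    Bideg → Submodule k (proj k i ⊗[k] X.corner i) :=
  tensorGrading (projGr N i) (X.cornerGr i)

theorem isInternal_twistGr (X : DGMod k n N) (i : ZMod n) :
    DirectSum.IsInternal (X.twistGr i) :=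
  isInternal_tensorGrading (isInternal_projGr N i) (X.isInternal_cornerGr i)

/-- The dg module `X ⊗ R_n (i) ⊗ P_i`, the first tensor product being over `R_n` and the second
over `k`. It is realized on the space `P_i ⊗ X (i)`: the tensor `m ⊗ p` is written `p ⊗ m`,
the right action is that of `P_i`, the differential sends `m ⊗ p` to `(d m) ⊗ p`, and the
bidegree is the total one. -/
@[reducible]
def twistObj (i : ZMod n) (X : DGMod k n N) : DGMod k n N where
  carrier := proj k i ⊗[k] X.corner i
  addCommGroup := TensorProduct.addCommGroup
  module := TensorProduct.instModule
  rightModule := TensorProduct.leftModule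
  isScalarTower := TensorProduct.isScalarTower_left
  gr := X.twistGr i
  isInternal := X.isInternal_twistGr i
  smul_mem a b m r hm hr := by
    induction hm using Submodule.span_induction with
    | mem t ht =>
      obtain ⟨a, a', rfl, p, hp, x, hx, rfl⟩ := ht
      rw [TensorProduct.smul_tmul']
      refine Submodule.subset_span ⟨a + b, a', add_right_comm _ _ _, _, ?_, x, hx, rfl⟩
      exact mul_mem_bigrading k N hp hr
    | zero => rw [smul_zero]; exact zero_mem _
    | add x y _ _ hx hy => rw [smul_add]; exact add_mem hx hy
    | smul c x _ hx => rw [smul_comm]; exact Submodule.smul_mem _ _ hx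
  d := TensorProduct.AlgebraTensorModule.lTensor (Zigzag k n)ᵐᵒᵖ (proj k i) (X.cornerD i)
  d_mem a m hm := by
    induction hm using Submodule.span_induction with
    | mem t ht =>
      obtain ⟨a, a', rfl, p, hp, x, hx, rfl⟩ := ht
      exact Submodule.subset_span ⟨a, a' + (1, 0), (add_assoc _ _ _).symm, p, hp, _,
        X.d_mem _ _ hx, rfl⟩
    | zero => rw [map_zero]; exact zero_mem _
    | add x y _ _ hx hy => rw [map_add]; exact add_mem hx hy
    | smul c x _ hx =>
      rw [LinearMap.map_smul_of_tower]; exact Submodule.smul_mem _ _ hx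
  d_d m := by
    induction m using TensorProduct.induction_on with
    | zero => simp
    | add x y hx hy => rw [map_add, map_add, hx, hy, add_zero]
    | tmul p x =>
      change p ⊗ₜ[k] (X.cornerD i (X.cornerD i x)) = 0
      rw [show X.cornerD i (X.cornerD i x) = 0 from Subtype.ext (X.d_d x), tmul_zero]

/-- The map `X (i) → Y (i)` induced by a morphism `X ⟶ Y`. -/
def cornerMap {X Y : DGMod k n N} (f : X ⟶ Y) (i : ZMod n) : X.corner i →ₗ[k] Y.corner i :=
  (Hom.link f).restrict (fun m hm => by
    change op (idem k i) • f.lin m = f.lin m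
    rw [← map_smul, show op (idem k i) • m = m from hm])

/-- The functoriality of `X ⊗ R_n (i) ⊗ P_i`. -/
def twistMap (i : ZMod n) {X Y : DGMod k n N} (f : X ⟶ Y) : twistObj i X ⟶ twistObj i Y :=
  (⟨TensorProduct.AlgebraTensorModule.lTensor (Zigzag k n)ᵐᵒᵖ (proj k i) (cornerMap f i), by
    intro a m hm
    induction hm using Submodule.span_induction with
    | mem t ht =>
      obtain ⟨a, a', rfl, p, hp, x, hx, rfl⟩ := ht
      exact Submodule.subset_span ⟨a, a', rfl, p, hp, _, f.map_mem _ _ hx, rfl⟩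
    | zero => rw [map_zero]; exact zero_mem _
    | add x y _ _ hx hy => rw [map_add]; exact add_mem hx hy
    | smul c x _ hx =>
      rw [LinearMap.map_smul_of_tower]; exact Submodule.smul_mem _ _ hx, by
    intro m
    induction m using TensorProduct.induction_on with
    | zero => simp
    | add x y hx hy => simp only [map_add, hx, hy]
    | tmul p x =>
      exact congrArg (fun t => p ⊗ₜ[k] t) (Subtype.ext (f.comm x))⟩ :
    Hom (twistObj i X) (twistObj i Y))

/-- The evaluation map `X ⊗ R_n (i) ⊗ P_i ⟶ X`, `m ⊗ p ↦ m p`. -/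
def ev (i : ZMod n) (X : DGMod k n N) : twistObj i X ⟶ X :=
  (⟨TensorProduct.AlgebraTensorModule.lift
    { toFun := fun p => (X.actK (p : Zigzag k n)).comp (X.corner i).subtype
      map_add' := fun p q => LinearMap.ext fun m => by
        change op ((p : Zigzag k n) + q) • (m : X.carrier) =
          op (p : Zigzag k n) • m.1 + op (q : Zigzag k n) • m.1
        rw [MulOpposite.op_add, add_smul]
      map_smul' := fun r p => LinearMap.ext fun m => by
        change op ((p : Zigzag k n) * unop r) • (m : X.carrier) = r • op (p : Zigzag k n) • m.1
        rw [op_mul, op_unop, mul_smul] }, by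
    intro a m hm
    induction hm using Submodule.span_induction with
    | mem t ht =>
      obtain ⟨a, a', rfl, p, hp, x, hx, rfl⟩ := ht
      rw [add_comm a a']
      exact X.smul_mem _ _ _ _ hx hp
    | zero => rw [map_zero]; exact zero_mem _
    | add x y _ _ hx hy => rw [map_add]; exact add_mem hx hy
    | smul c x _ hx =>
      rw [LinearMap.map_smul_of_tower]; exact Submodule.smul_mem _ _ hx, by
    intro m
    induction m using TensorProduct.induction_on with
    | zero => simp
    | add x y hx hy => simp only [map_add, hx, hy]
    | tmul p x =>
      change op (p : Zigzag k n) • X.d x = X.d (op (p : Zigzag k n) • (x : X.carrier))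
      rw [map_smul]⟩ :
    Hom (twistObj i X) X)

theorem ev_naturality (i : ZMod n) {X Y : DGMod k n N} (f : X ⟶ Y) :
    ev i X ≫ f = twistMap i f ≫ ev i Y := by
  apply hom_ext
  intro m
  rw [comp_lin, comp_lin]
  induction m using TensorProduct.induction_on with
  | zero => simp
  | add x y hx hy => simp only [map_add, hx, hy]
  | tmul p x =>
    exact map_smul f.lin (op (p : Zigzag k n)) (x : X.carrier)

theorem quasiIso_twistMap (i : ZMod n) {X Y : DGMod k n N} (f : X ⟶ Y)
    (hf : quasiIso k n N f) : quasiIso k n N (twistMap i f) := by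
  rw [quasiIso_iff] at hf ⊢
  have hc : ElemQuasiIso (X.cornerD i) (Y.cornerD i) (cornerMap f i) :=
    hf.retract (X.corner i).subtype
      ((X.actK (idem k i)).codRestrict (X.corner i) (fun m => X.actK_idem i m))
      (Y.corner i).subtype
      ((Y.actK (idem k i)).codRestrict (Y.corner i) (fun m => Y.actK_idem i m))
      (fun x => Subtype.ext x.2) (fun x => Subtype.ext x.2) (fun _ => rfl) (fun _ => rfl)
      (fun x => Subtype.ext (map_smul X.d (op (idem k i)) x).symm)
      (fun x => Subtype.ext (map_smul Y.d (op (idem k i)) x).symm)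
      (fun _ => rfl)
      (fun x => Subtype.ext (map_smul f.lin (op (idem k i)) x).symm)
  exact hc.lTensor (proj k i)

/-- The twist functor `T_i` on dg modules: `X` is sent to the mapping cone of the evaluation
map `X ⊗ R_n (i) ⊗ P_i ⟶ X`. -/
def twistFunctor (k : Type u) [Field k] {n : ℕ} [NeZero n] (N : ℤ) (i : ZMod n) :
    DGMod k n N ⥤ DGMod k n N where
  obj X := cone (ev i X)
  map f := coneMap (twistMap i f) f (ev_naturality i f)
  map_id X := by
    apply hom_ext
    rintro ⟨x, y⟩
    refine Prod.ext ?_ rfl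
    change (twistMap i (𝟙 X)).lin x = x
    induction x using TensorProduct.induction_on with
    | zero => simp
    | add x y hx hy => simp only [map_add, hx, hy]
    | tmul p x => rfl
  map_comp {X Y Z} f g := by
    apply hom_ext
    rintro ⟨x, y⟩
    refine Prod.ext ?_ rfl
    change (twistMap i (f ≫ g)).lin x = (twistMap i g).lin ((twistMap i f).lin x)
    induction x using TensorProduct.induction_on with
    | zero => simp
    | add x y hx hy => simp only [map_add, hx, hy]
    | tmul p x => rfl

end DGMod

end Functors

section Rotation

open MulOpposite Gen

variable {k : Type u} [Field k] {n : ℕ} [NeZero n] {N : ℤ}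

namespace DGMod

theorem actK_idem_ne (X : DGMod k n N) (i j : ZMod n) (m : X.carrier) (h : i ≠ j) :
    X.actK (idem k j) (X.actK (idem k i) m) = 0 := by
  change op (idem k j) • op (idem k i) • m = 0
  rw [smul_smul, ← op_mul, gen_vertex_mul_vertex k i j h, op_zero, zero_smul]

theorem sum_actK_idem (X : DGMod k n N) (m : X.carrier) : ∑ i, X.actK (idem k i) m = m := by
  change ∑ i, op (idem k i) • m = m
  rw [← Finset.sum_smul, ← Finset.op_sum, sum_gen_vertex, op_one, one_smul]

/-- The bigrading of a right dg module that is shifted by `s i` on the summand `X (i)`. -/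
def regrade (X : DGMod k n N) (s : ZMod n → Bideg) (c : Bideg) : Submodule k X.carrier :=
  ⨅ i, (X.gr (c + s i)).comap (X.actK (idem k i))

theorem mem_regrade (X : DGMod k n N) (s : ZMod n → Bideg) (c : Bideg) (m : X.carrier) :
    m ∈ X.regrade s c ↔ ∀ i, op (idem k i) • m ∈ X.gr (c + s i) := by
  simp only [regrade, Submodule.mem_iInf, Submodule.mem_comap]
  rfl

theorem isInternal_regraded (X : DGMod k n N) (s : ZMod n → Bideg) :
    DirectSum.IsInternal (X.regrade s) :=
  isInternal_regrade X.isInternal (fun i => X.actK (idem k i)) (fun i m => X.actK_idem i m)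
    (fun i j m h => X.actK_idem_ne i j m h) X.sum_actK_idem (fun i c x hx => by
      have := X.smul_mem c 0 x _ hx (idem_mem k N i)
      rwa [add_zero] at this) s

theorem regrade_gen (X : DGMod k n N) (a : ZMod n) (s : ZMod n → Bideg)
    (hs : ∀ i, s i + deg N (up i) = deg N (up (i + a)) + s (i + 1)) (c : Bideg) (g : Gen n)
    (m : X.carrier) (hm : m ∈ X.regrade s c) :
    op (gen k (g.rot (-a))) • m ∈ X.regrade s (c + deg N g) := by
  rw [mem_regrade] at hm ⊢
  intro j
  rw [smul_smul, ← op_mul]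
  cases g with
  | vertex i =>
    simp only [Gen.rot]
    by_cases hij : i + -a = j
    · subst hij
      rw [gen_vertex_mul_self, show deg N (vertex i) = 0 from rfl, add_zero]
      exact hm _
    · rw [gen_vertex_mul_vertex k _ _ hij, op_zero, zero_smul]
      exact zero_mem _
  | up i =>
    simp only [Gen.rot]
    obtain ⟨i, rfl⟩ : ∃ i', i = i' + a := ⟨i - a, by simp⟩
    rw [add_neg_cancel_right]
    by_cases hij : i + 1 = j
    · subst hij
      rw [gen_up_mul_vertex, ← gen_vertex_mul_up, op_mul, ← smul_smul, add_assoc, ← hs,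
        ← add_assoc]
      exact X.smul_mem _ _ _ _ (hm i) (gen_mem k N _)
    · rw [← gen_up_mul_vertex, mul_assoc, gen_vertex_mul_vertex k _ _ hij, mul_zero, op_zero,
        zero_smul]
      exact zero_mem _
  | down i =>
    simp only [Gen.rot]
    obtain ⟨i, rfl⟩ : ∃ i', i = i' + a := ⟨i - a, by simp⟩
    rw [add_neg_cancel_right]
    by_cases hij : i = j
    · subst hij
      have h1 := hs i
      have h2 := deg_up_add_deg_down N i (i + a)
      have h3 : deg N (down (i + a)) + s i = s (i + 1) + deg N (down i) := by
        have h4 : deg N (up (i + a)) + (deg N (down (i + a)) + s i) =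
            deg N (up (i + a)) + (s (i + 1) + deg N (down i)) := by
          rw [← add_assoc, ← h2, ← add_assoc, ← h1]
          abel
        exact add_left_cancel h4
      rw [gen_down_mul_vertex, ← gen_vertex_mul_down, op_mul, ← smul_smul, add_assoc, h3,
        ← add_assoc]
      exact X.smul_mem _ _ _ _ (hm (i + 1)) (gen_mem k N _)
    · rw [← gen_down_mul_vertex, mul_assoc, gen_vertex_mul_vertex k _ _ hij, mul_zero, op_zero,
        zero_smul]
      exact zero_mem _

theorem regrade_smul (X : DGMod k n N) (a : ZMod n) (s : ZMod n → Bideg)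
    (hs : ∀ i, s i + deg N (up i) = deg N (up (i + a)) + s (i + 1)) (c b : Bideg)
    (m : X.carrier) (r : Zigzag k n) (hm : m ∈ X.regrade s c) (hr : r ∈ bigrading k N b) :
    op (rotHom k (-a) r) • m ∈ X.regrade s (c + b) := by
  induction hr using Submodule.span_induction with
  | zero => rw [map_zero, op_zero, zero_smul]; exact zero_mem _
  | add x y _ _ hx hy => rw [map_add, MulOpposite.op_add, add_smul]; exact add_mem hx hy
  | smul t x _ hx =>
    rw [map_smul, MulOpposite.op_smul, smul_assoc]; exact Submodule.smul_mem _ _ hx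
  | mem x hx =>
    obtain ⟨w, rfl, rfl⟩ := hx
    induction w generalizing m c with
    | nil => simpa using hm
    | cons g w ih =>
      rw [List.map_cons, List.map_cons, List.prod_cons, map_mul, op_mul, ← smul_smul, rotHom_gen,
        List.sum_cons, ← add_assoc]
      exact ih _ _ (X.regrade_gen a s hs c g m hm)

theorem d_smul (X : DGMod k n N) (r : Zigzag k n) (m : X.carrier) :
    X.d (op r • m) = op r • X.d m := map_smul X.d _ m

theorem Hom.lin_smul {X Y : DGMod k n N} (f : Hom X Y) (r : Zigzag k n) (m : X.carrier) :
    f.lin (op r • m) = op r • f.lin m := map_smul f.lin _ m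

theorem rot_smul (X : DGMod k n N) (a : ZMod n) (c : k) (r : (Zigzag k n)ᵐᵒᵖ) (m : X.carrier) :
    op (rotHom k a (unop (c • r))) • m = c • op (rotHom k a (unop r)) • m := by
  rw [MulOpposite.unop_smul, map_smul, MulOpposite.op_smul, smul_assoc]

/-- The right dg module obtained from `X` by twisting the action with the inverse of the
rotation by `a`, that is `m * r = m t(r)` with `t (i₁|…|i_m) = (i₁ - a|…|i_m - a)`, and by
shifting the bigrading by `s i` on the summand `X (i)`, which becomes the summand of the vertex
`i + a`. -/
@[reducible]
def rotObj (a : ZMod n) (s : ZMod n → Bideg)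
    (hs : ∀ i, s i + deg N (up i) = deg N (up (i + a)) + s (i + 1)) (X : DGMod k n N) :
    DGMod k n N where
  carrier := X.carrier
  addCommGroup := X.addCommGroup
  module := X.module
  rightModule := Module.compHom X.carrier (RingHom.op (rotHom k (-a)).toRingHom)
  isScalarTower :=
    letI : Module (Zigzag k n)ᵐᵒᵖ X.carrier :=
      Module.compHom X.carrier (RingHom.op (rotHom k (-a)).toRingHom)
    ⟨fun c r m => X.rot_smul (-a) c r m⟩
  gr := X.regrade s
  isInternal := X.isInternal_regraded s
  smul_mem c b m r hm hr := X.regrade_smul a s hs c b m r hm hr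
  d :=
    letI : Module (Zigzag k n)ᵐᵒᵖ X.carrier :=
      Module.compHom X.carrier (RingHom.op (rotHom k (-a)).toRingHom)
    { toFun := X.d
      map_add' := map_add X.d
      map_smul' := fun r m => X.d_smul _ m }
  d_mem c m hm := by
    rw [mem_regrade] at hm ⊢
    intro i
    have := X.d_mem _ _ (hm i)
    rw [map_smul, add_right_comm] at this
    exact this
  d_d m := X.d_d m

/-- The functoriality of `rotObj`. -/
def rotFunctor (k : Type u) [Field k] {n : ℕ} [NeZero n] (N : ℤ) (a : ZMod n)
    (s : ZMod n → Bideg) (hs : ∀ i, s i + deg N (up i) = deg N (up (i + a)) + s (i + 1)) :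
    DGMod k n N ⥤ DGMod k n N where
  obj X := rotObj a s hs X
  map {X Y} f := (
    { lin :=
        letI : Module (Zigzag k n)ᵐᵒᵖ X.carrier :=
          Module.compHom X.carrier (RingHom.op (rotHom k (-a)).toRingHom)
        letI : Module (Zigzag k n)ᵐᵒᵖ Y.carrier :=
          Module.compHom Y.carrier (RingHom.op (rotHom k (-a)).toRingHom)
        { toFun := f.lin
          map_add' := map_add f.lin
          map_smul' := fun r m => Hom.lin_smul f _ m }
      map_mem := fun c m hm => by
        have hm := (X.mem_regrade s c m).1 hm
        refine (Y.mem_regrade s c _).2 (fun i => ?_)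
        have := f.map_mem _ _ (hm i)
        rw [map_smul] at this
        exact this
      comm := f.comm } : Hom (rotObj a s hs X) (rotObj a s hs Y))

theorem quasiIso_rot (a : ZMod n) (s : ZMod n → Bideg)
    (hs : ∀ i, s i + deg N (up i) = deg N (up (i + a)) + s (i + 1)) {X Y : DGMod k n N}
    (f : X ⟶ Y) (hf : quasiIso k n N f) : quasiIso k n N ((rotFunctor k N a s hs).map f) := by
  rw [quasiIso_iff] at hf ⊢
  exact hf

/-- The shift `s` of the functor `F_ρ`, on the summand `X (i)`: in the second degree it is `1`
for `i = n` and zero otherwise; in the first degree it is zero for `N` even. -/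
def rhoShift (n : ℕ) [NeZero n] (N : ℤ) (i : ZMod n) : Bideg := (N / 2, 0) - deg N (up i)

/-- The functor `F_ρ` on dg modules. It sends `P_i` to `P_{i+1}` for `i < n` and
`P_n` to `P_1⟨-1⟩`, up to a shift of the first degree if `N` is odd. -/
def rhoFunctor (k : Type u) [Field k] (n : ℕ) [NeZero n] (N : ℤ) :
    DGMod k n N ⥤ DGMod k n N :=
  rotFunctor k N 1 (rhoShift n N) (fun i => by simp [rhoShift])

/-- The functor `F'_ρ` on dg modules. -/
def rhoFunctor' (k : Type u) [Field k] (n : ℕ) [NeZero n] (N : ℤ) :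
    DGMod k n N ⥤ DGMod k n N :=
  rotFunctor k N (-1) (fun i => -rhoShift n N (i - 1)) (fun i => by
    simp only [rhoShift, add_sub_cancel_right, ← sub_eq_add_neg]
    abel)

end DGMod

end Rotation

section CommShift

open MulOpposite

variable {k : Type u} [Field k] {n : ℕ} [NeZero n] {N : ℤ}

namespace DGMod

theorem twistGr_shift (X : DGMod k n N) (i : ZMod n) (s c : Bideg) :
    (shiftObj s X).twistGr i c = X.twistGr i (c + s) := by
  refine congrArg (Submodule.span k) (Set.ext fun t => ⟨?_, ?_⟩)
  · rintro ⟨a, b, rfl, p, hp, x, hx, rfl⟩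
    exact ⟨a, b + s, (add_assoc _ _ _).symm, p, hp, x, hx, rfl⟩
  · rintro ⟨a, b, h, p, hp, x, hx, rfl⟩
    refine ⟨a, b - s, ?_, p, hp, x, ?_, rfl⟩
    · rw [← add_sub_assoc, h, add_sub_cancel_right]
    · change (x : X.carrier) ∈ X.gr (b - s + s)
      rw [sub_add_cancel]
      exact hx

theorem twist_shift_d (X : DGMod k n N) (i : ZMod n) (s : Bideg) (x : (twistObj i X).carrier) :
    (twistObj i (shiftObj s X)).d x = sgn s • (twistObj i X).d x :=
  lTensor_zsmul (X.cornerD i) ((shiftObj s X).cornerD i) (sgn s) (fun _ => rfl) x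

theorem twist_sign (X : DGMod k n N) (i : ZMod n) (s c : Bideg) (x : (twistObj i X).carrier)
    (hx : x ∈ X.twistGr i c) : sgn s • x ∈ X.twistGr i c :=
  zsmul_mem_submodule (X.twistGr i c) (sgn s) x hx

theorem twist_sign_d (X : DGMod k n N) (i : ZMod n) (s : Bideg) (x : (twistObj i X).carrier) :
    sgn s • (-((twistObj i (shiftObj s X)).d x)) =
      sgn s • (-((twistObj i X).d (sgn s • x))) := by
  rw [map_zsmul]
  exact congrArg (fun t => sgn s • (-t)) (twist_shift_d X i s x)

theorem twist_sign_ev (X : DGMod k n N) (i : ZMod n) (s : Bideg) (x : (twistObj i X).carrier)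
    (y : X.carrier) : (ev i X).lin x + sgn s • X.d y =
      sgn s • ((ev i X).lin (sgn s • x) + X.d y) := by
  rw [map_zsmul, smul_add, smul_smul, sgn_mul_self, one_smul]

/-- The involution `(x, y) ↦ ((-1)^s x, y)`. -/
def signEquiv {A : Type*} [Ring A] {V W : Type*} [AddCommGroup V] [Module A V] [AddCommGroup W]
    [Module A W] (s : Bideg) : (V × W) ≃ₗ[A] (V × W) :=
  LinearEquiv.ofInvolutive ((sgn s • LinearMap.id).prodMap LinearMap.id) (by
    rintro ⟨x, y⟩
    simp [smul_smul, sgn_mul_self])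

/-- The isomorphism `(m ⊗ p, x) ↦ ((-1)^s m ⊗ p, x)` between the twist of the shift by `s`
and the shift by `s` of the twist. -/
def twistShiftIso (i : ZMod n) (s : Bideg) :
    shiftBy k n N s ⋙ twistFunctor k N i ≅ twistFunctor k N i ⋙ shiftBy k n N s :=
  NatIso.ofComponents (fun X =>
    isoMk (X := cone (ev i (shiftObj s X))) (Y := shiftObj s (cone (ev i X)))
      (signEquiv (V := (twistObj i X).carrier) (W := X.carrier) s)
      (fun a x hx => by
        have h1 : x.1 ∈ (shiftObj s X).twistGr i (a + (1, 0)) := hx.1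
        rw [twistGr_shift, add_right_comm] at h1
        exact ⟨twist_sign X i s _ _ h1, hx.2⟩)
      (fun a x hx => by
        have h1 : x.1 ∈ X.twistGr i (a + s + (1, 0)) := hx.1
        have h2 := twist_sign X i s _ _ h1
        rw [add_right_comm, ← twistGr_shift] at h2
        exact ⟨h2, hx.2⟩)
      (fun x => Prod.ext (twist_sign_d X i s x.1) (twist_sign_ev X i s x.1 x.2)))
    (fun {X Y} f => by
      apply hom_ext
      intro x
      refine Prod.ext ?_ rfl
      exact (map_zsmul (twistMap i f).lin (sgn s) x.1).symm)

/-- The identity map between the twisting by a rotation of a shift, and the shift of the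
twisting by a rotation. -/
def rotShiftIso (a : ZMod n) (s : ZMod n → Bideg)
    (hs : ∀ i, s i + Gen.deg N (Gen.up i) = Gen.deg N (Gen.up (i + a)) + s (i + 1)) (t : Bideg) :
    shiftBy k n N t ⋙ rotFunctor k N a s hs ≅ rotFunctor k N a s hs ⋙ shiftBy k n N t :=
  NatIso.ofComponents (fun X =>
    isoMk (X := rotObj a s hs (shiftObj t X)) (Y := shiftObj t (rotObj a s hs X))
      (LinearEquiv.refl _ (rotObj a s hs X).carrier)
      (fun c x hx => by
        have hx := (mem_regrade (shiftObj t X) s c x).1 hx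
        refine (X.mem_regrade s (c + t) x).2 fun i => ?_
        rw [add_right_comm]
        exact hx i)
      (fun c x hx => by
        have hx := (X.mem_regrade s (c + t) x).1 hx
        refine (mem_regrade (shiftObj t X) s c x).2 fun i => ?_
        have := hx i
        rw [add_right_comm] at this
        exact this)
      (fun x => rfl))
    (fun f => rfl)

/-- The compatibility of `T_i` with the shifts. -/
@[reducible]
def twistCommShift (i : ZMod n) {A : Type} [AddGroup A] (φ : A →+ Bideg) :
    letI := hasShiftMk _ _ (shiftCore k n N φ)
    (twistFunctor k N i).CommShift A :=
  letI := hasShiftMk _ _ (shiftCore k n N φ)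
  { commShiftIso := fun a => twistShiftIso i (φ a)
    commShiftIso_zero := by
      refine Iso.ext (NatTrans.ext (funext fun X => hom_ext _ _ fun x => ?_))
      refine Eq.trans ?_ (congrArg (fun t => Hom.lin t x)
        (Functor.CommShift.isoZero_hom_app (twistFunctor k N i) A X)).symm
      refine Prod.ext ?_ rfl
      have h : (twistMap i ((shiftByZero (φ 0) φ.map_zero).hom.app X)).lin x.1 = x.1 :=
        lTensor_eq_self (A := (Zigzag k n)ᵐᵒᵖ) (V := proj k i) (W := X.corner i)
          (cornerMap ((shiftByZero (φ 0) φ.map_zero).hom.app X) i) (fun _ => rfl) x.1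
      refine Eq.trans ?_ h.symm
      have h2 : ∀ y : (twistObj i X).carrier, sgn (φ 0) • y = y := fun y => by
        rw [map_zero, sgn_zero, one_smul]
      exact h2 x.1
    commShiftIso_add := fun a b => by
      refine Iso.ext (NatTrans.ext (funext fun X => hom_ext _ _ fun x => ?_))
      refine Eq.trans ?_ (congrArg (fun t => Hom.lin t x)
        (Functor.CommShift.isoAdd_hom_app (F := twistFunctor k N i) (a := a) (b := b)
          (twistShiftIso i (φ a)) (twistShiftIso i (φ b)) X)).symm
      refine Prod.ext ?_ rfl
      have h : (twistMap i ((shiftByAdd (φ a) (φ b) _ (φ.map_add a b)).hom.app X)).lin x.1 = x.1 :=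
        lTensor_eq_self (A := (Zigzag k n)ᵐᵒᵖ) (V := proj k i) (W := X.corner i)
          (cornerMap ((shiftByAdd (φ a) (φ b) _ (φ.map_add a b)).hom.app X) i) (fun _ => rfl) x.1
      have h2 : ∀ y : (twistObj i X).carrier,
          sgn (φ (a + b)) • y = sgn (φ a) • sgn (φ b) • y := fun y => by
        rw [map_add, sgn_add, smul_smul]
      refine (h2 x.1).trans ?_
      exact congrArg (fun y : (twistObj i X).carrier => sgn (φ a) • sgn (φ b) • y) h.symm }

/-- The compatibility of `F_ρ` with the shifts. -/
@[reducible]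
def rotCommShift (r : ZMod n) (s : ZMod n → Bideg)
    (hs : ∀ i, s i + Gen.deg N (Gen.up i) = Gen.deg N (Gen.up (i + r)) + s (i + 1))
    {A : Type} [AddGroup A] (φ : A →+ Bideg) :
    letI := hasShiftMk _ _ (shiftCore k n N φ)
    (rotFunctor k N r s hs).CommShift A :=
  letI := hasShiftMk _ _ (shiftCore k n N φ)
  { commShiftIso := fun a => rotShiftIso r s hs (φ a)
    commShiftIso_zero := by
      refine Iso.ext (NatTrans.ext (funext fun X => hom_ext _ _ fun x => ?_))
      refine Eq.trans ?_ (congrArg (fun t => Hom.lin t x)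
        (Functor.CommShift.isoZero_hom_app (rotFunctor k N r s hs) A X)).symm
      rfl
    commShiftIso_add := fun a b => by
      refine Iso.ext (NatTrans.ext (funext fun X => hom_ext _ _ fun x => ?_))
      refine Eq.trans ?_ (congrArg (fun t => Hom.lin t x)
        (Functor.CommShift.isoAdd_hom_app (F := rotFunctor k N r s hs) (a := a) (b := b)
          (rotShiftIso r s hs (φ a)) (rotShiftIso r s hs (φ b)) X)).symm
      rfl }

instance (i : ZMod n) : (twistFunctor k N i).CommShift ℤ := twistCommShift i firstHom

instance (i : ZMod n) : (twistFunctor k N i).CommShift Second := twistCommShift i secondHom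

instance : (rhoFunctor k n N).CommShift ℤ := rotCommShift _ _ _ firstHom

instance : (rhoFunctor k n N).CommShift Second := rotCommShift _ _ _ secondHom

instance : (rhoFunctor' k n N).CommShift ℤ := rotCommShift _ _ _ firstHom

instance : (rhoFunctor' k n N).CommShift Second := rotCommShift _ _ _ secondHom

end DGMod

end CommShift

section Derived

variable (k : Type u) [Field k] (n : ℕ) [NeZero n] (N : ℤ)

open DGMod

/-- The derived category `D(R_n-mod)` of bigraded dg modules: the localization of the
category of bigraded dg modules at the quasi-isomorphisms. It carries the shifts `[a]`, indexed
by `ℤ`, and `⟨b⟩`, indexed by `Second`. -/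
abbrev DerivedCat : Type (u + 1) := (quasiIso k n N).Localization

/-- The localization functor. -/
abbrev toDerived : DGMod k n N ⥤ DerivedCat k n N := (quasiIso k n N).Q

/-- The distinguished triangles of `D(R_n-mod)`: those which are isomorphic to the image of
the triangle of a mapping cone. -/
def distTriangles : Set (Pretriangulated.Triangle (DerivedCat k n N)) :=
  {T | ∃ (X Y : DGMod k n N) (f : X ⟶ Y),
    Nonempty (T ≅ (toDerived k n N).mapTriangle.obj (coneTriangle f))}

variable {n}

/-- `T_i` as a morphism of localizers: it preserves quasi-isomorphisms. -/
def twistLocalizer (i : ZMod n) :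
    LocalizerMorphism (quasiIso k n N) (quasiIso k n N) where
  functor := twistFunctor k N i
  map _ _ f hf := quasiIso_coneMap _ _ (ev_naturality i f) (quasiIso_twistMap i f hf) hf

instance (i : ZMod n) : (twistLocalizer k N i).functor.CommShift ℤ :=
  twistCommShift i firstHom

instance (i : ZMod n) : (twistLocalizer k N i).functor.CommShift Second :=
  twistCommShift i secondHom

/-- The twist functor `T_i` on `D(R_n-mod)`. -/
abbrev T (i : ZMod n) : DerivedCat k n N ⥤ DerivedCat k n N :=
  (twistLocalizer k N i).localizedFunctor (toDerived k n N) (toDerived k n N)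

variable (n)

/-- `F_ρ` as a morphism of localizers. -/
def rhoLocalizer : LocalizerMorphism (quasiIso k n N) (quasiIso k n N) where
  functor := rhoFunctor k n N
  map _ _ f hf := quasiIso_rot _ _ _ f hf

/-- `F'_ρ` as a morphism of localizers. -/
def rhoLocalizer' : LocalizerMorphism (quasiIso k n N) (quasiIso k n N) where
  functor := rhoFunctor' k n N
  map _ _ f hf := quasiIso_rot _ _ _ f hf

instance : (rhoLocalizer k n N).functor.CommShift ℤ :=
  rotCommShift _ _ _ firstHom

instance : (rhoLocalizer k n N).functor.CommShift Second :=
  rotCommShift _ _ _ secondHom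

instance : (rhoLocalizer' k n N).functor.CommShift ℤ :=
  rotCommShift _ _ _ firstHom

instance : (rhoLocalizer' k n N).functor.CommShift Second :=
  rotCommShift _ _ _ secondHom

/-- The functor `F_ρ` on `D(R_n-mod)`. -/
abbrev Frho : DerivedCat k n N ⥤ DerivedCat k n N :=
  (rhoLocalizer k n N).localizedFunctor (toDerived k n N) (toDerived k n N)

/-- The functor `F'_ρ` on `D(R_n-mod)`. -/
abbrev Frho' : DerivedCat k n N ⥤ DerivedCat k n N :=
  (rhoLocalizer' k n N).localizedFunctor (toDerived k n N) (toDerived k n N)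

variable {k n N}

/-- A functor commuting with the shift `[1]` is an exact equivalence if it is an equivalence of
categories and sends distinguished triangles to distinguished triangles. -/
def IsExactEquivalence (G : DerivedCat k n N ⥤ DerivedCat k n N) [G.CommShift ℤ] : Prop :=
  G.IsEquivalence ∧ ∀ t ∈ distTriangles k n N, G.mapTriangle.obj t ∈ distTriangles k n N

/-- Two functors commuting with the shifts `[a]` and `⟨b⟩` are isomorphic through a graded
natural isomorphism, that is one which is compatible with the commutation isomorphisms. -/
def GradedIso (G H : DerivedCat k n N ⥤ DerivedCat k n N) [G.CommShift ℤ] [G.CommShift Second]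
    [H.CommShift ℤ] [H.CommShift Second] : Prop :=
  ∃ e : G ≅ H, NatTrans.CommShift e.hom ℤ ∧ NatTrans.CommShift e.hom Second

end Derived

end AffineZigzag

end

/-! All the functors are induced by functors on dg modules that preserve quasi-isomorphisms. A
graded isomorphism on the derived category therefore follows from a natural quasi-isomorphism of dg
modules compatible with the shifts (`IsInducedBy.gradedIso`), and exactness follows from
compatibility with mapping cones (`IsInducedBy.mapTriangle_mem`).

The algebra enters only through its corners. For n ≥ 3 the space (i)R(i) has the basis (i) and the
loop at i, the spaces (i)R(i+1) and (i+1)R(i) are spanned by one arrow each, and all other corners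
vanish (`corner_self`, `corner_up`, `corner_down`, `corner_far`). The coefficients are read off from
a representation by matrices over k[x, y]/(x², y²).

The twist has a universal property: a morphism T_i Y → W is a morphism Y → W together with a
contraction of its restriction to Y(i) (`descHom`). Maps out of iterated twists are built one
contraction at a time and compared on a few kinds of elements.

Braid relation. For adjacent i and j, the module T_i T_j T_i X is the sum of X, two copies of
X(i)⊗P_i, one of X(j)⊗P_j, the mixed terms X(i)⊗(i)R(j)⊗P_j and X(j)⊗(j)R(i)⊗P_i, the term
X(i)⊗(i)R(i)⊗P_i, and X(i)⊗(i)R(j)⊗(j)R(i)⊗P_i. The loop part of the term with (i)R(i) cancels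
against the last one, because the path i, j, i is the loop, and its idempotent part cancels against
a copy of X(i)⊗P_i. What remains is symmetric in i and j. `braidHom` is an explicit map between the
two unreduced complexes, and the same map with i and j exchanged is its homotopy inverse
(`braid_homotopy`).

Far vertices. As (i)R(j) = 0, one has (T_i X)(j) = X(j), and `farHom` is an isomorphism of dg
modules.

Invertibility. The coefficient of the loop pairs R(i) with (i)R perfectly. The dual bases define the
coevaluation X → X⊗R(i)⊗P_i of degree N, and the inverse T'_i of T_i is its cocone. In T'_i T_i X
and in T_i T'_i X the two halves of X(i)⊗(i)R(i)⊗P_i cancel against the two copies of X(i)⊗P_i, so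
that X remains (`quasiIso_unitHom`, `quasiIso_unitHom'`).

Rotation. The composites of F_ρ and F'_ρ are the identity on underlying spaces, and `conjHom`
relabels T_{i+1} as F_ρ T_i F'_ρ. Signs are handled uniformly: `tmap` carries a factor ε on the
tensor summand, and an identity proved for every ε gives naturality for ε = 1 and compatibility with
a shift for ε its sign. -/

noncomputable section

namespace AffineZigzag

/-! ### Paths and corners of the algebra `R_n` -/

section Coefficients

open Gen

variable (k : Type u) [Field k] {n : ℕ} [NeZero n]

/-- The matrices over `k[x, y] / (x², y²)` which represent the generators of `R_n`. -/
def matrixGen : Gen n → Matrix (ZMod n) (ZMod n) (DualNumber (DualNumber k))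
  | vertex i => Matrix.single i i 1
  | up i => Matrix.single i (i + 1) (TrivSqZeroExt.inl DualNumber.eps)
  | down i => Matrix.single (i + 1) i DualNumber.eps

/-- A faithful representation of `R_n` by matrices. -/
def matrixHom : Zigzag k n →ₐ[k] Matrix (ZMod n) (ZMod n) (DualNumber (DualNumber k)) :=
  liftHom k (matrixGen k) (by
    intro x y h
    cases h with
    | vertex_mul_self i => simp [matrixGen]
    | vertex_mul_vertex i j h => simp [matrixGen, Matrix.single_mul_single_of_ne, h]
    | sum_vertex =>
      simp only [map_sum, FreeAlgebra.lift_ι_apply, matrixGen, map_one]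
      exact Matrix.sum_single_one
    | vertex_mul_up i => simp [matrixGen]
    | up_mul_vertex i => simp [matrixGen]
    | vertex_mul_down i => simp [matrixGen]
    | down_mul_vertex i => simp [matrixGen]
    | loop i =>
      simp only [map_mul, FreeAlgebra.lift_ι_apply, matrixGen, Matrix.single_mul_single_same]
      -- Both loops at a vertex are represented by xy, so this relation is the commutativity of the
      -- ring of entries.
      exact congrArg _ (mul_comm (DualNumber.eps : DualNumber (DualNumber k)) _)
    | up_mul_up i =>
      simp [matrixGen, ← TrivSqZeroExt.inl_mul, DualNumber.eps_mul_eps]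
    | down_mul_down i => simp [matrixGen])

theorem matrixHom_gen (g : Gen n) : matrixHom k (gen k g) = matrixGen k g := liftHom_gen k _ _ g

/-- An entry of the matrix of an element of `R_n`. -/
def entry (i j : ZMod n) : Zigzag k n →ₗ[k] DualNumber (DualNumber k) :=
  (Matrix.entryLinearMap k (DualNumber (DualNumber k)) i j).comp (matrixHom k).toLinearMap

theorem entry_apply (i j : ZMod n) (r : Zigzag k n) : entry k i j r = matrixHom k r i j := rfl

theorem entry_idem_mul_mul_idem (i j : ZMod n) (r : Zigzag k n) :
    entry k i j (idem k i * r * idem k j) = entry k i j r := by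
  simp [entry_apply, matrixHom_gen, matrixGen]

/-- The coefficient of the idempotent `(i)`. -/
def coefIdem (i : ZMod n) : Zigzag k n →ₗ[k] k where
  toFun r := (entry k i i r).fst.fst
  map_add' _ _ := by simp
  map_smul' _ _ := by simp

/-- The coefficient of the loop at `i`. -/
def coefLoop (i : ZMod n) : Zigzag k n →ₗ[k] k where
  toFun r := (entry k i i r).snd.snd
  map_add' _ _ := by simp
  map_smul' _ _ := by simp

/-- The coefficient of the arrow `(i|i+1)`. -/
def coefUp (i : ZMod n) : Zigzag k n →ₗ[k] k where
  toFun r := (entry k i (i + 1) r).fst.snd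
  map_add' _ _ := by simp
  map_smul' _ _ := by simp

/-- The coefficient of the arrow `(i+1|i)`. -/
def coefDown (i : ZMod n) : Zigzag k n →ₗ[k] k where
  toFun r := (entry k (i + 1) i r).snd.fst
  map_add' _ _ := by simp
  map_smul' _ _ := by simp

/-- The loop `(i|i+1|i) = (i|i-1|i)`. -/
def loop (i : ZMod n) : Zigzag k n := gen k (up i) * gen k (down i)

variable {k}

/-- The starting point of a generator. -/
def src : Gen n → ZMod n
  | vertex i => i
  | up i => i
  | down i => i + 1

/-- The end point of a generator. -/
def tgt : Gen n → ZMod n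
  | vertex i => i
  | up i => i + 1
  | down i => i

theorem idem_src_mul (g : Gen n) : idem k (src g) * gen k g = gen k g := by
  cases g
  · exact gen_vertex_mul_self k _
  · exact gen_vertex_mul_up k _
  · exact gen_vertex_mul_down k _

theorem mul_idem_tgt (g : Gen n) : gen k g * idem k (tgt g) = gen k g := by
  cases g
  · exact gen_vertex_mul_self k _
  · exact gen_up_mul_vertex k _
  · exact gen_down_mul_vertex k _

theorem mul_eq_zero_of_ne {i j : ZMod n} (h : i ≠ j) {x y : Zigzag k n} (hx : x * idem k i = x)
    (hy : idem k j * y = y) : x * y = 0 := by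
  rw [← hx, ← hy, mul_assoc, ← mul_assoc (idem k i), gen_vertex_mul_vertex k i j h, zero_mul,
    mul_zero]

theorem gen_mul_gen_of_ne {g h : Gen n} (hgh : tgt g ≠ src h) : gen k g * gen k h = 0 :=
  mul_eq_zero_of_ne hgh (mul_idem_tgt g) (idem_src_mul h)

theorem down_mul_up (i : ZMod n) : gen k (down i) * gen k (up i) = loop k (i + 1) := gen_loop k i

theorem idem_mul_loop (i : ZMod n) : idem k i * loop k i = loop k i := by
  rw [loop, ← mul_assoc, gen_vertex_mul_up]

theorem loop_mul_idem (i : ZMod n) : loop k i * idem k i = loop k i := by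
  rw [loop, mul_assoc, gen_down_mul_vertex]

theorem loop_mul_up (i : ZMod n) : loop k i * gen k (up i) = 0 := by
  rw [loop, mul_assoc, gen_loop, ← mul_assoc, gen_up_mul_up, zero_mul]

theorem loop_mul_down (i : ZMod n) : loop k (i + 1) * gen k (down i) = 0 := by
  rw [loop, mul_assoc, gen_down_mul_down, mul_zero]

theorem down_mul_loop (i : ZMod n) : gen k (down i) * loop k i = 0 := by
  rw [loop, ← mul_assoc, gen_loop, mul_assoc, gen_down_mul_down, mul_zero]

theorem up_mul_loop (i : ZMod n) : gen k (up i) * loop k (i + 1) = 0 := by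
  rw [loop, ← mul_assoc, gen_up_mul_up, zero_mul]

/-- The paths of length at most two, which span `R_n`. -/
inductive IsBasic : Zigzag k n → Prop
  | gen (g : Gen n) : IsBasic (gen k g)
  | loop (i : ZMod n) : IsBasic (loop k i)

theorem gen_mul_gen_cases (g h : Gen n) :
    gen k g * gen k h = 0 ∨ IsBasic (gen k g * gen k h) := by
  by_cases hgh : tgt g = src h
  · cases h with
    | vertex j =>
      obtain rfl : tgt g = j := hgh
      exact Or.inr (by rw [mul_idem_tgt]; exact .gen g)
    | up j =>
      obtain rfl : tgt g = j := hgh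
      cases g with
      | vertex i => exact Or.inr (by rw [tgt, gen_vertex_mul_up]; exact .gen _)
      | up i => exact Or.inl (gen_up_mul_up k i)
      | down i => exact Or.inr (by rw [tgt, down_mul_up]; exact .loop _)
    | down j =>
      cases g with
      | vertex i =>
        obtain rfl : i = j + 1 := hgh
        exact Or.inr (by rw [gen_vertex_mul_down]; exact .gen _)
      | up i =>
        obtain rfl : i = j := add_right_cancel hgh
        exact Or.inr (.loop _)
      | down i =>
        obtain rfl : i = j + 1 := hgh
        exact Or.inl (gen_down_mul_down k j)
  · exact Or.inl (gen_mul_gen_of_ne hgh)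

theorem loop_mul_gen_cases (i : ZMod n) (h : Gen n) :
    loop k i * gen k h = 0 ∨ IsBasic (loop k i * gen k h) := by
  by_cases hi : i = src h
  · cases h with
    | vertex j =>
      obtain rfl : i = j := hi
      exact Or.inr (by rw [loop_mul_idem]; exact .loop i)
    | up j =>
      obtain rfl : i = j := hi
      exact Or.inl (loop_mul_up i)
    | down j =>
      obtain rfl : i = j + 1 := hi
      exact Or.inl (loop_mul_down j)
  · exact Or.inl (mul_eq_zero_of_ne hi (loop_mul_idem i) (idem_src_mul h))

/-- Multiplying a path of length at most two by a generator gives zero or again such a path, so a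
word that begins with one never leaves the list. -/
theorem IsBasic.mul_word {x : Zigzag k n} (hx : IsBasic x) (w : List (Gen n)) :
    x * (w.map (AffineZigzag.gen k)).prod = 0 ∨
      IsBasic (x * (w.map (AffineZigzag.gen k)).prod) := by
  induction w generalizing x with
  | nil => simpa using Or.inr hx
  | cons g w ih =>
    rw [List.map_cons, List.prod_cons, ← mul_assoc]
    have h : x * AffineZigzag.gen k g = 0 ∨ IsBasic (x * AffineZigzag.gen k g) := by
      cases hx with
      | gen g' => exact gen_mul_gen_cases g' g
      | loop i => exact loop_mul_gen_cases i g
    rcases h with h | h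
    · exact Or.inl (by rw [h, zero_mul])
    · exact ih h

-- Statements that are linear in an element of `R_n` need to be checked only on vertices, arrows and
-- loops: by `IsBasic.mul_word` every word reduces to these.
@[elab_as_elim]
theorem basic_induction {P : Zigzag k n → Prop} (zero : P 0) (add : ∀ x y, P x → P y → P (x + y))
    (smul : ∀ (c : k) x, P x → P (c • x)) (gen : ∀ g, P (gen k g)) (loop : ∀ i, P (loop k i))
    (r : Zigzag k n) : P r := by
  induction mem_span_words k r using Submodule.span_induction with
  | zero => exact zero
  | add x y _ _ hx hy => exact add x y hx hy
  | smul c x _ hx => exact smul c x hx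
  | mem x hx =>
    obtain ⟨w, rfl⟩ := hx
    dsimp only
    -- A word may be empty. Writing 1 as the sum of the idempotents turns it into a sum of words
    -- that begin with a basic path.
    rw [← one_mul (List.prod _), ← sum_gen_vertex, Finset.sum_mul]
    refine Finset.sum_induction _ P add zero fun i _ => ?_
    rcases (IsBasic.gen (vertex i) : IsBasic (idem k i)).mul_word w with h | h
    · rw [h]; exact zero
    · generalize idem k i * _ = y at h
      cases h with
      | gen g => exact gen g
      | loop i => exact loop i

theorem deg_up_add_deg_down_eq {n : ℕ} (N : ℤ) (i : ZMod n) :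
    deg N (up i) + deg N (down i) = (N, 0) := by
  ext
  · simp [deg]
  · simp only [deg, Prod.snd_add]; split_ifs <;> simp

theorem loop_mem (N : ℤ) (i : ZMod n) : loop k i ∈ bigrading k N (N, 0) := by
  have h := mul_mem_bigrading k N (gen_mem k N (up i)) (gen_mem k N (down i))
  rwa [deg_up_add_deg_down_eq] at h

theorem coefIdem_idem (i : ZMod n) : coefIdem k i (idem k i) = 1 := by
  simp [coefIdem, entry_apply, matrixHom_gen, matrixGen]

theorem coefLoop_idem (i : ZMod n) : coefLoop k i (idem k i) = 0 := by
  simp [coefLoop, entry_apply, matrixHom_gen, matrixGen]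

theorem coefIdem_loop (i : ZMod n) : coefIdem k i (loop k i) = 0 := by
  simp [coefIdem, entry_apply, matrixHom_gen, matrixGen, loop]

theorem coefLoop_loop (i : ZMod n) : coefLoop k i (loop k i) = 1 := by
  simp [coefLoop, entry_apply, matrixHom_gen, matrixGen, loop]

theorem coefUp_up (i : ZMod n) : coefUp k i (gen k (up i)) = 1 := by
  simp [coefUp, entry_apply, matrixHom_gen, matrixGen]

theorem coefDown_down (i : ZMod n) : coefDown k i (gen k (down i)) = 1 := by
  simp [coefDown, entry_apply, matrixHom_gen, matrixGen]

theorem coefIdem_corner (i : ZMod n) (r : Zigzag k n) :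
    coefIdem k i (idem k i * r * idem k i) = coefIdem k i r :=
  congrArg (fun t => t.fst.fst) (entry_idem_mul_mul_idem k i i r)

theorem coefLoop_corner (i : ZMod n) (r : Zigzag k n) :
    coefLoop k i (idem k i * r * idem k i) = coefLoop k i r :=
  congrArg (fun t => t.snd.snd) (entry_idem_mul_mul_idem k i i r)

theorem coefUp_corner (i : ZMod n) (r : Zigzag k n) :
    coefUp k i (idem k i * r * idem k (i + 1)) = coefUp k i r :=
  congrArg (fun t => t.fst.snd) (entry_idem_mul_mul_idem k i (i + 1) r)

theorem coefDown_corner (i : ZMod n) (r : Zigzag k n) :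
    coefDown k i (idem k (i + 1) * r * idem k i) = coefDown k i r :=
  congrArg (fun t => t.snd.fst) (entry_idem_mul_mul_idem k (i + 1) i r)

/-- The hypothesis covers both failures: a generator that does not start at `i` is killed on the
left, and one that starts at `i` but does not end at `j` is killed on the right. -/
theorem corner_gen_of_ne {i j : ZMod n} {g : Gen n} (h : i = src g → tgt g ≠ j) :
    idem k i * gen k g * idem k j = 0 := by
  by_cases hi : i = src g
  · rw [mul_assoc, mul_eq_zero_of_ne (h hi) (mul_idem_tgt g) (gen_vertex_mul_self k j), mul_zero]
  · rw [mul_eq_zero_of_ne hi (gen_vertex_mul_self k i) (idem_src_mul g), zero_mul]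

theorem corner_loop_of_ne {i j l : ZMod n} (h : i = l → l ≠ j) :
    idem k i * loop k l * idem k j = 0 := by
  by_cases hi : i = l
  · rw [mul_assoc, mul_eq_zero_of_ne (h hi) (loop_mul_idem l) (gen_vertex_mul_self k j), mul_zero]
  · rw [mul_eq_zero_of_ne hi (gen_vertex_mul_self k i) (idem_mul_loop l), zero_mul]

theorem one_ne_zero_zmod {n : ℕ} (hn : 3 ≤ n) : (1 : ZMod n) ≠ 0 := by
  have : Fact (1 < n) := ⟨by omega⟩
  exact one_ne_zero

theorem two_ne_zero_zmod {n : ℕ} (hn : 3 ≤ n) : (1 + 1 : ZMod n) ≠ 0 := by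
  intro h
  have h2 : ((2 : ℕ) : ZMod n) = 0 := by rw [← h]; norm_num
  rw [ZMod.natCast_eq_zero_iff] at h2
  exact absurd (Nat.le_of_dvd (by norm_num) h2) (by omega)

/-- Since i + 1 ≠ i, no arrow goes from i to i; among the basic paths only the idempotent and the
loop do. -/
theorem corner_self (hn : 3 ≤ n) (i : ZMod n) (r : Zigzag k n) :
    idem k i * r * idem k i = coefIdem k i r • idem k i + coefLoop k i r • loop k i := by
  -- With the coefficients taken of the corner itself, a path with zero corner contributes zero to
  -- both sides, and only the surviving paths need a computation.
  suffices h : ∀ r, idem k i * r * idem k i = coefIdem k i (idem k i * r * idem k i) • idem k i +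
      coefLoop k i (idem k i * r * idem k i) • loop k i by
    rw [h r, coefIdem_corner, coefLoop_corner]
  intro r
  induction r using basic_induction with
  | zero => simp
  | add x y hx hy =>
    rw [mul_add, add_mul, map_add, map_add]
    nth_rw 1 [hx, hy]
    module
  | smul c x hx =>
    rw [mul_smul_comm, smul_mul_assoc, map_smul, map_smul]
    nth_rw 1 [hx]
    module
  | gen g =>
    by_cases h : ∃ j, g = vertex j ∧ i = j
    · obtain ⟨_, rfl, rfl⟩ := h
      simp [gen_vertex_mul_self, coefIdem_idem, coefLoop_idem]
    · rw [corner_gen_of_ne]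
      · simp
      · intro hs ht
        cases g with
        | vertex j => exact h ⟨j, rfl, hs⟩
        | up j => exact one_ne_zero_zmod hn (by simpa [src, tgt, hs] using ht)
        | down j => exact one_ne_zero_zmod hn (by simpa [src, tgt, hs] using ht)
  | loop j =>
    by_cases h : i = j
    · subst h
      simp [idem_mul_loop, loop_mul_idem, coefIdem_loop, coefLoop_loop]
    · rw [corner_loop_of_ne fun h' => absurd h' h]
      simp

/-- Besides (i|i+1), the arrow (i|i-1) also starts at i; it ends at i + 1 only if 2 = 0 modulo n,
which n ≥ 3 excludes. -/
theorem corner_up (hn : 3 ≤ n) (i : ZMod n) (r : Zigzag k n) :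
    idem k i * r * idem k (i + 1) = coefUp k i r • gen k (up i) := by
  suffices h : ∀ r, idem k i * r * idem k (i + 1) =
      coefUp k i (idem k i * r * idem k (i + 1)) • gen k (up i) by
    rw [h r, coefUp_corner]
  intro r
  induction r using basic_induction with
  | zero => simp
  | add x y hx hy =>
    rw [mul_add, add_mul, map_add]
    nth_rw 1 [hx, hy]
    module
  | smul c x hx =>
    rw [mul_smul_comm, smul_mul_assoc, map_smul]
    nth_rw 1 [hx]
    module
  | gen g =>
    by_cases h : ∃ j, g = up j ∧ i = j
    · obtain ⟨_, rfl, rfl⟩ := h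
      rw [gen_vertex_mul_up, gen_up_mul_vertex, coefUp_up, one_smul]
    · rw [corner_gen_of_ne]
      · simp
      · intro hs ht
        cases g with
        | vertex j => exact one_ne_zero_zmod hn (by simpa [src, tgt, hs] using ht)
        | up j => exact h ⟨j, rfl, hs⟩
        | down j =>
          refine two_ne_zero_zmod hn ?_
          subst hs
          simpa [src, tgt, add_assoc] using ht
  | loop j =>
    rw [corner_loop_of_ne]
    · simp
    · rintro rfl h
      exact one_ne_zero_zmod hn (by simpa using h)

theorem corner_down (hn : 3 ≤ n) (i : ZMod n) (r : Zigzag k n) :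
    idem k (i + 1) * r * idem k i = coefDown k i r • gen k (down i) := by
  suffices h : ∀ r, idem k (i + 1) * r * idem k i =
      coefDown k i (idem k (i + 1) * r * idem k i) • gen k (down i) by
    rw [h r, coefDown_corner]
  intro r
  induction r using basic_induction with
  | zero => simp
  | add x y hx hy =>
    rw [mul_add, add_mul, map_add]
    nth_rw 1 [hx, hy]
    module
  | smul c x hx =>
    rw [mul_smul_comm, smul_mul_assoc, map_smul]
    nth_rw 1 [hx]
    module
  | gen g =>
    by_cases h : ∃ j, g = down j ∧ i = j
    · obtain ⟨_, rfl, rfl⟩ := h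
      rw [gen_vertex_mul_down, gen_down_mul_vertex, coefDown_down, one_smul]
    · rw [corner_gen_of_ne]
      · simp
      · intro hs ht
        cases g with
        | vertex j =>
          refine one_ne_zero_zmod hn (?_ : (1 : ZMod n) = 0)
          have h1 : i + 1 = i := hs.trans ht
          simpa using h1
        | up j =>
          refine two_ne_zero_zmod hn ?_
          have h1 : i + 1 + 1 = i := (congrArg (· + 1) (show i + 1 = j from hs)).trans ht
          simpa [add_assoc] using h1
        | down j => exact h ⟨j, rfl, add_right_cancel (show i + 1 = j + 1 from hs)⟩
  | loop j =>
    rw [corner_loop_of_ne]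
    · simp
    · rintro rfl h
      exact one_ne_zero_zmod hn (by simpa using h)

theorem corner_far {i j : ZMod n} (h1 : j ≠ i) (h2 : j ≠ i + 1) (h3 : i ≠ j + 1)
    (r : Zigzag k n) : idem k i * r * idem k j = 0 := by
  induction r using basic_induction with
  | zero => simp
  | add x y hx hy => rw [mul_add, add_mul, hx, hy, add_zero]
  | smul c x hx => rw [mul_smul_comm, smul_mul_assoc, hx, smul_zero]
  | gen g =>
    refine corner_gen_of_ne fun hs ht => ?_
    cases g with
    | vertex l => exact h1 (ht.symm.trans hs.symm)
    | up l => exact h2 (by rw [← ht, hs]; rfl)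
    | down l => exact h3 (by rw [← ht, hs]; rfl)
  | loop l => exact corner_loop_of_ne fun hs ht => h1 (ht.symm.trans hs.symm)

/-- A linear functional on `R_n` that vanishes on the pieces of bidegree different from `s`. -/
def IsHomog (N : ℤ) (κ : Zigzag k n →ₗ[k] k) (s : Bideg) : Prop :=
  ∀ c, ∀ r ∈ bigrading k N c, κ r ≠ 0 → c = s

theorem corner_mem (N : ℤ) (i j : ZMod n) {c : Bideg} {r : Zigzag k n}
    (hr : r ∈ bigrading k N c) : idem k i * r * idem k j ∈ bigrading k N c := by
  have := mul_mem_bigrading k N (mul_mem_bigrading k N (idem_mem k N i) hr) (idem_mem k N j)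
  rwa [zero_add, add_zero] at this

/-- For `r` of bidegree `c`, the corner κ(r)a lies in the pieces of bidegree `c` and `s`. Here a ≠ 0
because κ(a) = 1, so κ(r) ≠ 0 forces c = s. -/
theorem isHomog_of_corner (N : ℤ) {i j : ZMod n} {κ : Zigzag k n →ₗ[k] k} {a : Zigzag k n}
    {s : Bideg} (h : ∀ r, idem k i * r * idem k j = κ r • a) (ha : a ∈ bigrading k N s)
    (ha1 : κ a = 1) : IsHomog N κ s := by
  intro c r hr hκ
  obtain ⟨δ, hδ⟩ := exists_coaction (isInternal_bigrading (n := n) k N)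
  have h1 := hδ c _ (corner_mem N i j hr)
  rw [h, map_smul, hδ s _ ha, Finsupp.smul_single] at h1
  have h2 : κ r • a ≠ 0 := by
    intro h0
    rw [smul_eq_zero] at h0
    rcases h0 with h0 | h0
    · exact hκ h0
    · rw [h0, map_zero] at ha1
      exact zero_ne_one ha1
  exact ((Finsupp.single_left_inj h2).1 h1).symm

/-- The corner (i)r(i) also has an idempotent component, so the components of bidegree (N, 0) are
compared instead of whole elements. -/
theorem isHomog_coefLoop (hn : 3 ≤ n) (N : ℤ) (i : ZMod n) :
    IsHomog N (coefLoop k i) (N, 0) := by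
  intro c r hr hκ
  obtain ⟨δ, hδ⟩ := exists_coaction (isInternal_bigrading (n := n) k N)
  have h1 := hδ c _ (corner_mem N i i hr)
  rw [corner_self hn, map_add, map_smul, map_smul, hδ _ _ (loop_mem N i), hδ _ _ (idem_mem k N i),
    Finsupp.smul_single, Finsupp.smul_single] at h1
  by_contra hc
  have h2 := congrArg (fun f => coefLoop k i (f (N, 0))) h1
  -- For N = 0 the idempotent and the loop have the same bidegree, but `coefLoop` still tells them
  -- apart.
  by_cases hN : ((N, 0) : Bideg) = 0
  · rw [hN] at h2 hc
    simp [hc, coefLoop_loop, coefLoop_idem, hκ] at h2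
  · simp [hc, coefLoop_loop, hκ, Ne.symm hN] at h2

end Coefficients

/-! ### Pairs of opposite arrows, treated symmetrically in the two vertices -/

section Arrows

open Gen

variable (k : Type u) [Field k] {n : ℕ} [NeZero n]

/-- A pair of opposite arrows `a : i ⟶ j` and `b : j ⟶ i` between adjacent vertices, together with
the functionals that give the coefficients of `a` and `b`. -/
structure ArrowPair (N : ℤ) (i j : ZMod n) where
  /-- the arrow from `i` to `j` -/
  a : Zigzag k n
  /-- the arrow from `j` to `i` -/
  b : Zigzag k n
  /-- the coefficient of `a` -/
  α : Zigzag k n →ₗ[k] k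
  /-- the coefficient of `b` -/
  β : Zigzag k n →ₗ[k] k
  /-- the degree of `a` -/
  da : Bideg
  /-- the degree of `b` -/
  db : Bideg
  idem_a : idem k i * a = a
  a_idem : a * idem k j = a
  idem_b : idem k j * b = b
  b_idem : b * idem k i = b
  corner_a : ∀ r, idem k i * r * idem k j = α r • a
  corner_b : ∀ r, idem k j * r * idem k i = β r • b
  α_a : α a = 1
  β_b : β b = 1
  a_mul_b : a * b = loop k i
  b_mul_a : b * a = loop k j
  a_mem : a ∈ bigrading k N da
  b_mem : b ∈ bigrading k N db
  da_add_db : da + db = (N, 0)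

variable {k}

/-- The same arrows in the opposite order. -/
def ArrowPair.symm {N : ℤ} {i j : ZMod n} (A : ArrowPair k N i j) : ArrowPair k N j i where
  a := A.b
  b := A.a
  α := A.β
  β := A.α
  da := A.db
  db := A.da
  idem_a := A.idem_b
  a_idem := A.b_idem
  idem_b := A.idem_a
  b_idem := A.a_idem
  corner_a := A.corner_b
  corner_b := A.corner_a
  α_a := A.β_b
  β_b := A.α_a
  a_mul_b := A.b_mul_a
  b_mul_a := A.a_mul_b
  a_mem := A.b_mem
  b_mem := A.a_mem
  da_add_db := by rw [add_comm, A.da_add_db]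

/-- The arrows between the vertices `i` and `i + 1`. -/
def arrowPair (hn : 3 ≤ n) (N : ℤ) (i : ZMod n) : ArrowPair k N i (i + 1) where
  a := gen k (up i)
  b := gen k (down i)
  α := coefUp k i
  β := coefDown k i
  da := deg N (up i)
  db := deg N (down i)
  idem_a := gen_vertex_mul_up k i
  a_idem := gen_up_mul_vertex k i
  idem_b := gen_vertex_mul_down k i
  b_idem := gen_down_mul_vertex k i
  corner_a := corner_up hn i
  corner_b := corner_down hn i
  α_a := coefUp_up i
  β_b := coefDown_down i
  a_mul_b := rfl
  b_mul_a := down_mul_up i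
  a_mem := gen_mem k N _
  b_mem := gen_mem k N _
  da_add_db := deg_up_add_deg_down_eq N i

theorem ArrowPair.isHomog_α {N : ℤ} {i j : ZMod n} (A : ArrowPair k N i j) : IsHomog N A.α A.da :=
  isHomog_of_corner N A.corner_a A.a_mem A.α_a

end Arrows

/-! ### Elements of a twist and maps out of it -/

namespace DGMod

open MulOpposite

variable {k : Type u} [Field k] {n : ℕ} [NeZero n] {N : ℤ}

section Action

variable (X : DGMod k n N)

theorem op_smul_op_smul (r s : Zigzag k n) (m : X.carrier) : op r • op s • m = op (s * r) • m := by
  rw [smul_smul, op_mul]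

theorem op_smul_k_smul (c : k) (r : Zigzag k n) (m : X.carrier) :
    op r • c • m = c • op r • m := smul_comm _ _ _

theorem op_k_smul_smul (c : k) (r : Zigzag k n) (m : X.carrier) :
    op (c • r) • m = c • op r • m := by
  rw [MulOpposite.op_smul, smul_assoc]

theorem op_add_smul (r s : Zigzag k n) (m : X.carrier) :
    op (r + s) • m = op r • m + op s • m := by
  rw [MulOpposite.op_add, add_smul]

theorem idem_smul_mem (i : ZMod n) {c : Bideg} {m : X.carrier} (hm : m ∈ X.gr c) :
    op (idem k i) • m ∈ X.gr c := by
  have := X.smul_mem c 0 m _ hm (idem_mem k N i)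
  rwa [add_zero] at this

theorem smul_mem_of_eq {a b c : Bideg} {m : X.carrier} {r : Zigzag k n} (hm : m ∈ X.gr a)
    (hr : r ∈ bigrading k N b) (h : a + b = c) : op r • m ∈ X.gr c :=
  h ▸ X.smul_mem a b m r hm hr

theorem gr_of_eq {a c : Bideg} {m : X.carrier} (hm : m ∈ X.gr a) (h : a = c) : m ∈ X.gr c := h ▸ hm

theorem k_smul_d (c : k) (m : X.carrier) : X.d (c • m) = c • X.d m :=
  LinearMap.map_smul_of_tower X.d c m

end Action

section Carrier

variable (i : ZMod n) (Y : DGMod k n N)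

/-- The underlying module of the twist `T_i Y`. -/
abbrev TwistModule : Type u := (proj k i ⊗[k] Y.corner i) × Y.carrier

/-- The projection `Y → Y (i)`. -/
def cornerProj : Y.carrier →ₗ[k] Y.corner i :=
  (Y.actK (idem k i)).codRestrict (Y.corner i) (fun m => Y.actK_idem i m)

variable (k) in
/-- The idempotent `(i)` as an element of `P_i`. -/
def projIdem : proj k i := ⟨idem k i, gen_vertex_mul_self k i⟩

/-- The map `y ↦ y (i) ⊗ (i)`. -/
def moduleCop : Y.carrier →ₗ[k] TwistModule i Y :=
  (LinearMap.inl k _ _).comp ((TensorProduct.mk k _ _ (projIdem k i)).comp (cornerProj i Y))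

/-- The map `(y ⊗ p, z) ↦ κ(p) y`. -/
def moduleKap (κ : Zigzag k n →ₗ[k] k) : TwistModule i Y →ₗ[k] Y.carrier :=
  (TensorProduct.lift (LinearMap.compl₂ ((LinearMap.lsmul k Y.carrier).comp
    (κ.comp ((proj k i).subtype.restrictScalars k))) (Y.corner i).subtype)).comp
      (LinearMap.fst k _ _)

/-- The module map `(y ⊗ p, z) ↦ η(y) p + f(z)`. -/
def moduleDesc (W : DGMod k n N) (f : Y.carrier →ₗ[(Zigzag k n)ᵐᵒᵖ] W.carrier)
    (η : Y.carrier →ₗ[k] W.carrier) : TwistModule i Y →ₗ[(Zigzag k n)ᵐᵒᵖ] W.carrier :=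
  LinearMap.coprod (TensorProduct.AlgebraTensorModule.lift
    { toFun := fun p => (W.actK (p : Zigzag k n)).comp (η.comp (Y.corner i).subtype)
      map_add' := fun p q => LinearMap.ext fun m => W.op_add_smul _ _ _
      map_smul' := fun r p => LinearMap.ext fun m => by
        change op ((p : Zigzag k n) * unop r) • η m = r • op (p : Zigzag k n) • η m
        rw [op_mul, op_unop, mul_smul] }) f

theorem moduleCop_apply (y : Y.carrier) :
    moduleCop i Y y = (projIdem k i ⊗ₜ[k] cornerProj i Y y, 0) := rfl

theorem moduleKap_cop (κ : Zigzag k n →ₗ[k] k) (r : Zigzag k n) (y : Y.carrier) :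
    moduleKap i Y κ (op r • moduleCop i Y y) = κ (idem k i * r) • op (idem k i) • y := rfl

theorem moduleKap_snd (κ : Zigzag k n →ₗ[k] k) (y : Y.carrier) :
    moduleKap i Y κ (0, y) = 0 := by
  simp [moduleKap]

theorem moduleDesc_cop (W : DGMod k n N) (f : Y.carrier →ₗ[(Zigzag k n)ᵐᵒᵖ] W.carrier)
    (η : Y.carrier →ₗ[k] W.carrier) (y : Y.carrier) :
    moduleDesc i Y W f η (moduleCop i Y y) = op (idem k i) • η (op (idem k i) • y) := by
  rw [moduleCop_apply, moduleDesc, LinearMap.coprod_apply, map_zero, add_zero]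
  rfl

theorem moduleDesc_snd (W : DGMod k n N) (f : Y.carrier →ₗ[(Zigzag k n)ᵐᵒᵖ] W.carrier)
    (η : Y.carrier →ₗ[k] W.carrier) (y : Y.carrier) :
    moduleDesc i Y W f η (0, y) = f y := by
  simp [moduleDesc]

theorem moduleCop_idem (y : Y.carrier) :
    moduleCop i Y (op (idem k i) • y) = moduleCop i Y y :=
  Prod.ext (congrArg (projIdem k i ⊗ₜ[k] ·) (Subtype.ext (Y.actK_idem i y))) rfl

theorem idem_moduleCop (y : Y.carrier) :
    op (idem k i) • moduleCop i Y y = moduleCop i Y y :=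
  Prod.ext (congrArg (· ⊗ₜ[k] cornerProj i Y y) (Subtype.ext (gen_vertex_mul_self k i)))
    (smul_zero _)

-- The tensor y ⊗ p is the translate by `p` of y ⊗ (i), so the module is generated by the images of
-- `Y` and of `moduleCop`.
@[elab_as_elim]
theorem twistModule_induction {P : TwistModule i Y → Prop}
    (add : ∀ s t, P s → P t → P (s + t)) (inc : ∀ y, P (0, y))
    (cop : ∀ (r : Zigzag k n) (y : Y.carrier), op (idem k i) • y = y →
      P (op r • moduleCop i Y y))
    (t : TwistModule i Y) : P t := by
  have h : t = (t.1, 0) + (0, t.2) := by simp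
  rw [h]
  refine add _ _ ?_ (inc _)
  generalize t.1 = s
  induction s using TensorProduct.induction_on with
  | zero => exact inc 0
  | add x y hx hy =>
    have := add _ _ hx hy
    rwa [Prod.mk_add_mk, add_zero] at this
  | tmul p m =>
    have := cop (p : Zigzag k n) (m : Y.carrier) m.2
    convert this using 1
    refine Prod.ext ?_ (smul_zero _).symm
    change p ⊗ₜ[k] m = (⟨idem k i * (p : Zigzag k n), _⟩ : proj k i) ⊗ₜ[k] cornerProj i Y m
    congr 1
    · exact Subtype.ext p.2.symm
    · exact Subtype.ext m.2.symm

theorem moduleCop_mem {c : Bideg} {y : Y.carrier} (hy : y ∈ Y.gr c) :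
    (moduleCop i Y y).1 ∈ Y.twistGr i c :=
  Submodule.subset_span ⟨0, c, zero_add c, _, idem_mem k N i, _, Y.idem_smul_mem i hy, rfl⟩

@[elab_as_elim]
theorem twistGr_induction {c : Bideg} {P : (proj k i ⊗[k] Y.corner i) → Prop}
    (zero : P 0) (add : ∀ s t, P s → P t → P (s + t))
    (smul : ∀ (l : k) s, P s → P (l • s))
    (tmul : ∀ (a b : Bideg), a + b = c → ∀ (p : proj k i), (p : Zigzag k n) ∈ bigrading k N a →
      ∀ (y : Y.corner i), (y : Y.carrier) ∈ Y.gr b → P (p ⊗ₜ[k] y))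
    (t : proj k i ⊗[k] Y.corner i) (ht : t ∈ Y.twistGr i c) : P t := by
  induction ht using Submodule.span_induction with
  | zero => exact zero
  | add x y _ _ hx hy => exact add x y hx hy
  | smul l x _ hx => exact smul l x hx
  | mem x hx =>
    obtain ⟨a, b, hab, p, hp, y, hy, rfl⟩ := hx
    exact tmul a b hab p hp y hy

/-- Here `s` is the shift of the grading on the tensor summand. It is (1, 0) for the twist and (N -
1, 0) for the inverse twist, which has the same underlying module. -/
theorem moduleDesc_mem (W : DGMod k n N) (f : Y.carrier →ₗ[(Zigzag k n)ᵐᵒᵖ] W.carrier)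
    (η : Y.carrier →ₗ[k] W.carrier) {c s : Bideg} (hf : ∀ y ∈ Y.gr c, f y ∈ W.gr c)
    (hη : ∀ b, ∀ y ∈ Y.gr (b + s), op (idem k i) • y = y → η y ∈ W.gr b) (t : TwistModule i Y)
    (ht1 : t.1 ∈ Y.twistGr i (c + s)) (ht2 : t.2 ∈ Y.gr c) : moduleDesc i Y W f η t ∈ W.gr c := by
  rw [moduleDesc, LinearMap.coprod_apply]
  refine add_mem ?_ (hf _ ht2)
  refine twistGr_induction i Y ?_ (fun x y hx hy => ?_) (fun l x hx => ?_)
    (fun a b hab p hp y hy => ?_) t.1 ht1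
  · rw [map_zero]; exact zero_mem _
  · rw [map_add]; exact add_mem hx hy
  · rw [LinearMap.map_smul_of_tower]; exact Submodule.smul_mem _ _ hx
  · refine W.smul_mem_of_eq (a := b - s) (hη _ _ (by rwa [sub_add_cancel]) y.2) hp ?_
    rw [← add_sub_right_comm, add_comm, hab, add_sub_cancel_right]

theorem moduleKap_mem {κ : Zigzag k n →ₗ[k] k} {c s : Bideg} (hκ : IsHomog N κ s)
    (t : TwistModule i Y) (ht : t.1 ∈ Y.twistGr i (c + s)) : moduleKap i Y κ t ∈ Y.gr c := by
  rw [moduleKap, LinearMap.comp_apply, LinearMap.fst_apply]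
  refine twistGr_induction i Y ?_ (fun x y hx hy => ?_) (fun l x hx => ?_)
    (fun a b hab p hp y hy => ?_) t.1 ht
  · rw [map_zero]; exact zero_mem _
  · rw [map_add]; exact add_mem hx hy
  · rw [map_smul]; exact Submodule.smul_mem _ _ hx
  · change κ p • (y : Y.carrier) ∈ Y.gr c
    -- If κ(p) ≠ 0, homogeneity forces the bidegree of `p` to be `s`, and this is exactly the shift
    -- on the tensor summand.
    by_cases h : κ p = 0
    · rw [h, zero_smul]; exact zero_mem _
    · obtain rfl := hκ a _ hp h
      rw [add_comm] at hab
      rw [← add_right_cancel hab]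
      exact Submodule.smul_mem _ _ hy

end Carrier

section Twist

/-- The twist `T_i Y`. -/
def Tw (i : ZMod n) (Y : DGMod k n N) : DGMod k n N := (twistFunctor k N i).obj Y

variable (i : ZMod n) (Y : DGMod k n N)

/-- The inclusion `Y → T_i Y`. -/
def inc : Y.carrier →ₗ[(Zigzag k n)ᵐᵒᵖ] (Tw i Y).carrier :=
  LinearMap.inr (Zigzag k n)ᵐᵒᵖ (proj k i ⊗[k] Y.corner i) Y.carrier

/-- The projection `T_i Y → Y`, which does not commute with the differentials. -/
def twSnd : (Tw i Y).carrier →ₗ[(Zigzag k n)ᵐᵒᵖ] Y.carrier :=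
  LinearMap.snd (Zigzag k n)ᵐᵒᵖ (proj k i ⊗[k] Y.corner i) Y.carrier

/-- The map `Y → T_i Y`, `y ↦ y (i) ⊗ (i)`. -/
def cop : Y.carrier →ₗ[k] (Tw i Y).carrier := moduleCop i Y

/-- The map `T_i Y → Y`, `(y ⊗ p, z) ↦ κ(p) y`. -/
def kap (κ : Zigzag k n →ₗ[k] k) : (Tw i Y).carrier →ₗ[k] Y.carrier := moduleKap i Y κ

variable {Y}

/-- The module map `(y ⊗ p, z) ↦ η(y) p + f(z)` on `T_i Y`. -/
def desc {W : DGMod k n N} (f : Y.carrier →ₗ[(Zigzag k n)ᵐᵒᵖ] W.carrier)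
    (η : Y.carrier →ₗ[k] W.carrier) : (Tw i Y).carrier →ₗ[(Zigzag k n)ᵐᵒᵖ] W.carrier :=
  moduleDesc i Y W f η

theorem cop_idem (y : Y.carrier) : cop i Y (op (idem k i) • y) = cop i Y y :=
  moduleCop_idem i Y y

theorem idem_cop (y : Y.carrier) : op (idem k i) • cop i Y y = cop i Y y :=
  idem_moduleCop i Y y

theorem d_inc (y : Y.carrier) : (Tw i Y).d (inc i Y y) = inc i Y (Y.d y) := by
  refine Prod.ext ((congrArg (- ·) (map_zero (twistObj i Y).d)).trans
    (neg_zero (G := (twistObj i Y).carrier))) ?_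
  change (ev i Y).lin 0 + Y.d y = Y.d y
  rw [map_zero, zero_add]

/-- On Y(i) this reads d ∘ cop + cop ∘ d = inc: the map `cop` contracts the inclusion of Y into its
twist. The chain map verifications for iterated twists rest on this identity. -/
theorem d_cop (y : Y.carrier) :
    (Tw i Y).d (cop i Y y) = inc i Y (op (idem k i) • y) - cop i Y (Y.d y) := by
  refine Prod.ext ?_ ?_
  · refine Eq.trans ?_ (zero_sub (G := (twistObj i Y).carrier) _).symm
    exact congrArg (fun t => -(projIdem k i ⊗ₜ[k] t : (twistObj i Y).carrier))
      (Subtype.ext (Y.d_smul _ _))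
  · change op (idem k i) • op (idem k i) • y + Y.d 0 = op (idem k i) • y - 0
    rw [op_smul_op_smul, gen_vertex_mul_self, map_zero, add_zero, sub_zero]

theorem twSnd_inc (y : Y.carrier) : twSnd i Y (inc i Y y) = y := rfl

theorem twSnd_cop (y : Y.carrier) : twSnd i Y (cop i Y y) = 0 := rfl

theorem kap_inc (κ : Zigzag k n →ₗ[k] k) (y : Y.carrier) : kap i Y κ (inc i Y y) = 0 :=
  moduleKap_snd i Y κ y

theorem kap_op_inc (κ : Zigzag k n →ₗ[k] k) (r : Zigzag k n) (y : Y.carrier) :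
    kap i Y κ (op r • inc i Y y) = 0 := by
  rw [← map_smul, kap_inc]

theorem kap_op_cop (κ : Zigzag k n →ₗ[k] k) (r : Zigzag k n) (y : Y.carrier) :
    kap i Y κ (op r • cop i Y y) = κ (idem k i * r) • op (idem k i) • y :=
  moduleKap_cop i Y κ r y

theorem kap_cop (κ : Zigzag k n →ₗ[k] k) (y : Y.carrier) :
    kap i Y κ (cop i Y y) = κ (idem k i) • op (idem k i) • y := by
  rw [← idem_cop, kap_op_cop, gen_vertex_mul_self]

section Desc

variable {W : DGMod k n N} (f : Y.carrier →ₗ[(Zigzag k n)ᵐᵒᵖ] W.carrier)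
    (η : Y.carrier →ₗ[k] W.carrier)

theorem desc_inc (y : Y.carrier) : desc i f η (inc i Y y) = f y := moduleDesc_snd i Y W f η y

theorem desc_cop' (y : Y.carrier) :
    desc i f η (cop i Y y) = op (idem k i) • η (op (idem k i) • y) := moduleDesc_cop i Y W f η y

theorem desc_cop {y : Y.carrier} (hy : op (idem k i) • y = y)
    (h : op (idem k i) • η y = η y) : desc i f η (cop i Y y) = η y := by
  rw [desc_cop', hy, h]

end Desc

@[elab_as_elim]
theorem tw_induction {P : (Tw i Y).carrier → Prop}
    (add : ∀ s t, P s → P t → P (s + t)) (inc : ∀ y, P (inc i Y y))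
    (cop : ∀ (r : Zigzag k n) (y : Y.carrier), op (idem k i) • y = y → P (op r • cop i Y y))
    (t : (Tw i Y).carrier) : P t :=
  twistModule_induction i Y (P := P) add inc cop t

theorem tw_hom_ext {W : DGMod k n N} {f g : (Tw i Y).carrier →ₗ[(Zigzag k n)ᵐᵒᵖ] W.carrier}
    (h1 : ∀ y, f (inc i Y y) = g (inc i Y y))
    (h2 : ∀ y, op (idem k i) • y = y → f (cop i Y y) = g (cop i Y y)) (t : (Tw i Y).carrier) :
    f t = g t := by
  induction t using tw_induction with
  | add s t hs ht => rw [map_add, map_add, hs, ht]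
  | inc y => exact h1 y
  | cop r y hy => rw [map_smul, map_smul, h2 y hy]

theorem inc_mem {c : Bideg} {y : Y.carrier} (hy : y ∈ Y.gr c) : inc i Y y ∈ (Tw i Y).gr c :=
  ⟨zero_mem _, hy⟩

theorem cop_mem {c : Bideg} {y : Y.carrier} (hy : y ∈ Y.gr (c + (1, 0))) :
    cop i Y y ∈ (Tw i Y).gr c :=
  ⟨moduleCop_mem i Y hy, zero_mem _⟩

theorem twSnd_mem {c : Bideg} {t : (Tw i Y).carrier} (ht : t ∈ (Tw i Y).gr c) :
    twSnd i Y t ∈ Y.gr c := ht.2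

theorem kap_mem {κ : Zigzag k n →ₗ[k] k} {c c' s : Bideg} (hκ : IsHomog N κ s)
    {t : (Tw i Y).carrier} (ht : t ∈ (Tw i Y).gr c') (h : c' + (1, 0) = c + s) :
    kap i Y κ t ∈ Y.gr c :=
  moduleKap_mem i Y hκ t (h ▸ ht.1)

/-- The morphism of dg modules `T_i Y ⟶ W` given by a morphism `Y ⟶ W` and a contraction of
its restriction to `Y (i)`. -/
def descHom {W : DGMod k n N} (f : Y ⟶ W) (η : Y.carrier →ₗ[k] W.carrier)
    (hη : ∀ b, ∀ y ∈ Y.gr (b + (1, 0)), op (idem k i) • y = y → η y ∈ W.gr b)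
    (hd : ∀ y, op (idem k i) • y = y → W.d (η y) + η (Y.d y) = f.lin y) : Tw i Y ⟶ W :=
  (⟨desc i f.lin η, fun c t ht => moduleDesc_mem i Y W f.lin η (f.map_mem c) hη t ht.1 ht.2, by
    intro t
    refine LinearMap.congr_fun (f := (desc i f.lin η).comp (Tw i Y).d)
      (g := W.d.comp (desc i f.lin η)) (LinearMap.ext fun t => ?_) t
    refine tw_hom_ext i (fun y => ?_) (fun y hy => ?_) t
    · rw [LinearMap.comp_apply, LinearMap.comp_apply, d_inc, desc_inc, desc_inc, f.comm]
    -- On `cop y` with y in Y(i), compatibility with the differentials is the contraction equation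
    -- `hd`.
    · have h1 : f.lin y = op (idem k i) • f.lin y := by rw [← Hom.lin_smul, hy]
      have h2 : op (idem k i) • Y.d y = Y.d y := by rw [← d_smul, hy]
      rw [LinearMap.comp_apply, LinearMap.comp_apply, d_cop, map_sub, desc_inc, desc_cop',
        desc_cop', hy, h1, ← hd y hy, h2, d_smul, smul_add, add_sub_cancel_right]⟩ : Hom (Tw i Y) W)

theorem kap_idem {κ : Zigzag k n →ₗ[k] k} {j : ZMod n} (hκ : ∀ r, κ (r * idem k j) = κ r)
    (t : (Tw i Y).carrier) : kap i Y κ (op (idem k j) • t) = kap i Y κ t := by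
  induction t using tw_induction with
  | add s t hs ht => rw [smul_add, map_add, map_add, hs, ht]
  | inc y => rw [← map_smul, kap_inc, kap_inc]
  | cop r y hy => rw [op_smul_op_smul, kap_op_cop, kap_op_cop, ← mul_assoc, hκ]

theorem idem_kap (κ : Zigzag k n →ₗ[k] k) (t : (Tw i Y).carrier) :
    op (idem k i) • kap i Y κ t = kap i Y κ t := by
  induction t using tw_induction with
  | add s t hs ht => rw [map_add, smul_add, hs, ht]
  | inc y => rw [kap_inc, smul_zero]
  | cop r y hy => rw [kap_op_cop, op_smul_k_smul, hy, hy]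

theorem k_smul_op_cop (c : k) (r : Zigzag k n) (y : Y.carrier) :
    op (c • r) • cop i Y y = op r • cop i Y (c • y) := by
  rw [op_k_smul_smul, map_smul, op_smul_k_smul]

/-- An additive property of elements of `(T_i Y)(j)`, for `j` adjacent to `i`. -/
@[elab_as_elim]
theorem tw_induction_adjacent {j : ZMod n} (A : ArrowPair k N i j) {P : (Tw i Y).carrier → Prop}
    (add : ∀ s t, P s → P t → P (s + t))
    (inc : ∀ y, op (idem k j) • y = y → P (inc i Y y))
    (cop : ∀ y, op (idem k i) • y = y → P (op A.a • cop i Y y))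
    (t : (Tw i Y).carrier) (ht : op (idem k j) • t = t) : P t := by
  rw [← ht]
  clear ht
  induction t using tw_induction with
  | add s t hs ht => rw [smul_add]; exact add _ _ hs ht
  | inc y =>
    rw [← map_smul]
    exact inc _ (by rw [op_smul_op_smul, gen_vertex_mul_self])
  | cop r y hy =>
    -- Only the corner (i)r(j) acts here. It is a multiple of the arrow, and the scalar is moved
    -- into `y`.
    rw [← idem_cop, op_smul_op_smul, op_smul_op_smul, ← mul_assoc, A.corner_a, k_smul_op_cop]
    exact cop _ (by rw [op_smul_k_smul, hy])

/-- An additive property of elements of `(T_i Y)(i)`. -/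
@[elab_as_elim]
theorem tw_induction_self (hn : 3 ≤ n) {P : (Tw i Y).carrier → Prop}
    (add : ∀ s t, P s → P t → P (s + t))
    (inc : ∀ y, op (idem k i) • y = y → P (inc i Y y))
    (cop : ∀ y, op (idem k i) • y = y → P (cop i Y y))
    (loop : ∀ y, op (idem k i) • y = y → P (op (loop k i) • DGMod.cop i Y y))
    (t : (Tw i Y).carrier) (ht : op (idem k i) • t = t) : P t := by
  rw [← ht]
  clear ht
  induction t using tw_induction with
  | add s t hs ht => rw [smul_add]; exact add _ _ hs ht
  | inc y =>
    rw [← map_smul]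
    exact inc _ (by rw [op_smul_op_smul, gen_vertex_mul_self])
  | cop r y hy =>
    rw [← idem_cop, op_smul_op_smul, op_smul_op_smul, ← mul_assoc, corner_self hn, op_add_smul,
      k_smul_op_cop, k_smul_op_cop, idem_cop]
    exact add _ _ (cop _ (by rw [op_smul_k_smul, hy])) (loop _ (by rw [op_smul_k_smul, hy]))

/-- A property of elements of `(T_i Y)(j)`, for `j` neither equal nor adjacent to `i`. -/
@[elab_as_elim]
theorem tw_induction_far {j : ZMod n} (h1 : j ≠ i) (h2 : j ≠ i + 1) (h3 : i ≠ j + 1)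
    {P : (Tw i Y).carrier → Prop} (inc : ∀ y, op (idem k j) • y = y → P (inc i Y y))
    (t : (Tw i Y).carrier) (ht : op (idem k j) • t = t) : P t := by
  suffices h : ∃ y, op (idem k j) • y = y ∧ t = DGMod.inc i Y y by
    obtain ⟨y, hy, rfl⟩ := h
    exact inc y hy
  rw [← ht]
  clear ht
  induction t using tw_induction with
  | add s t hs ht =>
    obtain ⟨y, hy, hs⟩ := hs
    obtain ⟨z, hz, ht⟩ := ht
    exact ⟨y + z, by rw [smul_add, hy, hz], by rw [smul_add, hs, ht, map_add]⟩
  | inc y => exact ⟨op (idem k j) • y, by rw [op_smul_op_smul, gen_vertex_mul_self], by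
      rw [← map_smul]⟩
  | cop r y hy =>
    exact ⟨0, smul_zero _, by
      rw [← idem_cop, op_smul_op_smul, op_smul_op_smul, ← mul_assoc, corner_far h1 h2 h3, op_zero,
        zero_smul, map_zero]⟩

/-- The module map `T_i Y → T_i Z` induced by `g : Y → Z`, with the factor `ε` on the summand
`Y ⊗ R_n (i) ⊗ P_i`. -/
def tmap (ε : ℤ) {Z : DGMod k n N} (g : Y.carrier →ₗ[(Zigzag k n)ᵐᵒᵖ] Z.carrier) :
    (Tw i Y).carrier →ₗ[(Zigzag k n)ᵐᵒᵖ] (Tw i Z).carrier :=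
  desc i ((inc i Z).comp g) (ε • (cop i Z).comp (g.restrictScalars k))

section TMap

variable (ε : ℤ) {Z : DGMod k n N} (g : Y.carrier →ₗ[(Zigzag k n)ᵐᵒᵖ] Z.carrier)

theorem tmap_inc (y : Y.carrier) : tmap i ε g (inc i Y y) = inc i Z (g y) := desc_inc i _ _ y

theorem tmap_cop (y : Y.carrier) : tmap i ε g (cop i Y y) = ε • cop i Z (g y) := by
  rw [tmap, desc_cop']
  simp only [LinearMap.smul_apply, LinearMap.comp_apply, LinearMap.coe_restrictScalars,
    map_smul, cop_idem]
  rw [smul_comm, idem_cop]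

theorem twSnd_tmap (t : (Tw i Y).carrier) : twSnd i Z (tmap i ε g t) = g (twSnd i Y t) := by
  induction t using tw_induction with
  | add s t hs ht => simp only [map_add, hs, ht]
  | inc y => rw [tmap_inc, twSnd_inc, twSnd_inc]
  | cop r y hy => simp only [map_smul, tmap_cop, map_zsmul, twSnd_cop, smul_zero, map_zero]

theorem kap_tmap (κ : Zigzag k n →ₗ[k] k) (t : (Tw i Y).carrier) :
    kap i Z κ (tmap i ε g t) = ε • g (kap i Y κ t) := by
  induction t using tw_induction with
  | add s t hs ht => simp only [map_add, hs, ht, smul_add]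
  | inc y => rw [tmap_inc, kap_inc, kap_inc, map_zero, smul_zero]
  | cop r y hy =>
    rw [map_smul, tmap_cop, smul_comm, map_zsmul, kap_op_cop, kap_op_cop,
      LinearMap.map_smul_of_tower, map_smul]

end TMap

/-- Functoriality of the twist is `tmap` with ε = 1, and by `twistShiftIso_lin` its commutation with
a shift is `tmap` of an identity map with ε the sign of the shift. A formula valid for all ε thus
yields naturality and compatibility with the shifts together. -/
theorem twistFunctor_map_lin {Z : DGMod k n N} (g : Y ⟶ Z) (t : (Tw i Y).carrier) :
    Hom.lin ((twistFunctor k N i).map g) t = tmap i 1 g.lin t := by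
  refine tw_hom_ext (Y := Y) (W := Tw i Z) i (f := Hom.lin ((twistFunctor k N i).map g))
    (fun y => ?_) (fun y hy => ?_) t
  · rw [tmap_inc]
    exact Prod.ext (map_zero (twistMap i g).lin) rfl
  · rw [tmap_cop, one_smul]
    refine Prod.ext ?_ (map_zero g.lin)
    exact congrArg (projIdem k i ⊗ₜ[k] ·) (Subtype.ext (map_smul g.lin _ y))

theorem twistShiftIso_lin (s : Bideg) (t : (Tw i (shiftObj s Y)).carrier) :
    Hom.lin ((twistShiftIso i s).hom.app Y) t =
      tmap (Y := shiftObj s Y) (Z := Y) i (sgn s) (LinearMap.id (M := Y.carrier)) t := by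
  refine tw_hom_ext (Y := shiftObj s Y) (W := shiftObj s (Tw i Y)) i
    (f := Hom.lin ((twistShiftIso i s).hom.app Y)) (fun y => ?_) (fun y hy => ?_) t
  · rw [tmap_inc]
    exact Prod.ext (smul_zero (M := ℤ) (A := (twistObj i Y).carrier) (sgn s)) rfl
  · rw [tmap_cop]
    exact Prod.ext rfl (smul_zero (sgn s)).symm

end Twist

end DGMod

namespace DGMod

open MulOpposite

variable {k : Type u} [Field k] {n : ℕ} [NeZero n] {N : ℤ}

/-! ### The braid map between triple twists and its homotopy inverse -/

section Braid

variable {i j : ZMod n} (A : ArrowPair k N i j) (X : DGMod k n N)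

theorem smul_inc (i : ZMod n) (Y : DGMod k n N) (r : Zigzag k n) (y : Y.carrier) :
    op r • inc i Y y = inc i Y (op r • y) := (map_smul _ _ _).symm

theorem op_smul_zsmul (ε : ℤ) (r : Zigzag k n) (m : X.carrier) :
    op r • ε • m = ε • op r • m := smul_comm _ _ _

/-- The inclusion `Y → T_i Y` as a `k`-linear map. -/
abbrev incK (i : ZMod n) (Y : DGMod k n N) : Y.carrier →ₗ[k] (Tw i Y).carrier :=
  (inc i Y).restrictScalars k

/-- The inclusion `Y → T_i Y` as a morphism of dg modules. -/
def incHom (i : ZMod n) (Y : DGMod k n N) : Y ⟶ Tw i Y :=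
  (⟨inc i Y, fun _ _ h => inc_mem i h, fun y => (d_inc i y).symm⟩ : Hom Y (Tw i Y))

/-- The contraction of `X → T_j T_i T_j X` on `X (i)`. -/
def braidEta₁ (i j : ZMod n) (X : DGMod k n N) : X.carrier →ₗ[k] (Tw j (Tw i (Tw j X))).carrier :=
  incK j _ ∘ₗ cop i _ ∘ₗ incK j X

/-- The contraction on `(T_i X) (j)` of the map `T_i X → T_j T_i T_j X`. -/
def braidEta₂ : (Tw i X).carrier →ₗ[k] (Tw j (Tw i (Tw j X))).carrier :=
  incK j _ ∘ₗ incK i _ ∘ₗ cop j X ∘ₗ (twSnd i X).restrictScalars k +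
    (cop j _ ∘ₗ actK _ A.a ∘ₗ cop i _ ∘ₗ incK j X -
      cop j _ ∘ₗ incK i _ ∘ₗ cop j X ∘ₗ actK _ A.a) ∘ₗ kap i X A.α

/-- The contraction on `(T_j T_i X) (i)` of the map `T_j T_i X → T_j T_i T_j X`. -/
def braidEta₃ : (Tw j (Tw i X)).carrier →ₗ[k] (Tw j (Tw i (Tw j X))).carrier :=
  (braidEta₁ i j X ∘ₗ (twSnd i X).restrictScalars k +
    (actK _ A.b ∘ₗ (cop j _ ∘ₗ actK _ A.a ∘ₗ cop i _ ∘ₗ incK j X -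
      cop j _ ∘ₗ incK i _ ∘ₗ cop j X ∘ₗ actK _ A.a) +
      incK j _ ∘ₗ cop i _ ∘ₗ actK _ A.b ∘ₗ cop j X ∘ₗ actK _ A.a) ∘ₗ kap i X (coefLoop k i)) ∘ₗ
        (twSnd j (Tw i X)).restrictScalars k +
  incK j _ ∘ₗ cop i _ ∘ₗ actK _ A.b ∘ₗ cop j X ∘ₗ (twSnd i X).restrictScalars k ∘ₗ
    kap j (Tw i X) A.β

theorem braidEta₁_apply (x : X.carrier) :
    braidEta₁ i j X x = inc j _ (cop i _ (inc j X x)) := rfl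

theorem braidEta₂_apply (t : (Tw i X).carrier) :
    braidEta₂ A X t = inc j _ (inc i _ (cop j X (twSnd i X t))) +
      (cop j _ (op A.a • cop i _ (inc j X (kap i X A.α t))) -
        cop j _ (inc i _ (cop j X (op A.a • kap i X A.α t)))) := rfl

theorem braidEta₃_apply (t : (Tw j (Tw i X)).carrier) :
    braidEta₃ A X t = (inc j _ (cop i _ (inc j X (twSnd i X (twSnd j _ t)))) +
      (op A.b • (cop j _ (op A.a • cop i _ (inc j X (kap i X (coefLoop k i) (twSnd j _ t)))) -
        cop j _ (inc i _ (cop j X (op A.a • kap i X (coefLoop k i) (twSnd j _ t))))) +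
        inc j _ (cop i _ (op A.b • cop j X (op A.a • kap i X (coefLoop k i) (twSnd j _ t)))))) +
      inc j _ (cop i _ (op A.b • cop j X (twSnd i X (kap j _ A.β t)))) := rfl

/-- The morphism `T_i X ⟶ T_j T_i T_j X`. -/
def braidHom₁ (i j : ZMod n) (X : DGMod k n N) : Tw i X ⟶ Tw j (Tw i (Tw j X)) :=
  descHom i (incHom j X ≫ incHom i _ ≫ incHom j _) (braidEta₁ i j X)
    (fun b y hy _ => inc_mem _ (cop_mem _ (inc_mem _ hy)))
    (fun y hy => by
      rw [braidEta₁_apply, braidEta₁_apply, d_inc, d_cop, d_inc, smul_inc, hy, map_sub,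
        sub_add_cancel]
      rfl)

theorem braidHom₁_inc (x : X.carrier) :
    Hom.lin (braidHom₁ i j X) (inc i X x) = inc j _ (inc i _ (inc j X x)) := desc_inc i _ _ x

theorem braidHom₁_cop {x : X.carrier} (hx : op (idem k i) • x = x) :
    Hom.lin (braidHom₁ i j X) (cop i X x) = inc j _ (cop i _ (inc j X x)) :=
  desc_cop i _ _ hx (by rw [braidEta₁_apply, smul_inc, idem_cop])

theorem idem_braidEta₂ (t : (Tw i X).carrier) :
    op (idem k j) • braidEta₂ A X t = braidEta₂ A X t := by
  simp only [braidEta₂_apply, smul_add, smul_sub, smul_inc, idem_cop]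

theorem idem_braidEta₃ (t : (Tw j (Tw i X)).carrier) :
    op (idem k i) • braidEta₃ A X t = braidEta₃ A X t := by
  simp only [braidEta₃_apply, smul_add, smul_sub, smul_inc, idem_cop, op_smul_op_smul, A.b_idem]

theorem braidEta₂_mem {c : Bideg} {t : (Tw i X).carrier} (ht : t ∈ (Tw i X).gr (c + (1, 0))) :
    braidEta₂ A X t ∈ (Tw j (Tw i (Tw j X))).gr c := by
  have h := kap_mem i (c := c + (1, 0) + (1, 0) - A.da) A.isHomog_α ht (sub_add_cancel _ _).symm
  rw [braidEta₂_apply]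
  refine add_mem (inc_mem _ (inc_mem _ (cop_mem _ (twSnd_mem _ ht)))) (sub_mem ?_ ?_)
  · refine cop_mem _ (smul_mem_of_eq _ (cop_mem (c := c + (1, 0) - A.da) _ (inc_mem _ ?_))
      A.a_mem (sub_add_cancel _ _))
    exact gr_of_eq _ h (by abel)
  · exact cop_mem _ (inc_mem _ (cop_mem _ (smul_mem_of_eq _ h A.a_mem (sub_add_cancel _ _))))

theorem braidEta₃_mem (hn : 3 ≤ n) {c : Bideg} {t : (Tw j (Tw i X)).carrier}
    (ht : t ∈ (Tw j (Tw i X)).gr (c + (1, 0))) :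
    braidEta₃ A X t ∈ (Tw j (Tw i (Tw j X))).gr c := by
  have hs := twSnd_mem j ht
  have h := kap_mem i (c := c + (1, 0) + (1, 0) - A.da - A.db) (isHomog_coefLoop hn N i) hs
    (by rw [← A.da_add_db]; abel)
  have hu := kap_mem j (c := c + (1, 0) + (1, 0) - A.db) A.symm.isHomog_α ht
    (sub_add_cancel _ _).symm
  rw [braidEta₃_apply]
  refine add_mem (add_mem (inc_mem _ (cop_mem _ (inc_mem _ (twSnd_mem _ hs))))
    (add_mem ?_ (inc_mem _ (cop_mem _ ?_)))) (inc_mem _ (cop_mem _ ?_))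
  · refine smul_mem_of_eq _ (a := c - A.db) (sub_mem ?_ ?_) A.b_mem (sub_add_cancel _ _)
    · refine cop_mem _ (smul_mem_of_eq _ (cop_mem (c := c + (1, 0) - A.da - A.db) _ (inc_mem _ ?_))
        A.a_mem (by abel))
      exact gr_of_eq _ h (by abel)
    · exact cop_mem _ (inc_mem _ (cop_mem _ (smul_mem_of_eq _ h A.a_mem (by abel))))
  · exact smul_mem_of_eq _ (cop_mem (c := c + (1, 0) - A.db) _
      (smul_mem_of_eq _ h A.a_mem (by abel))) A.b_mem (sub_add_cancel _ _)
  · exact smul_mem_of_eq _ (cop_mem (c := c + (1, 0) - A.db) _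
      (gr_of_eq _ (twSnd_mem _ hu) (by abel))) A.b_mem (sub_add_cancel _ _)

theorem braidEta₂_inc (x : X.carrier) :
    braidEta₂ A X (inc i X x) = inc j _ (inc i _ (cop j X x)) := by
  simp [braidEta₂_apply, twSnd_inc, kap_inc]

theorem braidEta₂_cop {x : X.carrier} (hx : op (idem k i) • x = x) :
    braidEta₂ A X (op A.a • cop i X x) =
      cop j _ (op A.a • cop i _ (inc j X x)) - cop j _ (inc i _ (cop j X (op A.a • x))) := by
  simp [braidEta₂_apply, twSnd_cop, kap_op_cop, A.idem_a, A.α_a, hx]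

/-- The elements of (T_i X)(j) are sums of `inc x` and of `cop x · a`. The former are contracted by
the innermost T_j, the latter by the outermost one. The outer contraction leaves a term in `cop (inc
(inc (x a)))`, which the subtracted summand of `braidEta₂` cancels. -/
theorem d_braidEta₂ (t : (Tw i X).carrier) (ht : op (idem k j) • t = t) :
    (Tw j (Tw i (Tw j X))).d (braidEta₂ A X t) + braidEta₂ A X ((Tw i X).d t) =
      Hom.lin (braidHom₁ i j X) t := by
  refine tw_induction_adjacent i A (fun s t hs ht => ?_) (fun x hx => ?_) (fun x hx => ?_) t ht
  · simp only [map_add, ← hs, ← ht]; abel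
  · simp only [d_inc, braidEta₂_inc, d_cop, hx, map_sub, braidHom₁_inc]
    abel
  · have hdx : op (idem k i) • X.d x = X.d x := by rw [← d_smul, hx]
    simp only [d_smul, d_cop, hx, smul_sub, map_sub, smul_inc, braidEta₂_inc,
      braidEta₂_cop A X hx, braidEta₂_cop A X hdx, d_inc, Hom.lin_smul, braidHom₁_cop X hx,
      op_smul_op_smul, A.a_idem, idem_cop]
    abel

/-- The morphism `T_j T_i X ⟶ T_j T_i T_j X`. -/
def braidHom₂ : Tw j (Tw i X) ⟶ Tw j (Tw i (Tw j X)) :=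
  descHom j (braidHom₁ i j X) (braidEta₂ A X) (fun _ _ ht _ => braidEta₂_mem A X ht)
    (d_braidEta₂ A X)

theorem braidHom₂_inc (t : (Tw i X).carrier) :
    Hom.lin (braidHom₂ A X) (inc j _ t) = Hom.lin (braidHom₁ i j X) t := desc_inc j _ _ t

theorem braidHom₂_cop {t : (Tw i X).carrier} (ht : op (idem k j) • t = t) :
    Hom.lin (braidHom₂ A X) (cop j _ t) = braidEta₂ A X t :=
  desc_cop j _ _ ht (idem_braidEta₂ A X t)

theorem braidEta₃_inc_inc (x : X.carrier) :
    braidEta₃ A X (inc j _ (inc i X x)) = inc j _ (cop i _ (inc j X x)) := by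
  simp [braidEta₃_apply, twSnd_inc, kap_inc]

theorem braidEta₃_inc_cop (x : X.carrier) :
    braidEta₃ A X (inc j _ (cop i X x)) = 0 := by
  simp [braidEta₃_apply, twSnd_inc, kap_inc, twSnd_cop, kap_cop, coefLoop_idem]

theorem braidEta₃_inc_loop {x : X.carrier} (hx : op (idem k i) • x = x) :
    braidEta₃ A X (inc j _ (op (loop k i) • cop i X x)) =
      op A.b • cop j _ (op A.a • cop i _ (inc j X x)) -
        op A.b • cop j _ (inc i _ (cop j X (op A.a • x))) +
      inc j _ (cop i _ (op A.b • cop j X (op A.a • x))) := by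
  simp [braidEta₃_apply, twSnd_inc, kap_op_inc, twSnd_cop, kap_op_cop, idem_mul_loop, coefLoop_loop,
    hx, smul_sub]

theorem braidEta₃_cop_inc {x : X.carrier} (hx : op (idem k j) • x = x) :
    braidEta₃ A X (op A.b • cop j _ (inc i X x)) =
      inc j _ (cop i _ (op A.b • cop j X x)) := by
  simp [braidEta₃_apply, twSnd_inc, twSnd_cop, kap_op_cop, A.idem_b, A.β_b, smul_inc, hx]

theorem braidEta₃_cop_cop (x : X.carrier) :
    braidEta₃ A X (op A.b • cop j _ (op A.a • cop i X x)) = 0 := by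
  simp [braidEta₃_apply, twSnd_cop, kap_op_cop, A.idem_b, A.β_b, op_smul_op_smul, A.a_idem]

theorem d_idem {Y : DGMod k n N} {i : ZMod n} {y : Y.carrier} (hy : op (idem k i) • y = y) :
    op (idem k i) • Y.d y = Y.d y := by rw [← d_smul, hy]

theorem a_smul_idem (x : X.carrier) :
    op (idem k j) • op A.a • x = op A.a • x := by
  rw [op_smul_op_smul, A.a_idem]

theorem inc_idem {Y : DGMod k n N} {i j : ZMod n} {y : Y.carrier} (hy : op (idem k i) • y = y) :
    op (idem k i) • inc j Y y = inc j Y y := by rw [smul_inc, hy]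

/-- There are five kinds of elements in (T_j T_i X)(i). The value of `braidEta₃` on `inc (cop x ·
loop)` is forced: as `a b` is the loop, the equation for `cop (cop x · a) · b`, where `braidEta₃`
vanishes, expresses it through the other values. -/
theorem d_braidEta₃ (hn : 3 ≤ n) (t : (Tw j (Tw i X)).carrier) (ht : op (idem k i) • t = t) :
    (Tw j (Tw i (Tw j X))).d (braidEta₃ A X t) + braidEta₃ A X ((Tw j (Tw i X)).d t) =
      Hom.lin (braidHom₂ A X) t := by
  refine tw_induction_adjacent j A.symm (fun s t hs ht => ?_) (fun s hs => ?_) (fun s hs => ?_) t ht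
  · simp only [map_add, ← hs, ← ht]; abel
  · refine tw_induction_self i hn (fun s t hs ht => ?_) (fun x hx => ?_) (fun x hx => ?_)
      (fun x hx => ?_) s hs
    · simp only [map_add, ← hs, ← ht]; abel
    · simp only [d_inc, braidEta₃_inc_inc, d_cop, hx, map_sub, braidHom₂_inc, braidHom₁_inc,
        smul_inc]
      abel
    · simp only [d_inc, braidEta₃_inc_inc, d_cop, hx, map_sub, braidHom₂_inc, braidHom₁_cop X hx,
        braidEta₃_inc_cop, map_zero]
      abel
    · simp only [d_smul, d_inc, d_cop, hx, map_sub, map_add, smul_sub, smul_inc,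
        braidEta₃_inc_loop A X hx, braidEta₃_inc_loop A X (d_idem hx), braidEta₃_inc_inc,
        braidHom₂_inc, braidHom₁_cop X hx, Hom.lin_smul, op_smul_op_smul, A.a_idem, A.a_mul_b,
        A.b_idem, A.idem_b]
      abel
  -- The induction over `A.symm` speaks of `A.symm.a`, which is `A.b` by definition.
  · change _ + braidEta₃ A X ((Tw j (Tw i X)).d (op A.b • cop j _ s)) =
      Hom.lin (braidHom₂ A X) (op A.b • cop j _ s)
    change (Tw j (Tw i (Tw j X))).d (braidEta₃ A X (op A.b • cop j _ s)) + _ = _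
    refine tw_induction_adjacent i A (fun s t hs ht => ?_) (fun x hx => ?_) (fun x hx => ?_) s hs
    · simp only [map_add, smul_add] at hs ht ⊢; rw [← hs, ← ht]; abel
    · simp only [d_smul, d_inc, d_cop, hx, map_sub, smul_sub, smul_inc,
        braidEta₃_cop_inc A X hx, braidEta₃_cop_inc A X (d_idem hx), braidEta₃_inc_inc,
        braidHom₂_cop A X (inc_idem hx), Hom.lin_smul, op_smul_op_smul, A.b_idem,
        braidEta₂_inc]
      abel
    · simp only [d_smul, d_cop, hx, map_sub, smul_sub, smul_inc,
        braidEta₃_cop_cop,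
        braidEta₃_cop_inc A X (a_smul_idem A X x),
        braidHom₂_cop A X (a_smul_idem A (Tw i X) _), Hom.lin_smul, op_smul_op_smul, A.a_idem,
        A.a_mul_b, braidEta₂_cop A X hx, braidEta₃_inc_loop A X hx, map_zero]
      abel

/-- The morphism `T_i T_j T_i X ⟶ T_j T_i T_j X`. -/
def braidHom (hn : 3 ≤ n) : Tw i (Tw j (Tw i X)) ⟶ Tw j (Tw i (Tw j X)) :=
  descHom i (braidHom₂ A X) (braidEta₃ A X) (fun _ _ ht _ => braidEta₃_mem A X hn ht)
    (d_braidEta₃ A X hn)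

theorem braidHom_inc (hn : 3 ≤ n) (t : (Tw j (Tw i X)).carrier) :
    Hom.lin (braidHom A X hn) (inc i _ t) = Hom.lin (braidHom₂ A X) t := desc_inc i _ _ t

theorem braidHom_cop (hn : 3 ≤ n) {t : (Tw j (Tw i X)).carrier} (ht : op (idem k i) • t = t) :
    Hom.lin (braidHom A X hn) (cop i _ t) = braidEta₃ A X t :=
  desc_cop i _ _ ht (idem_braidEta₃ A X t)

/-- Chain maps that are inverse to each other up to homotopy are quasi-isomorphisms. -/
theorem quasiIso_of_homotopy {X Y : DGMod k n N} (f : X ⟶ Y) (g : Y ⟶ X)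
    (h : X.carrier → X.carrier) (h' : Y.carrier → Y.carrier)
    (hgf : ∀ x, g.lin (f.lin x) - x = X.d (h x) + h (X.d x))
    (hfg : ∀ y, f.lin (g.lin y) - y = Y.d (h' y) + h' (Y.d y)) (h0 : h 0 = 0) (h0' : h' 0 = 0) :
    quasiIso k n N f := by
  rw [quasiIso_iff]
  constructor
  · rintro x hx ⟨y, hy⟩
    have hx : X.d x = 0 := hx
    have hy : f.lin x = Y.d y := hy
    have h1 := hgf x
    rw [hx, h0, add_zero, hy, g.comm] at h1
    refine ⟨g.lin y - h x, ?_⟩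
    change x = X.d (g.lin y - h x)
    rw [map_sub, ← h1, sub_sub_cancel]
  · intro y hy
    have hy : Y.d y = 0 := hy
    have h1 := hfg y
    rw [hy, h0', add_zero] at h1
    refine ⟨g.lin y, ?_, -h' y, ?_⟩
    · change X.d (g.lin y) = 0
      rw [← g.comm, hy, map_zero]
    · change y = f.lin (g.lin y) + Y.d (-h' y)
      rw [map_neg, ← h1]
      abel

/-- The contraction that gives the homotopy between the identity of `T_i T_j T_i X` and its
projection to the reduced complex. -/
def braidZeta : (Tw j (Tw i X)).carrier →ₗ[k] (Tw i (Tw j (Tw i X))).carrier :=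
  cop i _ ∘ₗ (incK j _ ∘ₗ cop i X ∘ₗ (twSnd i X).restrictScalars k +
    actK _ A.b ∘ₗ cop j _ ∘ₗ actK _ A.a ∘ₗ cop i X ∘ₗ kap i X (coefLoop k i)) ∘ₗ
      (twSnd j (Tw i X)).restrictScalars k

theorem braidZeta_apply (t : (Tw j (Tw i X)).carrier) :
    braidZeta A X t = cop i _ (inc j _ (cop i X (twSnd i X (twSnd j _ t))) +
      op A.b • cop j _ (op A.a • cop i X (kap i X (coefLoop k i) (twSnd j _ t)))) := rfl

theorem braidZeta_inc_inc (x : X.carrier) :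
    braidZeta A X (inc j _ (inc i X x)) = cop i _ (inc j _ (cop i X x)) := by
  simp [braidZeta_apply, twSnd_inc, kap_inc]

theorem braidZeta_inc_cop (x : X.carrier) : braidZeta A X (inc j _ (cop i X x)) = 0 := by
  simp [braidZeta_apply, twSnd_inc, kap_cop, twSnd_cop, coefLoop_idem]

theorem braidZeta_inc_loop {x : X.carrier} (hx : op (idem k i) • x = x) :
    braidZeta A X (inc j _ (op (loop k i) • cop i X x)) =
      cop i _ (op A.b • cop j _ (op A.a • cop i X x)) := by
  simp [braidZeta_apply, twSnd_inc, kap_op_cop, twSnd_cop, idem_mul_loop, coefLoop_loop, hx]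

theorem braidZeta_cop (r : Zigzag k n) (t : (Tw i X).carrier) :
    braidZeta A X (op r • cop j _ t) = 0 := by
  simp [braidZeta_apply, twSnd_cop]

theorem symm_a : A.symm.a = A.b := rfl

/-- On the submodule T_j T_i X the two braid maps compose to the inclusion on the nose, so the
homotopy of `braid_homotopy` can be taken to be zero there. -/
theorem braidHom_braidHom₂ (hn : 3 ≤ n) (t : (Tw j (Tw i X)).carrier) :
    Hom.lin (braidHom A.symm X hn) (Hom.lin (braidHom₂ A X) t) = inc i _ t := by
  refine tw_hom_ext j (f := (Hom.lin (braidHom A.symm X hn)).comp (Hom.lin (braidHom₂ A X)))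
    (g := inc i _) (fun s => ?_) (fun s hs => ?_) t
  · rw [LinearMap.comp_apply, braidHom₂_inc]
    refine tw_hom_ext i (f := (Hom.lin (braidHom A.symm X hn)).comp (Hom.lin (braidHom₁ i j X)))
      (g := (inc i _).comp (inc j _)) (fun x => ?_) (fun x hx => ?_) s
    · simp only [LinearMap.comp_apply, braidHom₁_inc, braidHom_inc, braidHom₂_inc]
    · simp only [LinearMap.comp_apply, braidHom₁_cop X hx, braidHom_inc,
        braidHom₂_cop A.symm X (inc_idem hx), braidEta₂_inc]
  · rw [LinearMap.comp_apply]
    refine tw_induction_adjacent i A (fun s t hs ht => ?_) (fun x hx => ?_) (fun x hx => ?_) s hs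
    · simp only [map_add, hs, ht]
    · simp only [braidHom₂_cop A X (inc_idem hx), braidEta₂_inc, braidHom_inc, braidHom₂_inc,
        braidHom₁_cop X hx]
    · simp only [braidHom₂_cop A X (a_smul_idem A (Tw i X) _), braidEta₂_cop A X hx, map_sub,
        braidHom_cop A.symm X hn (a_smul_idem A (Tw i (Tw j X)) _),
        braidHom_cop A.symm X hn (inc_idem (idem_cop j _)), braidEta₃_inc_cop, sub_zero]
      exact braidEta₃_cop_inc A.symm X hx

/-- The homotopy pairs the summands that cancel: the outer copy of X(i)⊗P_i with the idempotent part
of X(i)⊗(i)R(i)⊗P_i, and the loop part of the latter with X(i)⊗(i)R(j)⊗(j)R(i)⊗P_i. The identity is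
then checked on the five kinds of elements of (T_j T_i X)(i). -/
theorem braid_homotopy (hn : 3 ≤ n) (t : (Tw i (Tw j (Tw i X))).carrier) :
    Hom.lin (braidHom A.symm X hn) (Hom.lin (braidHom A X hn) t) - t =
      (Tw i (Tw j (Tw i X))).d (desc i 0 (braidZeta A X) t) +
        desc i 0 (braidZeta A X) ((Tw i (Tw j (Tw i X))).d t) := by
  have hζ : ∀ t : (Tw j (Tw i X)).carrier, op (idem k i) • t = t →
      desc i 0 (braidZeta A X) (cop i _ t) = braidZeta A X t := fun t ht =>
    desc_cop i _ _ ht (by rw [braidZeta_apply, idem_cop])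
  have h1 : ∀ x, op (idem k i) • x = x → Hom.lin (braidHom A.symm X hn)
      (cop j _ (op A.a • cop i _ (inc j X x))) = inc i _ (cop j _ (op A.a • cop i X x)) :=
    fun x hx => (braidHom_cop A.symm X hn (a_smul_idem A (Tw i (Tw j X)) _)).trans
      (braidEta₃_cop_inc A.symm X hx)
  have h2 : ∀ x, Hom.lin (braidHom A.symm X hn) (cop j _ (inc i _ (cop j X x))) = 0 := fun x =>
    (braidHom_cop A.symm X hn (inc_idem (idem_cop j _))).trans (braidEta₃_inc_cop A.symm X x)
  have h4 : ∀ x, op (idem k j) • x = x → Hom.lin (braidHom₂ A.symm X) (cop i _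
      (op A.b • cop j X x)) = cop i _ (op A.b • cop j _ (inc i X x)) -
        cop i _ (inc j _ (cop i X (op A.b • x))) := fun x hx =>
    (braidHom₂_cop A.symm X (a_smul_idem A.symm (Tw j X) _)).trans (braidEta₂_cop A.symm X hx)
  have h3 : ∀ x, Hom.lin (braidHom A.symm X hn) (inc j _ (cop i _
      (op A.b • cop j X (op A.a • x)))) = cop i _ (op A.b • cop j _ (inc i X (op A.a • x))) -
        cop i _ (inc j _ (cop i X (op A.b • op A.a • x))) := fun x =>
    (braidHom_inc A.symm X hn _).trans (h4 _ (a_smul_idem A X x))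
  refine tw_hom_ext i
    (f := (Hom.lin (braidHom A.symm X hn)).comp (Hom.lin (braidHom A X hn)) - LinearMap.id)
    (g := (Tw i (Tw j (Tw i X))).d.comp (desc i 0 (braidZeta A X)) +
        (desc i 0 (braidZeta A X)).comp (Tw i (Tw j (Tw i X))).d) (fun t => ?_) (fun t ht => ?_) t
  · simp only [LinearMap.sub_apply, LinearMap.comp_apply, LinearMap.add_apply, LinearMap.id_apply,
      braidHom_inc, braidHom_braidHom₂, d_inc, desc_inc, LinearMap.zero_apply, map_zero, sub_self,
      add_zero]
  · simp only [LinearMap.sub_apply, LinearMap.comp_apply, LinearMap.add_apply, LinearMap.id_apply,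
      braidHom_cop A X hn ht, hζ t ht, d_cop, ht, map_sub, desc_inc, LinearMap.zero_apply,
      hζ _ (d_idem ht), zero_sub]
    refine tw_induction_adjacent j A.symm (fun s t hs ht => ?_) (fun s hs => ?_) (fun s hs => ?_)
      t ht
    · simp only [map_add, neg_add] at hs ht ⊢
      rw [add_sub_add_comm, hs, ht]
      abel
    · refine tw_induction_self i hn (fun s t hs ht => ?_) (fun x hx => ?_) (fun x hx => ?_)
        (fun x hx => ?_) s hs
      · simp only [map_add, neg_add] at hs ht ⊢
        rw [add_sub_add_comm, hs, ht]
        abel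
      · simp only [braidEta₃_inc_inc, braidHom_inc, d_inc, braidZeta_inc_inc, d_cop, inc_idem,
          idem_cop, map_sub, braidHom₂_cop A.symm X (inc_idem hx), braidEta₂_inc, hx]
        abel
      · simp only [braidEta₃_inc_cop, d_inc, braidZeta_inc_inc, braidZeta_inc_cop, d_cop, map_sub,
          map_zero, hx]
        abel
      · simp only [braidEta₃_inc_loop A X hx, d_inc, braidZeta_inc_inc, d_cop,
          map_sub, hx, d_smul, smul_sub, smul_inc, braidZeta_inc_loop A X hx,
          braidZeta_inc_loop A X (d_idem hx), map_add, Hom.lin_smul, h1 x hx, h2, h3,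
            op_smul_op_smul,
          A.a_mul_b, A.a_idem, A.b_idem, smul_zero]
        abel
    · rw [symm_a]
      refine tw_induction_adjacent i A (fun s t hs ht => ?_) (fun x hx => ?_) (fun x hx => ?_) s hs
      · simp only [map_add, neg_add, smul_add] at hs ht ⊢
        rw [add_sub_add_comm, hs, ht]
        abel
      · simp only [braidEta₃_cop_inc A X hx, braidHom_inc, d_inc, braidZeta_inc_inc, braidZeta_cop,
          d_cop, d_smul, smul_sub, map_sub, hx, smul_inc, map_zero, h4 x hx]
        abel
      · simp only [braidEta₃_cop_cop, braidZeta_cop, d_cop, d_smul,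
          smul_sub, map_sub, hx, smul_inc, map_zero, op_smul_op_smul, A.a_mul_b, A.a_idem,
          braidZeta_inc_loop A X hx]
        abel

/-- Reversing the pair of arrows exchanges the two braid maps, so `braid_homotopy` for `A.symm` is
the homotopy on the other side. -/
theorem quasiIso_braidHom (hn : 3 ≤ n) : quasiIso k n N (braidHom A X hn) :=
  quasiIso_of_homotopy _ (braidHom A.symm X hn) _ _ (braid_homotopy A X hn)
    (braid_homotopy A.symm X hn) (map_zero _) (map_zero _)

section Naturality

variable {X} {Y : DGMod k n N} (ε : ℤ) (g : X.carrier →ₗ[(Zigzag k n)ᵐᵒᵖ] Y.carrier)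

theorem braidHom₁_tmap (t : (Tw i X).carrier) :
    Hom.lin (braidHom₁ i j Y) (tmap i ε g t) =
      tmap j ε (tmap i ε (tmap j ε g)) (Hom.lin (braidHom₁ i j X) t) := by
  refine tw_hom_ext i (f := (Hom.lin (braidHom₁ i j Y)).comp (tmap i ε g))
    (g := (tmap j ε (tmap i ε (tmap j ε g))).comp (Hom.lin (braidHom₁ i j X)))
    (fun x => ?_) (fun x hx => ?_) t
  · simp only [LinearMap.comp_apply, tmap_inc, braidHom₁_inc]
  · have hgx : op (idem k i) • g x = g x := by rw [← map_smul, hx]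
    simp only [LinearMap.comp_apply, tmap_inc, tmap_cop, braidHom₁_cop X hx, map_zsmul,
      braidHom₁_cop Y hgx]

/-- Each term of the contraction contains exactly one more `cop` than `kap`. Both kinds of maps
contribute a factor ε, on opposite sides of the equation, so a single ε is left over and nothing is
assumed about ε. The same count applies to `braidEta₃`. -/
theorem braidEta₂_tmap (t : (Tw i X).carrier) :
    ε • braidEta₂ A Y (tmap i ε g t) =
      tmap j ε (tmap i ε (tmap j ε g)) (braidEta₂ A X t) := by
  simp only [braidEta₂_apply, twSnd_tmap, kap_tmap, map_zsmul, map_add, map_sub, tmap_inc,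
    tmap_cop, map_smul, smul_add, smul_sub, op_smul_zsmul]

theorem braidHom₂_tmap (t : (Tw j (Tw i X)).carrier) :
    Hom.lin (braidHom₂ A Y) (tmap j ε (tmap i ε g) t) =
      tmap j ε (tmap i ε (tmap j ε g)) (Hom.lin (braidHom₂ A X) t) := by
  refine tw_hom_ext j (f := (Hom.lin (braidHom₂ A Y)).comp (tmap j ε (tmap i ε g)))
    (g := (tmap j ε (tmap i ε (tmap j ε g))).comp (Hom.lin (braidHom₂ A X)))
    (fun x => ?_) (fun x hx => ?_) t
  · simp only [LinearMap.comp_apply, tmap_inc, braidHom₂_inc, braidHom₁_tmap]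
  · have hgx : op (idem k j) • tmap i ε g x = tmap i ε g x := by rw [← map_smul, hx]
    simp only [LinearMap.comp_apply, tmap_cop, braidHom₂_cop A X hx, map_zsmul,
      braidHom₂_cop A Y hgx, braidEta₂_tmap]

theorem braidEta₃_tmap (t : (Tw j (Tw i X)).carrier) :
    ε • braidEta₃ A Y (tmap j ε (tmap i ε g) t) =
      tmap j ε (tmap i ε (tmap j ε g)) (braidEta₃ A X t) := by
  simp only [braidEta₃_apply, twSnd_tmap, kap_tmap, map_zsmul, map_add, map_sub, tmap_inc,
    tmap_cop, map_smul, smul_add, smul_sub, op_smul_zsmul]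

theorem braidHom_tmap (hn : 3 ≤ n) (t : (Tw i (Tw j (Tw i X))).carrier) :
    Hom.lin (braidHom A Y hn) (tmap i ε (tmap j ε (tmap i ε g)) t) =
      tmap j ε (tmap i ε (tmap j ε g)) (Hom.lin (braidHom A X hn) t) := by
  refine tw_hom_ext i (f := (Hom.lin (braidHom A Y hn)).comp (tmap i ε (tmap j ε (tmap i ε g))))
    (g := (tmap j ε (tmap i ε (tmap j ε g))).comp (Hom.lin (braidHom A X hn)))
    (fun x => ?_) (fun x hx => ?_) t
  · simp only [LinearMap.comp_apply, tmap_inc, braidHom_inc, braidHom₂_tmap]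
  · have hgx : op (idem k i) • tmap j ε (tmap i ε g) x = tmap j ε (tmap i ε g) x := by
      rw [← map_smul, hx]
    simp only [LinearMap.comp_apply, tmap_cop, braidHom_cop A X hn hx, map_zsmul,
      braidHom_cop A Y hn hgx, braidEta₃_tmap]

end Naturality

end Braid

end DGMod

/-! ### Descent of natural quasi-isomorphisms to the derived category -/

section Localization

/-- Transformations out of a localization are determined at the objects `L X`. There the shift
compatibility of the restricted transformation differs from the required one only by the invertible
commutation isomorphism of `L`. -/
theorem commShift_of_whiskerLeft {C D E : Type*} [Category* C] [Category* D] [Category* E]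
    (L : C ⥤ D) (W : MorphismProperty C) [L.IsLocalization W] (A : Type*) [AddMonoid A]
    [HasShift C A] [HasShift D A] [HasShift E A] [L.CommShift A] {G G' : D ⥤ E} [G.CommShift A]
    [G'.CommShift A] (ρ : G ⟶ G') [NatTrans.CommShift (Functor.whiskerLeft L ρ) A] :
    NatTrans.CommShift ρ A := by
  refine ⟨fun a => Localization.natTrans_ext L W fun X => ?_⟩
  have h := NatTrans.shift_app_comm (Functor.whiskerLeft L ρ) a X
  simp only [Functor.commShiftIso_comp_hom_app, Functor.whiskerLeft_app, Category.assoc] at h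
  rw [← cancel_epi (G.map ((L.commShiftIso a).hom.app X))]
  simp only [NatTrans.comp_app, Functor.whiskerRight_app, Functor.whiskerLeft_app]
  rw [h, ← NatTrans.naturality_assoc]

open DGMod

variable {k : Type u} [Field k] {n : ℕ} [NeZero n] {N : ℤ}

/-- The functor `G` on `D(R_n-mod)` is induced by the functor `F` on dg modules, compatibly with
the shifts. -/
def IsInducedBy (G : DerivedCat k n N ⥤ DerivedCat k n N) [G.CommShift ℤ] [G.CommShift Second]
    (F : DGMod k n N ⥤ DGMod k n N) [F.CommShift ℤ] [F.CommShift Second] : Prop :=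
  ∃ e : F ⋙ toDerived k n N ≅ toDerived k n N ⋙ G,
    NatTrans.CommShift e.hom ℤ ∧ NatTrans.CommShift e.hom Second

/-- The localized functor inherits its commutation with the shifts from the functor on dg modules
through this square, so the square is compatible with the shifts. -/
theorem isInducedBy_localizedFunctor (Φ : LocalizerMorphism (quasiIso k n N) (quasiIso k n N))
    [Φ.functor.CommShift ℤ] [Φ.functor.CommShift Second] :
    IsInducedBy (Φ.localizedFunctor (toDerived k n N) (toDerived k n N)) Φ.functor :=
  ⟨CatCommSq.iso Φ.functor (quasiIso k n N).Q (quasiIso k n N).Q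
    (Φ.localizedFunctor (quasiIso k n N).Q (quasiIso k n N).Q), inferInstance, inferInstance⟩

theorem isInducedBy_T (i : ZMod n) : IsInducedBy (T k N i) (twistFunctor k N i) :=
  isInducedBy_localizedFunctor (twistLocalizer k N i)

theorem isInducedBy_Frho : IsInducedBy (Frho k n N) (rhoFunctor k n N) :=
  isInducedBy_localizedFunctor (rhoLocalizer k n N)

theorem isInducedBy_Frho' : IsInducedBy (Frho' k n N) (rhoFunctor' k n N) :=
  isInducedBy_localizedFunctor (rhoLocalizer' k n N)

variable {F F' : DGMod k n N ⥤ DGMod k n N} {G G' : DerivedCat k n N ⥤ DerivedCat k n N}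
  [F.CommShift ℤ] [F.CommShift Second] [F'.CommShift ℤ] [F'.CommShift Second]
  [G.CommShift ℤ] [G.CommShift Second] [G'.CommShift ℤ] [G'.CommShift Second]

theorem isInducedBy_id : IsInducedBy (𝟭 (DerivedCat k n N)) (𝟭 (DGMod k n N)) :=
  ⟨Functor.leftUnitor _ ≪≫ (Functor.rightUnitor _).symm, by
    dsimp only [Iso.trans_hom]; infer_instance, by dsimp only [Iso.trans_hom]; infer_instance⟩

theorem IsInducedBy.comp (h : IsInducedBy G F) (h' : IsInducedBy G' F') :
    IsInducedBy (G ⋙ G') (F ⋙ F') := by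
  obtain ⟨e, he1, he2⟩ := h
  obtain ⟨e', he1', he2'⟩ := h'
  refine ⟨Functor.associator _ _ _ ≪≫ Functor.isoWhiskerLeft F e' ≪≫
    (Functor.associator _ _ _).symm ≪≫ Functor.isoWhiskerRight e G' ≪≫
    Functor.associator _ _ _, ?_, ?_⟩ <;>
  · dsimp only [Iso.trans_hom, Functor.isoWhiskerLeft_hom, Functor.isoWhiskerRight_hom]
    infer_instance

section

variable {F F' : DGMod k n N ⥤ DGMod k n N} {G G' : DerivedCat k n N ⥤ DerivedCat k n N}
  (e : F ⋙ toDerived k n N ≅ toDerived k n N ⋙ G)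
  (e' : F' ⋙ toDerived k n N ≅ toDerived k n N ⋙ G') (τ : F ⟶ F')
  (hτ : ∀ X, quasiIso k n N (τ.app X))

/-- The isomorphism of functors on `D(R_n-mod)` that is induced by a natural
quasi-isomorphism. -/
def isoOfQuasiIso : G ≅ G' :=
  have : ∀ X, IsIso ((Functor.whiskerRight τ (toDerived k n N)).app X) := fun X =>
    Localization.inverts (toDerived k n N) (quasiIso k n N) _ (hτ X)
  have : IsIso (Functor.whiskerRight τ (toDerived k n N)) := NatIso.isIso_of_isIso_app _
  Localization.liftNatIso (toDerived k n N) (quasiIso k n N) _ _ G G'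
    (e.symm ≪≫ asIso (Functor.whiskerRight τ (toDerived k n N)) ≪≫ e')

theorem whiskerLeft_isoOfQuasiIso :
    Functor.whiskerLeft (toDerived k n N) (isoOfQuasiIso e e' τ hτ).hom =
      e.inv ≫ Functor.whiskerRight τ (toDerived k n N) ≫ e'.hom := by
  ext X
  simp [isoOfQuasiIso]

end

/-- A natural quasi-isomorphism becomes invertible in the derived category. Restricted to dg
modules, the resulting isomorphism is a composite of transformations compatible with the shifts, and
`commShift_of_whiskerLeft` removes the restriction. -/
theorem IsInducedBy.gradedIso (h : IsInducedBy G F) (h' : IsInducedBy G' F') (τ : F ⟶ F')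
    (hτ : ∀ X, quasiIso k n N (τ.app X)) [NatTrans.CommShift τ ℤ] [NatTrans.CommShift τ Second] :
    GradedIso G G' := by
  obtain ⟨e, he1, he2⟩ := h
  obtain ⟨e', he1', he2'⟩ := h'
  let f := isoOfQuasiIso e e' τ hτ
  have h1 : NatTrans.CommShift (Functor.whiskerLeft (toDerived k n N) f.hom) ℤ := by
    rw [whiskerLeft_isoOfQuasiIso]; infer_instance
  have h2 : NatTrans.CommShift (Functor.whiskerLeft (toDerived k n N) f.hom) Second := by
    rw [whiskerLeft_isoOfQuasiIso]; infer_instance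
  exact ⟨f, commShift_of_whiskerLeft (toDerived k n N) (quasiIso k n N) ℤ f.hom,
    commShift_of_whiskerLeft (toDerived k n N) (quasiIso k n N) Second f.hom⟩

end Localization

namespace DGMod

open MulOpposite

variable {k : Type u} [Field k] {n : ℕ} [NeZero n] {N : ℤ}

/-! ### Commutation of composite twists with the shifts -/

section TwistShift

theorem tmap_tmap (i : ZMod n) (ε ε' : ℤ) {X Y Z : DGMod k n N}
    (g : Y.carrier →ₗ[(Zigzag k n)ᵐᵒᵖ] Z.carrier) (g' : X.carrier →ₗ[(Zigzag k n)ᵐᵒᵖ] Y.carrier)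
    (t : (Tw i X).carrier) : tmap i ε g (tmap i ε' g' t) = tmap i (ε * ε') (g.comp g') t := by
  refine tw_hom_ext i (f := (tmap i ε g).comp (tmap i ε' g')) (fun x => ?_) (fun x _ => ?_) t
  · simp only [LinearMap.comp_apply, tmap_inc]
  · simp only [LinearMap.comp_apply, tmap_cop, map_zsmul, smul_smul, mul_comm]

theorem lin_twistFunctor_map (i : ZMod n) {Y Z : DGMod k n N} (g : Y ⟶ Z) :
    Hom.lin ((twistFunctor k N i).map g) = tmap i 1 g.lin :=
  LinearMap.ext fun t => twistFunctor_map_lin i g t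

/-- The functoriality of `T_i Y`. -/
def twMap (i : ZMod n) {Y Z : DGMod k n N} (g : Y ⟶ Z) : Tw i Y ⟶ Tw i Z :=
  (twistFunctor k N i).map g

theorem twMap_lin (i : ZMod n) {Y Z : DGMod k n N} (g : Y ⟶ Z) :
    Hom.lin (twMap i g) = tmap i 1 g.lin := lin_twistFunctor_map i g

/-- The compatibility of `T_i` with a shift. -/
def twistShift₁ (i : ZMod n) (s : Bideg) (X : DGMod k n N) :
    Tw i (shiftObj s X) ⟶ shiftObj s (Tw i X) := (twistShiftIso i s).hom.app X

/-- The identity map from the shift of `X` to `X`. -/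
def unshift (s : Bideg) (X : DGMod k n N) :
    (shiftObj s X).carrier →ₗ[(Zigzag k n)ᵐᵒᵖ] X.carrier := LinearMap.id (M := X.carrier)

/-- The map `unshift` commutes with the differentials only up to a sign, but it is linear over
`R_n`, which is all that `tmap` requires. It allows iterated twists of `X` and of its shift to be
compared by nested `tmap`s. -/
theorem unshift_twistShift₁ (i : ZMod n) (s : Bideg) (X : DGMod k n N)
    (t : (Tw i (shiftObj s X)).carrier) :
    unshift s (Tw i X) (Hom.lin (twistShift₁ i s X) t) =
      tmap i (sgn s) (unshift s X) t :=
  twistShiftIso_lin i s t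

variable (i j l : ZMod n) (s : Bideg) (X : DGMod k n N)

/-- The compatibility of `T_j T_i` with a shift. -/
def twistShift₂ : Tw j (Tw i (shiftObj s X)) ⟶ shiftObj s (Tw j (Tw i X)) :=
  twMap j (twistShift₁ i s X) ≫ twistShift₁ j s (Tw i X)

theorem unshift_twistShift₂ (t : (Tw j (Tw i (shiftObj s X))).carrier) :
    unshift s _ (Hom.lin (twistShift₂ i j s X) t) =
      tmap j (sgn s) (tmap i (sgn s) (unshift s X)) t := by
  rw [twistShift₂, comp_lin]
  refine (unshift_twistShift₁ j s (Tw i X) _).trans ?_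
  rw [twMap_lin]
  refine (tmap_tmap (X := Tw i (shiftObj s X)) (Y := shiftObj s (Tw i X)) (Z := Tw i X)
    j (sgn s) 1 (unshift s (Tw i X)) (Hom.lin (twistShift₁ i s X)) t).trans ?_
  rw [mul_one]
  exact congrArg (fun g => tmap j (sgn s) g t)
    (LinearMap.ext fun t => unshift_twistShift₁ i s X t)

/-- The compatibility of `T_l T_j T_i` with a shift. -/
def twistShift₃ : Tw l (Tw j (Tw i (shiftObj s X))) ⟶ shiftObj s (Tw l (Tw j (Tw i X))) :=
  twMap l (twistShift₂ i j s X) ≫ twistShift₁ l s (Tw j (Tw i X))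

theorem unshift_twistShift₃ (t : (Tw l (Tw j (Tw i (shiftObj s X)))).carrier) :
    unshift s _ (Hom.lin (twistShift₃ i j l s X) t) =
      tmap l (sgn s) (tmap j (sgn s) (tmap i (sgn s) (unshift s X))) t := by
  rw [twistShift₃, comp_lin]
  refine (unshift_twistShift₁ l s (Tw j (Tw i X)) _).trans ?_
  rw [twMap_lin]
  refine (tmap_tmap (X := Tw j (Tw i (shiftObj s X))) (Y := shiftObj s (Tw j (Tw i X)))
    (Z := Tw j (Tw i X)) l (sgn s) 1 (unshift s _) (Hom.lin (twistShift₂ i j s X)) t).trans ?_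
  rw [mul_one]
  exact congrArg (fun g => tmap l (sgn s) g t)
    (LinearMap.ext fun t => unshift_twistShift₂ i j s X t)

/-- The commutation isomorphism of the composite is bracketed differently from `twistShift₃`;
functoriality of the last twist `T_l` reconciles the two. -/
theorem commShiftIso_twist₃ (a : ℤ) :
    ((twistFunctor k N i ⋙ twistFunctor k N j ⋙ twistFunctor k N l).commShiftIso a).hom.app X =
      twistShift₃ i j l (firstHom a) X := by
  rw [Functor.commShiftIso_comp_hom_app, Functor.commShiftIso_comp_hom_app, ← Category.assoc,
    Functor.comp_map, ← Functor.map_comp]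
  rfl

theorem commShiftIso_second_twist₃ (a : Second) :
    ((twistFunctor k N i ⋙ twistFunctor k N j ⋙ twistFunctor k N l).commShiftIso a).hom.app X =
      twistShift₃ i j l (secondHom a) X := by
  rw [Functor.commShiftIso_comp_hom_app, Functor.commShiftIso_comp_hom_app, ← Category.assoc,
    Functor.comp_map, ← Functor.map_comp]
  rfl

end TwistShift

/-! ### The braid map as a transformation compatible with the shifts -/

section Braid

variable {i j : ZMod n} (A : ArrowPair k N i j) (hn : 3 ≤ n)

/-- The natural morphism `T_i T_j T_i ⟶ T_j T_i T_j` on dg modules. -/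
def braidTrans : twistFunctor k N i ⋙ twistFunctor k N j ⋙ twistFunctor k N i ⟶
    twistFunctor k N j ⋙ twistFunctor k N i ⋙ twistFunctor k N j where
  app X := braidHom A X hn
  naturality X Y g := by
    refine hom_ext _ _ fun t => ?_
    change Hom.lin (braidHom A Y hn) (Hom.lin (twMap i (twMap j (twMap i g))) t) =
      Hom.lin (twMap j (twMap i (twMap j g))) (Hom.lin (braidHom A X hn) t)
    rw [twMap_lin, twMap_lin, twMap_lin, twMap_lin, twMap_lin, twMap_lin]
    exact braidHom_tmap A 1 g.lin hn t

/-- The shift acts on each of the three twists by the same sign, so this is `braidHom_tmap` with ε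
the sign of the shift and `unshift` as the module map. -/
theorem braidHom_shift (s : Bideg) (X : DGMod k n N)
    (t : (Tw i (Tw j (Tw i (shiftObj s X)))).carrier) :
    Hom.lin (braidHom A X hn) (unshift s _ (Hom.lin (twistShift₃ i j i s X) t)) =
      unshift s _ (Hom.lin (twistShift₃ j i j s X) (Hom.lin (braidHom A (shiftObj s X) hn) t)) := by
  rw [unshift_twistShift₃, unshift_twistShift₃]
  exact braidHom_tmap A (sgn s) (unshift s X) hn t

instance : NatTrans.CommShift (braidTrans A hn) ℤ := ⟨fun a => by
  refine NatTrans.ext (funext fun X => ?_)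
  rw [NatTrans.comp_app, NatTrans.comp_app, commShiftIso_twist₃, Functor.whiskerLeft_app,
    commShiftIso_twist₃]
  exact hom_ext _ _ fun t => braidHom_shift A hn (firstHom a) X t⟩

instance : NatTrans.CommShift (braidTrans A hn) Second := ⟨fun a => by
  refine NatTrans.ext (funext fun X => ?_)
  rw [NatTrans.comp_app, NatTrans.comp_app, commShiftIso_second_twist₃, Functor.whiskerLeft_app,
    commShiftIso_second_twist₃]
  exact hom_ext _ _ fun t => braidHom_shift A hn (secondHom a) X t⟩

end Braid

end DGMod

open DGMod

theorem gradedIso_braid {k : Type u} [Field k] {n : ℕ} [NeZero n] (hn : 3 ≤ n) (N : ℤ)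
    (i : ZMod n) : GradedIso (T k N i ⋙ T k N (i + 1) ⋙ T k N i)
      (T k N (i + 1) ⋙ T k N i ⋙ T k N (i + 1)) :=
  ((isInducedBy_T i).comp ((isInducedBy_T (i + 1)).comp (isInducedBy_T i))).gradedIso
    ((isInducedBy_T (i + 1)).comp ((isInducedBy_T i).comp (isInducedBy_T (i + 1))))
    (braidTrans (arrowPair hn N i) hn) (fun X => quasiIso_braidHom _ X hn)

namespace DGMod

open MulOpposite

variable {k : Type u} [Field k] {n : ℕ} [NeZero n] {N : ℤ}

/-! ### Twists at vertices that are neither equal nor adjacent -/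

section Far

theorem commShiftIso_twist₂ (i j : ZMod n) (a : ℤ) (X : DGMod k n N) :
    ((twistFunctor k N i ⋙ twistFunctor k N j).commShiftIso a).hom.app X =
      twistShift₂ i j (firstHom a) X := by
  rw [Functor.commShiftIso_comp_hom_app]
  rfl

theorem commShiftIso_second_twist₂ (i j : ZMod n) (a : Second) (X : DGMod k n N) :
    ((twistFunctor k N i ⋙ twistFunctor k N j).commShiftIso a).hom.app X =
      twistShift₂ i j (secondHom a) X := by
  rw [Functor.commShiftIso_comp_hom_app]
  rfl

/-- Two vertices are far if they are neither equal nor adjacent. -/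
def IsFar (i j : ZMod n) : Prop := j ≠ i ∧ j ≠ i + 1 ∧ i ≠ j + 1

theorem IsFar.symm {n : ℕ} {i j : ZMod n} (h : IsFar i j) : IsFar j i := ⟨h.1.symm, h.2.2, h.2.1⟩

variable {i j : ZMod n} (h : IsFar i j) (X : DGMod k n N)

/-- The contraction on `(T_i X) (j)` of the map `T_i X → T_i T_j X`. -/
def farEta (i j : ZMod n) (X : DGMod k n N) : (Tw i X).carrier →ₗ[k] (Tw i (Tw j X)).carrier :=
  incK i _ ∘ₗ cop j X ∘ₗ (twSnd i X).restrictScalars k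

theorem farEta_apply (t : (Tw i X).carrier) :
    farEta i j X t = inc i _ (cop j X (twSnd i X t)) := rfl

/-- The morphism `T_j T_i X ⟶ T_i T_j X` for far vertices. -/
def farHom : Tw j (Tw i X) ⟶ Tw i (Tw j X) :=
  descHom j (twMap i (incHom j X)) (farEta i j X)
    (fun _ _ ht _ => inc_mem _ (cop_mem _ (twSnd_mem _ ht)))
    (fun t ht => by
      -- As (i)R(j) = 0, every element of (T_i X)(j) comes from X(j), where the contraction is the
      -- one of T_j X.
      refine tw_induction_far i h.1 h.2.1 h.2.2 (fun x hx => ?_) t ht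
      rw [farEta_apply, farEta_apply, twSnd_inc, d_inc, d_inc, d_cop, twSnd_inc, hx, map_sub,
        sub_add_cancel, twMap_lin, tmap_inc]
      rfl)

theorem farHom_inc (t : (Tw i X).carrier) :
    Hom.lin (farHom h X) (inc j _ t) = tmap i 1 (inc j X) t :=
  (desc_inc j _ _ t).trans (by rw [twMap_lin]; rfl)

theorem farHom_cop {t : (Tw i X).carrier} (ht : op (idem k j) • t = t) :
    Hom.lin (farHom h X) (cop j _ t) = inc i _ (cop j X (twSnd i X t)) :=
  desc_cop j _ _ ht (by rw [farEta_apply, smul_inc, idem_cop])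

/-- Exchanging the two vertices gives a strict inverse, so zero homotopies suffice in
`quasiIso_farHom`. -/
theorem farHom_farHom (t : (Tw j (Tw i X)).carrier) :
    Hom.lin (farHom h.symm X) (Hom.lin (farHom h X) t) = t := by
  refine tw_hom_ext j (f := (Hom.lin (farHom h.symm X)).comp (Hom.lin (farHom h X)))
    (g := LinearMap.id) (fun s => ?_) (fun s hs => ?_) t
  · rw [LinearMap.comp_apply, farHom_inc]
    refine tw_hom_ext i (f := (Hom.lin (farHom h.symm X)).comp (tmap i 1 (inc j X)))
      (g := inc j _) (fun x => ?_) (fun x hx => ?_) s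
    · rw [LinearMap.comp_apply, tmap_inc, farHom_inc, tmap_inc]
    · rw [LinearMap.comp_apply, tmap_cop, one_smul, farHom_cop h.symm X (inc_idem hx), twSnd_inc]
  · rw [LinearMap.comp_apply]
    refine tw_induction_far i h.1 h.2.1 h.2.2 (fun x hx => ?_) s hs
    rw [farHom_cop h X (inc_idem hx), twSnd_inc, farHom_inc, tmap_cop, one_smul]
    rfl

theorem quasiIso_farHom : quasiIso k n N (farHom h X) :=
  quasiIso_of_homotopy _ (farHom h.symm X) 0 0
    (fun t => by rw [farHom_farHom]; simp) (fun t => by rw [farHom_farHom h.symm]; simp) rfl rfl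

theorem farHom_tmap {Y : DGMod k n N} (ε : ℤ) (g : X.carrier →ₗ[(Zigzag k n)ᵐᵒᵖ] Y.carrier)
    (t : (Tw j (Tw i X)).carrier) : Hom.lin (farHom h Y) (tmap j ε (tmap i ε g) t) =
      tmap i ε (tmap j ε g) (Hom.lin (farHom h X) t) := by
  refine tw_hom_ext j (f := (Hom.lin (farHom h Y)).comp (tmap j ε (tmap i ε g)))
    (g := (tmap i ε (tmap j ε g)).comp (Hom.lin (farHom h X)))
    (fun s => ?_) (fun s hs => ?_) t
  · rw [LinearMap.comp_apply, LinearMap.comp_apply, tmap_inc, farHom_inc, farHom_inc, tmap_tmap,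
      tmap_tmap, one_mul, mul_one]
    congr 2
    exact LinearMap.ext fun x => (tmap_inc j ε g x).symm
  · have hg : op (idem k j) • tmap i ε g s = tmap i ε g s := by rw [← map_smul, hs]
    rw [LinearMap.comp_apply, LinearMap.comp_apply, tmap_cop, map_zsmul, farHom_cop h X hs,
      farHom_cop h Y hg, twSnd_tmap, tmap_inc, tmap_cop, map_zsmul]

/-- The natural morphism `T_j T_i ⟶ T_i T_j` on dg modules. -/
def farTrans : twistFunctor k N i ⋙ twistFunctor k N j ⟶
    twistFunctor k N j ⋙ twistFunctor k N i where
  app X := farHom h X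
  naturality X Y g := by
    refine hom_ext _ _ fun t => ?_
    change Hom.lin (farHom h Y) (Hom.lin (twMap j (twMap i g)) t) =
      Hom.lin (twMap i (twMap j g)) (Hom.lin (farHom h X) t)
    rw [twMap_lin, twMap_lin, twMap_lin, twMap_lin]
    exact farHom_tmap h X 1 g.lin t

theorem farHom_shift (s : Bideg) (t : (Tw j (Tw i (shiftObj s X))).carrier) :
    Hom.lin (farHom h X) (unshift s _ (Hom.lin (twistShift₂ i j s X) t)) =
      unshift s _ (Hom.lin (twistShift₂ j i s X) (Hom.lin (farHom h (shiftObj s X)) t)) := by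
  rw [unshift_twistShift₂, unshift_twistShift₂]
  exact farHom_tmap h (shiftObj s X) (sgn s) (unshift s X) t

instance : NatTrans.CommShift (farTrans (k := k) (N := N) h) ℤ := ⟨fun a => by
  refine NatTrans.ext (funext fun X => ?_)
  rw [NatTrans.comp_app, NatTrans.comp_app, commShiftIso_twist₂, Functor.whiskerLeft_app,
    commShiftIso_twist₂]
  exact hom_ext _ _ fun t => farHom_shift h X (firstHom a) t⟩

instance : NatTrans.CommShift (farTrans (k := k) (N := N) h) Second := ⟨fun a => by
  refine NatTrans.ext (funext fun X => ?_)
  rw [NatTrans.comp_app, NatTrans.comp_app, commShiftIso_second_twist₂, Functor.whiskerLeft_app,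
    commShiftIso_second_twist₂]
  exact hom_ext _ _ fun t => farHom_shift h X (secondHom a) t⟩

end Far

end DGMod

open DGMod

theorem gradedIso_far {k : Type u} [Field k] {n : ℕ} [NeZero n] (N : ℤ) {i j : ZMod n}
    (h : IsFar i j) : GradedIso (T k N i ⋙ T k N j) (T k N j ⋙ T k N i) :=
  ((isInducedBy_T i).comp (isInducedBy_T j)).gradedIso
    ((isInducedBy_T j).comp (isInducedBy_T i)) (farTrans h) (fun X => quasiIso_farHom h X)

/-! ### Dual bases of paths and the Casimir construction -/

section Casimir

open MulOpposite Gen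

variable {k : Type u} [Field k] {n : ℕ} [NeZero n]

theorem gen_mul_idem (g : Gen n) (l : ZMod n) :
    gen k g * idem k l = if tgt g = l then gen k g else 0 := by
  split_ifs with h
  · rw [← h, mul_idem_tgt]
  · exact mul_eq_zero_of_ne h (mul_idem_tgt g) (gen_vertex_mul_self k l)

theorem idem_mul_gen (g : Gen n) (l : ZMod n) :
    idem k l * gen k g = if src g = l then gen k g else 0 := by
  split_ifs with h
  · rw [← h, idem_src_mul]
  · exact mul_eq_zero_of_ne (Ne.symm h) (gen_vertex_mul_self k l) (idem_src_mul g)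

theorem loop_mul_idem' (i l : ZMod n) :
    loop k i * idem k l = if i = l then loop k i else 0 := by
  split_ifs with h
  · rw [← h, loop_mul_idem]
  · exact mul_eq_zero_of_ne h (loop_mul_idem i) (gen_vertex_mul_self k l)

theorem idem_mul_loop' (i l : ZMod n) :
    idem k l * loop k i = if i = l then loop k i else 0 := by
  split_ifs with h
  · rw [← h, idem_mul_loop]
  · exact mul_eq_zero_of_ne (Ne.symm h) (gen_vertex_mul_self k l) (idem_mul_loop i)

theorem loop_mul_up' (i l : ZMod n) : loop k i * gen k (up l) = 0 := by
  by_cases h : i = l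
  · rw [h, loop_mul_up]
  · exact mul_eq_zero_of_ne h (loop_mul_idem i) (idem_src_mul (up l))

theorem loop_mul_down' (i l : ZMod n) : loop k i * gen k (down l) = 0 := by
  by_cases h : i = l + 1
  · rw [h, loop_mul_down]
  · exact mul_eq_zero_of_ne h (loop_mul_idem i) (idem_src_mul (down l))

theorem up_mul_loop' (i l : ZMod n) : gen k (up l) * loop k i = 0 := by
  by_cases h : l + 1 = i
  · rw [← h, up_mul_loop]
  · exact mul_eq_zero_of_ne h (mul_idem_tgt (up l)) (idem_mul_loop i)

theorem down_mul_loop' (i l : ZMod n) : gen k (down l) * loop k i = 0 := by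
  by_cases h : l = i
  · rw [← h, down_mul_loop]
  · exact mul_eq_zero_of_ne h (mul_idem_tgt (down l)) (idem_mul_loop i)

theorem up_mul_up' (i l : ZMod n) : gen k (up i) * gen k (up l) = 0 := by
  by_cases h : i + 1 = l
  · rw [← h, gen_up_mul_up]
  · exact gen_mul_gen_of_ne h

theorem down_mul_down' (i l : ZMod n) : gen k (down i) * gen k (down l) = 0 := by
  by_cases h : i = l + 1
  · rw [h, gen_down_mul_down]
  · exact gen_mul_gen_of_ne h

theorem up_mul_down' (i l : ZMod n) :
    gen k (up i) * gen k (down l) = if i = l then loop k i else 0 := by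
  split_ifs with h
  · rw [← h, loop]
  · exact gen_mul_gen_of_ne fun h' => h (add_right_cancel h')

theorem down_mul_up' (i l : ZMod n) :
    gen k (down i) * gen k (up l) = if i = l then loop k (i + 1) else 0 := by
  split_ifs with h
  · rw [← h, down_mul_up]
  · exact gen_mul_gen_of_ne h

/-- Words in the generators span `R_n`, so linearity over `R_n` can be tested on generators; this
makes the linearity of `casimir` a finite check. -/
theorem op_smul_induction {V W : Type*} [AddCommGroup V] [AddCommGroup W] [Module k V]
    [Module k W] [Module (Zigzag k n)ᵐᵒᵖ V] [Module (Zigzag k n)ᵐᵒᵖ W]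
    [IsScalarTower k (Zigzag k n)ᵐᵒᵖ V] [IsScalarTower k (Zigzag k n)ᵐᵒᵖ W] (f : V →ₗ[k] W)
    (h : ∀ (g : Gen n) x, f (op (gen k g) • x) = op (gen k g) • f x) (r : Zigzag k n) (x : V) :
    f (op r • x) = op r • f x := by
  induction mem_span_words k r using Submodule.span_induction generalizing x with
  | zero => simp
  | add a b _ _ ha hb => rw [MulOpposite.op_add, add_smul, add_smul, map_add, ha, hb]
  | smul c a _ ha => rw [MulOpposite.op_smul, smul_assoc, smul_assoc, map_smul, ha]
  | mem a ha =>
    obtain ⟨w, rfl⟩ := ha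
    dsimp only
    induction w generalizing x with
    | nil => simp
    | cons g w ih => rw [List.map_cons, List.prod_cons, op_mul, mul_smul, mul_smul, ih, h]

variable {V W : Type*} [AddCommGroup V] [AddCommGroup W] [Module k V]
    [Module k W] [Module (Zigzag k n)ᵐᵒᵖ V] [Module (Zigzag k n)ᵐᵒᵖ W]
    [IsScalarTower k (Zigzag k n)ᵐᵒᵖ V] [IsScalarTower k (Zigzag k n)ᵐᵒᵖ W]

/-- The map `x ↦ ∑ ψ(x w) w'`, where `w` runs through the basis of `R_n (i)` given by the paths,
`w'` is the dual basis of `P_i`, and `i = m + 1`. -/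
def casimir (m : ZMod n) (ψ : V →ₗ[k] W) : V →ₗ[(Zigzag k n)ᵐᵒᵖ] W :=
  let f : V →ₗ[k] W :=
    { toFun := fun x => op (loop k (m + 1)) • ψ (op (idem k (m + 1)) • x) +
        op (idem k (m + 1)) • ψ (op (loop k (m + 1)) • x) +
        op (gen k (down m)) • ψ (op (gen k (up m)) • x) +
        op (gen k (up (m + 1))) • ψ (op (gen k (down (m + 1))) • x)
      map_add' := fun x y => by simp only [smul_add, map_add]; abel
      map_smul' := fun c x => by
        simp only [smul_add, map_smul, RingHom.id_apply, smul_comm _ c] }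
  { f with
    map_smul' := fun r x => by
      -- In terms of the dual bases, the claim is that Σ g w ⊗ w' = Σ w ⊗ w' g for each generator g.
      -- Here w is the idempotent, the loop, or one of the two arrows that end at m + 1.
      refine op_smul_induction f (fun g x => ?_) (unop r) x
      simp only [f, LinearMap.coe_mk, AddHom.coe_mk, smul_add, smul_smul, ← op_mul]
      cases g with
      | vertex l =>
        simp only [loop_mul_idem', idem_mul_loop', gen_mul_idem, idem_mul_gen, src, tgt]
        by_cases h1 : m + 1 = l
        · subst h1
          -- Here n is arbitrary, so m and m + 1 may coincide. Since m = m + 1 cannot be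
          -- substituted, the equalities are replaced by their truth values.
          rcases Classical.propComplete (m = m + 1) with h2 | h2 <;>
          rcases Classical.propComplete (m + 1 + 1 = m + 1) with h3 | h3 <;>
            simp only [h2, h3, if_true, if_false, op_zero, zero_smul, map_zero, smul_zero]
        · rcases Classical.propComplete (m = l) with h2 | h2 <;>
          rcases Classical.propComplete (m + 1 + 1 = l) with h3 | h3 <;>
            simp only [eq_false h1, eq_false (Ne.symm h1), h2, h3, if_true, if_false, op_zero,
              zero_smul, map_zero, smul_zero]
      | up l =>
        simp only [loop_mul_up', up_mul_up', down_mul_up', up_mul_loop', up_mul_down',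
          gen_mul_idem, idem_mul_gen, src, tgt, add_left_inj, @eq_comm _ l, op_zero, zero_smul,
          map_zero, smul_zero]
        by_cases h1 : m + 1 = l
        · subst h1
          rcases Classical.propComplete (m = m + 1) with h2 | h2
          · have h3 := congrArg (fun t => gen k (up t)) (of_eq_true h2)
            simp only [h2, if_true] at h3 ⊢
            rw [h3]
            abel
          · simp only [h2, if_false, op_zero, zero_smul, map_zero, smul_zero]
            abel
        · rcases Classical.propComplete (m = l) with h2 | h2
          · have h3 := congrArg (fun t => gen k (up t)) (of_eq_true h2)
            simp only [eq_false h1, h2, if_true, if_false, op_zero, zero_smul, map_zero,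
              smul_zero] at h3 ⊢
            rw [h3]
            abel
          · simp only [eq_false h1, h2, if_false, op_zero, zero_smul, map_zero, smul_zero]
      | down l =>
        simp only [loop_mul_down', down_mul_down', down_mul_up', down_mul_loop', up_mul_down',
          gen_mul_idem, idem_mul_gen, src, tgt, add_left_inj, @eq_comm _ l, op_zero, zero_smul,
          map_zero, smul_zero]
        by_cases h2 : m = l
        · subst h2
          rcases Classical.propComplete (m + 1 = m) with h1 | h1
          · have h3 := congrArg (fun t => gen k (down t)) (of_eq_true h1)
            simp only [h1, if_true] at h3 ⊢
            rw [h3]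
            abel
          · simp only [h1, if_false, op_zero, zero_smul, map_zero, smul_zero]
            abel
        · rcases Classical.propComplete (m + 1 = l) with h1 | h1
          · have h3 := congrArg (fun t => gen k (down t)) (of_eq_true h1)
            simp only [eq_false h2, h1, if_true, if_false, op_zero, zero_smul, map_zero,
              smul_zero] at h3 ⊢
            rw [h3]
            abel
          · simp only [eq_false h2, h1, if_false, op_zero, zero_smul, map_zero, smul_zero] }

theorem casimir_apply (m : ZMod n) (ψ : V →ₗ[k] W) (x : V) :
    casimir m ψ x = op (loop k (m + 1)) • ψ (op (idem k (m + 1)) • x) +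
        op (idem k (m + 1)) • ψ (op (loop k (m + 1)) • x) +
        op (gen k (down m)) • ψ (op (gen k (up m)) • x) +
        op (gen k (up (m + 1))) • ψ (op (gen k (down (m + 1))) • x) := rfl

/-- The Casimir construction is natural in the k-linear map. With differentials, projections, zero
or identity maps for `f` and `g`, this gives the identities for the coevaluation, the units and
their homotopies. -/
theorem map_casimir {V' W' : Type*} [AddCommGroup V'] [AddCommGroup W'] [Module k V']
    [Module k W'] [Module (Zigzag k n)ᵐᵒᵖ V'] [Module (Zigzag k n)ᵐᵒᵖ W']
    [IsScalarTower k (Zigzag k n)ᵐᵒᵖ V'] [IsScalarTower k (Zigzag k n)ᵐᵒᵖ W'] (m : ZMod n)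
    (ψ : V →ₗ[k] W) (ψ' : V' →ₗ[k] W') (f : V →ₗ[(Zigzag k n)ᵐᵒᵖ] V')
    (g : W →ₗ[(Zigzag k n)ᵐᵒᵖ] W') (h : ∀ x, g (ψ x) = ψ' (f x)) (x : V) :
    g (casimir m ψ x) = casimir m ψ' (f x) := by
  simp only [casimir_apply, map_add, map_smul, h]

/-- The paths ending in a vertex and the paths starting from it are dual bases. -/
theorem casimir_coefLoop (hn : 3 ≤ n) (m : ZMod n) (r : Zigzag k n) (x : V) :
    casimir m ((LinearMap.toSpanSingleton k V x).comp (coefLoop k (m + 1))) r =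
      op r • op (idem k (m + 1)) • x := by
  -- The coefficient of the loop vanishes on paths that start at another vertex.
  have h1 : ∀ {r : Zigzag k n} {j : ZMod n}, idem k j * r = r → j ≠ m + 1 →
      coefLoop k (m + 1) r = 0 := fun {r j} hr hj => by
    rw [← coefLoop_corner, ← hr, ← mul_assoc,
      gen_vertex_mul_vertex k _ _ hj.symm, zero_mul, zero_mul, map_zero]
  -- By linearity over `R_n` it suffices to take r = 1. There only the term where w is the loop and
  -- w' the idempotent survives.
  have hr : r = op r • (1 : Zigzag k n) := by simp
  conv_lhs => rw [hr, map_smul]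
  congr 1
  rw [casimir_apply]
  simp only [LinearMap.comp_apply, op_smul_eq_mul, one_mul, coefLoop_idem,
    coefLoop_loop, LinearMap.toSpanSingleton_apply]
  rw [h1 (idem_src_mul (up m)) (fun h => one_ne_zero_zmod hn (add_eq_left.1 h.symm)),
    h1 (idem_src_mul (down (m + 1))) (fun h => one_ne_zero_zmod hn (add_eq_left.1 h))]
  simp

end Casimir

namespace DGMod

open MulOpposite Gen

variable {k : Type u} [Field k] {n : ℕ} [NeZero n] {N : ℤ}

/-- The graded module `X ⊕ Y`, where the grading of `X` is shifted by `s`, with the differential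
zero. -/
def shiftedSum (s : Bideg) (X Y : DGMod k n N) : DGMod k n N where
  carrier := X.carrier × Y.carrier
  gr c := (X.gr (c + s)).prod (Y.gr c)
  isInternal := isInternal_prod X.isInternal Y.isInternal s
  smul_mem a b x r hx hr := by
    refine ⟨?_, Y.smul_mem _ _ _ _ hx.2 hr⟩
    have := X.smul_mem _ _ _ _ hx.1 hr
    rwa [add_right_comm] at this
  d := 0
  d_mem a x _ := zero_mem _
  d_d x := rfl

/-! ### The inverse twist -/

section Cotwist

variable (m : ZMod n) (X : DGMod k n N)

/-- The graded module that underlies the inverse twist of `X`. -/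
def cotwistBase : DGMod k n N := shiftedSum (N - 1, 0) (twistObj (m + 1) X) X

theorem cotwistBase_inc_mem {c : Bideg} {x : X.carrier} (hx : x ∈ X.gr c) :
    inc (m + 1) X x ∈ (cotwistBase m X).gr c := ⟨zero_mem _, hx⟩

theorem cotwistBase_cop_mem {c : Bideg} {x : X.carrier} (hx : x ∈ X.gr (c + (N - 1, 0))) :
    cop (m + 1) X x ∈ (cotwistBase m X).gr c := ⟨moduleCop_mem (m + 1) X hx, zero_mem _⟩

/-- A path w and its dual w' have total bidegree (N, 0), the bidegree of the loop. So `casimir`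
raises the bidegree of ψ by (N, 0). -/
theorem casimir_mem {Y Z : DGMod k n N} (ψ : Y.carrier →ₗ[k] Z.carrier) {s : Bideg}
    (hψ : ∀ c, ∀ y ∈ Y.gr (c + s), ψ y ∈ Z.gr c) {c b : Bideg} (h : c + (N, 0) = b + s)
    {y : Y.carrier} (hy : y ∈ Y.gr c) : casimir m ψ y ∈ Z.gr b := by
  have key : ∀ {p q : Zigzag k n} {d e : Bideg}, p ∈ bigrading k N d → q ∈ bigrading k N e →
      d + e = (N, 0) → op q • ψ (op p • y) ∈ Z.gr b := by
    intro p q d e hp hq hde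
    refine Z.smul_mem_of_eq (hψ (b - e) _ (Y.smul_mem_of_eq hy hp ?_)) hq (sub_add_cancel _ _)
    rw [sub_add_eq_add_sub, ← h, ← hde, ← add_assoc, add_sub_cancel_right]
  rw [casimir_apply]
  refine add_mem (add_mem (add_mem ?_ ?_) ?_) ?_
  · exact key (idem_mem k N _) (loop_mem N _) (zero_add _)
  · exact key (loop_mem N _) (idem_mem k N _) (add_zero _)
  · exact key (gen_mem k N _) (gen_mem k N _) (deg_up_add_deg_down_eq N m)
  · exact key (gen_mem k N _) (gen_mem k N _)
      ((add_comm _ _).trans (deg_up_add_deg_down_eq N (m + 1)))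

/-- The differential of the inverse twist. -/
def cotwistD : (Tw (m + 1) X).carrier →ₗ[(Zigzag k n)ᵐᵒᵖ] (Tw (m + 1) X).carrier :=
  desc (W := Tw (m + 1) X) (m + 1) ((inc (m + 1) X).comp X.d + casimir m (cop (m + 1) X))
    (-(cop (m + 1) X).comp X.dk)

theorem cotwistD_inc (x : X.carrier) : cotwistD m X (inc (m + 1) X x) =
    inc (m + 1) X (X.d x) + casimir m (cop (m + 1) X) x := desc_inc _ _ _ _

theorem cotwistD_cop (x : X.carrier) : cotwistD m X (cop (m + 1) X x) =
    -cop (m + 1) X (X.d x) := by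
  rw [cotwistD, desc_cop']
  change op (idem k (m + 1)) • (-cop (m + 1) X (X.d (op (idem k (m + 1)) • x))) = _
  rw [smul_neg, idem_cop, d_smul, cop_idem]

theorem cotwistD_mem (a : Bideg) (t : (cotwistBase m X).carrier)
    (ht : t ∈ (cotwistBase m X).gr a) : cotwistD m X t ∈ (cotwistBase m X).gr (a + (1, 0)) := by
  refine moduleDesc_mem (m + 1) X (shiftObj (1, 0) (cotwistBase m X)) (c := a)
    (s := (N - 1, 0)) _ _ (fun y hy => ?_) (fun b y hy _ => ?_) t ht.1 ht.2
  · refine add_mem (cotwistBase_inc_mem m X (X.d_mem _ _ hy)) ?_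
    -- As (N, 0) = (1, 0) + (N - 1, 0), the shift of the tensor summand turns the coevaluation into
    -- a map of bidegree (1, 0).
    exact casimir_mem (Z := cotwistBase m X) m _ (s := (N - 1, 0))
      (fun c y hy => cotwistBase_cop_mem m X hy)
      (by rw [add_assoc]; congr 1; simp) hy
  · refine neg_mem (cotwistBase_cop_mem m X ?_)
    have := X.d_mem _ _ hy
    rwa [add_right_comm] at this

/-- The coevaluation commutes with the differentials and the tensor summand carries the negative
one, so the two mixed terms cancel. Accordingly `map_casimir` is applied with `-X.d` on the source.
-/
theorem cotwistD_cotwistD (t : (Tw (m + 1) X).carrier) : cotwistD m X (cotwistD m X t) = 0 := by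
  refine tw_hom_ext (W := Tw (m + 1) X) (m + 1) (f := (cotwistD m X).comp (cotwistD m X))
    (g := 0) (fun y => ?_) (fun y hy => ?_) t
  · have h := map_casimir m (cop (m + 1) X) (cop (m + 1) X) (-X.d) (cotwistD m X)
      (fun x => by rw [cotwistD_cop, LinearMap.neg_apply, map_neg]) y
    rw [LinearMap.comp_apply, cotwistD_inc, map_add, cotwistD_inc, h, X.d_d, map_zero,
      zero_add, ← map_add, LinearMap.neg_apply, add_neg_cancel, map_zero, LinearMap.zero_apply]
  · rw [LinearMap.comp_apply, cotwistD_cop, map_neg, cotwistD_cop, X.d_d, map_zero, neg_zero,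
      neg_zero, LinearMap.zero_apply]

/-- The differential of the inverse twist, as an endomorphism of `cotwistBase m X`. -/
def cotwistLin : (cotwistBase m X).carrier →ₗ[(Zigzag k n)ᵐᵒᵖ] (cotwistBase m X).carrier where
  toFun t := cotwistD m X t
  map_add' s t := map_add (cotwistD m X) s t
  map_smul' r t := map_smul (cotwistD m X) r t

theorem cotwistLin_mem (a : Bideg) (t : (cotwistBase m X).carrier)
    (ht : t ∈ (cotwistBase m X).gr a) : cotwistLin m X t ∈ (cotwistBase m X).gr (a + (1, 0)) :=
  cotwistD_mem m X a t ht

theorem cotwistLin_cotwistLin (t : (cotwistBase m X).carrier) :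
    cotwistLin m X (cotwistLin m X t) = 0 := cotwistD_cotwistD m X t

/-- The inverse twist of `X`, the cocone of the coevaluation map `X → X ⊗ R_n (i) ⊗ P_i`, where
`i = m + 1`. -/
def Cotw : DGMod k n N :=
  { cotwistBase m X with
    d := cotwistLin m X
    d_mem := cotwistLin_mem m X
    d_d := cotwistLin_cotwistLin m X }

/-- The identity map between the modules that underlie `T_i X` and `cotwistBase m X`. -/
def cotwistBaseEquiv :
    (Tw (m + 1) X).carrier ≃ₗ[(Zigzag k n)ᵐᵒᵖ] (cotwistBase m X).carrier where
  toFun t := t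
  invFun t := t
  map_add' _ _ := rfl
  map_smul' _ _ := rfl
  left_inv _ := rfl
  right_inv _ := rfl

/-- The identity map between the modules that underlie `cotwistBase m X` and `T'_i X`. -/
def cotwistBaseEquiv' : (cotwistBase m X).carrier ≃ₗ[(Zigzag k n)ᵐᵒᵖ] (Cotw m X).carrier where
  toFun t := t
  invFun t := t
  map_add' _ _ := rfl
  map_smul' _ _ := rfl
  left_inv _ := rfl
  right_inv _ := rfl

/-- The identity map between the modules that underlie `T_i X` and `T'_i X`. -/
def cotwEquiv : (Tw (m + 1) X).carrier ≃ₗ[(Zigzag k n)ᵐᵒᵖ] (Cotw m X).carrier :=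
  (cotwistBaseEquiv m X).trans (cotwistBaseEquiv' m X)

/-- The inclusion `X → T'_i X`, which does not commute with the differentials. -/
def coinc : X.carrier →ₗ[(Zigzag k n)ᵐᵒᵖ] (Cotw m X).carrier :=
  (cotwEquiv m X).toLinearMap.comp (inc (m + 1) X)

/-- The projection `T'_i X → X`. -/
def cosnd : (Cotw m X).carrier →ₗ[(Zigzag k n)ᵐᵒᵖ] X.carrier :=
  (twSnd (m + 1) X).comp (cotwEquiv m X).symm.toLinearMap

/-- The map `X → T'_i X`, `x ↦ x (i) ⊗ (i)`. -/
def cocop : X.carrier →ₗ[k] (Cotw m X).carrier :=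
  ((cotwEquiv m X).toLinearMap.restrictScalars k).comp (cop (m + 1) X)

/-- The map `T'_i X → X`, `(x ⊗ p, y) ↦ λ(p) x`, where `λ` is the coefficient of the loop. -/
def cokap : (Cotw m X).carrier →ₗ[k] X.carrier :=
  (kap (m + 1) X (coefLoop k (m + 1))).comp
    ((cotwEquiv m X).symm.toLinearMap.restrictScalars k)

variable {X}

/-- The module map `(x ⊗ p, y) ↦ η(x) p + f(y)` on `T'_i X`. -/
def codesc {W : DGMod k n N} (f : X.carrier →ₗ[(Zigzag k n)ᵐᵒᵖ] W.carrier)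
    (η : X.carrier →ₗ[k] W.carrier) : (Cotw m X).carrier →ₗ[(Zigzag k n)ᵐᵒᵖ] W.carrier :=
  (desc (m + 1) f η).comp (cotwEquiv m X).symm.toLinearMap

theorem d_cotwEquiv (t : (Tw (m + 1) X).carrier) :
    (Cotw m X).d (cotwEquiv m X t) = cotwEquiv m X (cotwistD m X t) := rfl

theorem coinc_apply (x : X.carrier) : coinc m X x = cotwEquiv m X (inc (m + 1) X x) := rfl

theorem cocop_apply (x : X.carrier) : cocop m X x = cotwEquiv m X (cop (m + 1) X x) := rfl

theorem d_coinc (x : X.carrier) :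
    (Cotw m X).d (coinc m X x) = coinc m X (X.d x) + casimir m (cocop m X) x := by
  rw [coinc_apply, d_cotwEquiv, cotwistD_inc, map_add, coinc_apply]
  congr 1

theorem d_cocop (x : X.carrier) : (Cotw m X).d (cocop m X x) = -cocop m X (X.d x) := by
  rw [cocop_apply, d_cotwEquiv, cotwistD_cop, map_neg, cocop_apply]

theorem cosnd_coinc (x : X.carrier) : cosnd m X (coinc m X x) = x := rfl

theorem cosnd_cocop (x : X.carrier) : cosnd m X (cocop m X x) = 0 := rfl

theorem cocop_idem (x : X.carrier) : cocop m X (op (idem k (m + 1)) • x) = cocop m X x := by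
  rw [cocop_apply, cop_idem, cocop_apply]

theorem idem_cocop (x : X.carrier) : op (idem k (m + 1)) • cocop m X x = cocop m X x := by
  rw [cocop_apply, ← map_smul, idem_cop]

theorem cokap_coinc (x : X.carrier) : cokap m X (coinc m X x) = 0 := kap_inc (m + 1) _ x

theorem cokap_op_cocop (r : Zigzag k n) (x : X.carrier) :
    cokap m X (op r • cocop m X x) = coefLoop k (m + 1) (idem k (m + 1) * r) •
      op (idem k (m + 1)) • x := by
  rw [cocop_apply, ← map_smul]
  exact kap_op_cop (m + 1) (coefLoop k (m + 1)) r x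

theorem codesc_coinc {W : DGMod k n N} (f : X.carrier →ₗ[(Zigzag k n)ᵐᵒᵖ] W.carrier)
    (η : X.carrier →ₗ[k] W.carrier) (x : X.carrier) : codesc m f η (coinc m X x) = f x :=
  desc_inc (m + 1) f η x

theorem codesc_cocop' {W : DGMod k n N} (f : X.carrier →ₗ[(Zigzag k n)ᵐᵒᵖ] W.carrier)
    (η : X.carrier →ₗ[k] W.carrier) (x : X.carrier) :
    codesc m f η (cocop m X x) = op (idem k (m + 1)) • η (op (idem k (m + 1)) • x) :=
  desc_cop' (m + 1) f η x

@[elab_as_elim]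
theorem cotw_induction {P : (Cotw m X).carrier → Prop}
    (add : ∀ s t, P s → P t → P (s + t)) (inc : ∀ y, P (coinc m X y))
    (cop : ∀ (r : Zigzag k n) (y : X.carrier), op (idem k (m + 1)) • y = y →
      P (op r • cocop m X y)) (t : (Cotw m X).carrier) : P t := by
  suffices h : ∀ t : (Tw (m + 1) X).carrier, P (cotwEquiv m X t) from h t
  intro t
  induction t using tw_induction with
  | add s t hs ht => rw [map_add]; exact add _ _ hs ht
  | inc y => exact inc y
  | cop r y hy => rw [map_smul]; exact cop r y hy

theorem cotw_hom_ext {W : DGMod k n N} {f g : (Cotw m X).carrier →ₗ[(Zigzag k n)ᵐᵒᵖ] W.carrier}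
    (h1 : ∀ y, f (coinc m X y) = g (coinc m X y))
    (h2 : ∀ y, op (idem k (m + 1)) • y = y → f (cocop m X y) = g (cocop m X y))
    (t : (Cotw m X).carrier) : f t = g t := by
  induction t using cotw_induction with
  | add s t hs ht => rw [map_add, map_add, hs, ht]
  | inc y => exact h1 y
  | cop r y hy => rw [map_smul, map_smul, h2 y hy]

/-- An additive property of elements of `(T'_i X)(i)`. -/
@[elab_as_elim]
theorem cotw_induction_self (hn : 3 ≤ n) {P : (Cotw m X).carrier → Prop}
    (add : ∀ s t, P s → P t → P (s + t))
    (inc : ∀ y, op (idem k (m + 1)) • y = y → P (coinc m X y))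
    (cop : ∀ y, op (idem k (m + 1)) • y = y → P (cocop m X y))
    (loop : ∀ y, op (idem k (m + 1)) • y = y → P (op (loop k (m + 1)) • cocop m X y))
    (t : (Cotw m X).carrier) (ht : op (idem k (m + 1)) • t = t) : P t := by
  suffices h : ∀ t : (Tw (m + 1) X).carrier, op (idem k (m + 1)) • t = t → P (cotwEquiv m X t)
    from h t ht
  intro t ht
  refine tw_induction_self (m + 1) hn (fun s t hs ht => ?_) inc cop (fun y hy => ?_) t ht
  · rw [map_add]; exact add _ _ hs ht
  · rw [map_smul]; exact loop y hy

theorem coinc_mem {c : Bideg} {x : X.carrier} (hx : x ∈ X.gr c) :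
    coinc m X x ∈ (Cotw m X).gr c := cotwistBase_inc_mem m X hx

theorem cocop_mem {c : Bideg} {x : X.carrier} (hx : x ∈ X.gr (c + (N - 1, 0))) :
    cocop m X x ∈ (Cotw m X).gr c := cotwistBase_cop_mem m X hx

end Cotwist

end DGMod

namespace DGMod

open MulOpposite Gen

variable {k : Type u} [Field k] {n : ℕ} [NeZero n] {N : ℤ}

/-! ### Further identities for the Casimir construction -/

section Casimir

variable {X Y Z : DGMod k n N} (m : ZMod n)

theorem casimir_zero (x : X.carrier) : casimir m (0 : X.carrier →ₗ[k] Y.carrier) x = 0 := by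
  simp only [casimir_apply, LinearMap.zero_apply, smul_zero, add_zero]

theorem casimir_add (ψ ψ' : X.carrier →ₗ[k] Y.carrier) (x : X.carrier) :
    casimir m (ψ + ψ') x = casimir m ψ x + casimir m ψ' x := by
  simp only [casimir_apply, LinearMap.add_apply, smul_add]
  abel

theorem casimir_neg (ψ : X.carrier →ₗ[k] Y.carrier) (x : X.carrier) :
    casimir m (-ψ) x = -casimir m ψ x := by
  simp only [casimir_apply, LinearMap.neg_apply, smul_neg, neg_add]

theorem casimir_comp_lin (ψ : Y.carrier →ₗ[k] Z.carrier)
    (f : X.carrier →ₗ[(Zigzag k n)ᵐᵒᵖ] Y.carrier) (x : X.carrier) :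
    casimir m (ψ.comp (f.restrictScalars k)) x = casimir m ψ (f x) :=
  map_casimir m (ψ.comp (f.restrictScalars k)) ψ f LinearMap.id (fun _ => rfl) x

theorem casimir_lin_comp (ψ : X.carrier →ₗ[k] Y.carrier)
    (f : Y.carrier →ₗ[(Zigzag k n)ᵐᵒᵖ] Z.carrier) (x : X.carrier) :
    casimir m ((f.restrictScalars k).comp ψ) x = f (casimir m ψ x) :=
  (map_casimir m ψ ((f.restrictScalars k).comp ψ) LinearMap.id f (fun _ => rfl) x).symm

/-- Of the four paths that end at i = m + 1, the two arrows start at other vertices and so act by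
zero on X(i). -/
theorem casimir_of_idem (hn : 3 ≤ n) (ψ : X.carrier →ₗ[k] Y.carrier) {x : X.carrier}
    (hx : op (idem k (m + 1)) • x = x) :
    casimir m ψ x = op (loop k (m + 1)) • ψ x +
      op (idem k (m + 1)) • ψ (op (loop k (m + 1)) • x) := by
  have h1 : op (gen k (up m)) • x = 0 := by
    rw [← hx, op_smul_op_smul, idem_mul_gen, if_neg, op_zero, zero_smul]
    exact fun h => one_ne_zero_zmod hn (add_eq_left.1 (show m + 1 = m from h.symm))
  have h2 : op (gen k (down (m + 1))) • x = 0 := by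
    rw [← hx, op_smul_op_smul, idem_mul_gen, if_neg, op_zero, zero_smul]
    exact fun h => one_ne_zero_zmod hn (add_eq_left.1 (show m + 1 + 1 = m + 1 from h))
  rw [casimir_apply, h1, h2, hx]
  simp only [map_zero, smul_zero, add_zero]

/-- The contraction of the coevaluation with the coefficient of the loop. -/
theorem casimir_kap_cop (hn : 3 ≤ n) (φ : X.carrier →ₗ[k] Y.carrier) (x : X.carrier) :
    casimir m (φ.comp (kap (m + 1) X (coefLoop k (m + 1)))) (cop (m + 1) X x) =
      op (idem k (m + 1)) • φ (op (idem k (m + 1)) • x) := by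
  -- The module map r ↦ cop x · r out of the regular module pulls the claim back to
  -- `casimir_coefLoop` at r = 1.
  let f : Zigzag k n →ₗ[(Zigzag k n)ᵐᵒᵖ] (Tw (m + 1) X).carrier :=
    { toFun := fun r => op r • cop (m + 1) X x
      map_add' := fun r s => op_add_smul _ _ _ _
      map_smul' := fun r s => by
        change op (s * unop r) • cop (m + 1) X x = r • op s • cop (m + 1) X x
        rw [op_mul, op_unop, mul_smul] }
  have h := map_casimir m ((LinearMap.toSpanSingleton k Y.carrier
    (φ (op (idem k (m + 1)) • x))).comp (coefLoop k (m + 1)))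
    (φ.comp (kap (m + 1) X (coefLoop k (m + 1)))) f LinearMap.id (fun r => by
      change coefLoop k (m + 1) r • φ _ = φ (kap (m + 1) X _ (op r • cop (m + 1) X x))
      rw [kap_op_cop, LinearMap.map_smul φ, ← coefLoop_corner (m + 1) (idem k (m + 1) * r),
        ← mul_assoc,
        gen_vertex_mul_self, coefLoop_corner]) 1
  rw [casimir_coefLoop hn] at h
  simpa [f] using h.symm

end Casimir

/-- A chain map with a left inverse which is a homotopy inverse is a quasi-isomorphism. -/
theorem quasiIso_of_retraction {X Y : DGMod k n N} (f : X ⟶ Y)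
    (r : Y.carrier →ₗ[(Zigzag k n)ᵐᵒᵖ] X.carrier) (h : Y.carrier → Y.carrier)
    (hr : ∀ x, r (f.lin x) = x) (hd : ∀ y, r (Y.d y) = X.d (r y))
    (hh : ∀ y, y - f.lin (r y) = Y.d (h y) + h (Y.d y)) (h0 : h 0 = 0) : quasiIso k n N f := by
  rw [quasiIso_iff]
  constructor
  · rintro x hx ⟨y, hy⟩
    have hy : f.lin x = Y.d y := hy
    exact ⟨r y, by
      change x = X.d (r y)
      rw [← hd, ← hy, hr]⟩
  · intro y hy
    have hy : Y.d y = 0 := hy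
    refine ⟨r y, ?_, h y, ?_⟩
    · change X.d (r y) = 0
      rw [← hd, hy, map_zero]
    · change y = f.lin (r y) + Y.d (h y)
      have := hh y
      rw [hy, h0, add_zero] at this
      rw [← this, add_sub_cancel]

/-! ### The inverse twist as a functor and as a cocone -/

section CotwMap

variable (m : ZMod n) {X Y Z : DGMod k n N}

theorem codesc_mem (f : X.carrier →ₗ[(Zigzag k n)ᵐᵒᵖ] Y.carrier)
    (η : X.carrier →ₗ[k] Y.carrier) {c : Bideg} (hf : ∀ x ∈ X.gr c, f x ∈ Y.gr c)
    (hη : ∀ b, ∀ x ∈ X.gr (b + (N - 1, 0)), op (idem k (m + 1)) • x = x → η x ∈ Y.gr b)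
    (t : (Cotw m X).carrier) (ht : t ∈ (Cotw m X).gr c) : codesc m f η t ∈ Y.gr c :=
  moduleDesc_mem (m + 1) X Y f η hf hη t ht.1 ht.2

/-- The underlying map of `T'_i f`. -/
def cotmap (g : X.carrier →ₗ[(Zigzag k n)ᵐᵒᵖ] Y.carrier) :
    (Cotw m X).carrier →ₗ[(Zigzag k n)ᵐᵒᵖ] (Cotw m Y).carrier :=
  codesc m ((coinc m Y).comp g) ((cocop m Y).comp (g.restrictScalars k))

theorem cotmap_coinc (g : X.carrier →ₗ[(Zigzag k n)ᵐᵒᵖ] Y.carrier) (x : X.carrier) :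
    cotmap m g (coinc m X x) = coinc m Y (g x) := codesc_coinc m _ _ x

theorem cotmap_cocop (g : X.carrier →ₗ[(Zigzag k n)ᵐᵒᵖ] Y.carrier) (x : X.carrier) :
    cotmap m g (cocop m X x) = cocop m Y (g x) := by
  rw [cotmap, codesc_cocop']
  simp only [LinearMap.comp_apply, LinearMap.coe_restrictScalars, map_smul, cocop_idem,
    idem_cocop]

/-- The functoriality of `T'_i`. -/
def cotwMap (f : X ⟶ Y) : Cotw m X ⟶ Cotw m Y :=
  (⟨cotmap m f.lin, fun c t ht => codesc_mem m ((coinc m Y).comp f.lin)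
    ((cocop m Y).comp (f.lin.restrictScalars k)) (fun x hx => coinc_mem m (f.map_mem _ _ hx))
    (fun b x hx _ => cocop_mem m (f.map_mem _ _ hx)) t ht, by
    intro t
    refine LinearMap.congr_fun (f := (cotmap m f.lin).comp (Cotw m X).d)
      (g := (Cotw m Y).d.comp (cotmap m f.lin)) (LinearMap.ext fun t => ?_) t
    refine cotw_hom_ext m (fun y => ?_) (fun y hy => ?_) t
    · rw [LinearMap.comp_apply, LinearMap.comp_apply, d_coinc, cotmap_coinc, d_coinc, map_add,
        cotmap_coinc, f.comm]
      congr 1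
      exact map_casimir m _ _ f.lin _ (cotmap_cocop m f.lin) y
    · rw [LinearMap.comp_apply, LinearMap.comp_apply, d_cocop, cotmap_cocop, d_cocop, map_neg,
        cotmap_cocop, f.comm]⟩ : Hom (Cotw m X) (Cotw m Y))

theorem cotwMap_lin (f : X ⟶ Y) : Hom.lin (cotwMap m f) = cotmap m f.lin := rfl

variable (k N) in
/-- The functor `T'_i` on dg modules, for `i = m + 1`. -/
def cotwistFunctor : DGMod k n N ⥤ DGMod k n N where
  obj X := Cotw m X
  map f := cotwMap m f
  map_id X := by
    apply hom_ext
    intro t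
    exact cotw_hom_ext m (f := cotmap m (Hom.lin (𝟙 X))) (g := LinearMap.id)
      (fun y => cotmap_coinc m _ _) (fun y _ => cotmap_cocop m _ _) t
  map_comp {X Y Z} f g := by
    apply hom_ext
    intro t
    refine cotw_hom_ext m (f := cotmap m (Hom.lin (f ≫ g)))
      (g := (cotmap m g.lin).comp (cotmap m f.lin)) (fun y => ?_) (fun y _ => ?_) t
    · rw [LinearMap.comp_apply, cotmap_coinc, cotmap_coinc, cotmap_coinc, comp_lin]
    · rw [LinearMap.comp_apply, cotmap_cocop, cotmap_cocop, cotmap_cocop, comp_lin]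

variable (X) in
/-- The dg module `X ⊗ R_n (i) ⊗ P_i`, for `i = m + 1`. -/
def Ten : DGMod k n N := twistObj (m + 1) X

variable (X) in
/-- The projection of `T'_i X` to `X ⊗ R_n (i) ⊗ P_i`. -/
def cofst : (Cotw m X).carrier →ₗ[(Zigzag k n)ᵐᵒᵖ] (Ten m X).carrier :=
  (LinearMap.fst (Zigzag k n)ᵐᵒᵖ (proj k (m + 1) ⊗[k] X.corner (m + 1)) X.carrier).comp
    (cotwEquiv m X).symm.toLinearMap

variable (X) in
/-- The inclusion of `X ⊗ R_n (i) ⊗ P_i` into `T'_i X`. -/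
def coinl : (Ten m X).carrier →ₗ[(Zigzag k n)ᵐᵒᵖ] (Cotw m X).carrier :=
  (cotwEquiv m X).toLinearMap.comp
    (LinearMap.inl (Zigzag k n)ᵐᵒᵖ (proj k (m + 1) ⊗[k] X.corner (m + 1)) X.carrier)

theorem cofst_coinc (x : X.carrier) : cofst m X (coinc m X x) = 0 := rfl

theorem cofst_cocop (x : X.carrier) : cofst m X (cocop m X x) =
    projIdem k (m + 1) ⊗ₜ[k] cornerProj (m + 1) X x := rfl

theorem cofst_coinl (t : (Ten m X).carrier) : cofst m X (coinl m X t) = t := rfl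

theorem cosnd_coinl (t : (Ten m X).carrier) : cosnd m X (coinl m X t) = 0 := rfl

theorem coinl_cofst_cocop (x : X.carrier) : coinl m X (cofst m X (cocop m X x)) = cocop m X x :=
  rfl

theorem coinc_cosnd_add (t : (Cotw m X).carrier) :
    coinc m X (cosnd m X t) + coinl m X (cofst m X t) = t := by
  refine cotw_hom_ext m (f := (coinc m X).comp (cosnd m X) + (coinl m X).comp (cofst m X))
    (g := LinearMap.id) (fun y => ?_) (fun y _ => ?_) t
  · rw [LinearMap.add_apply, LinearMap.comp_apply, LinearMap.comp_apply, cosnd_coinc, cofst_coinc,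
      map_zero, add_zero, LinearMap.id_apply]
  · rw [LinearMap.add_apply, LinearMap.comp_apply, LinearMap.comp_apply, cosnd_cocop,
      coinl_cofst_cocop, map_zero, zero_add, LinearMap.id_apply]

theorem cosnd_casimir (x : X.carrier) : cosnd m X (casimir m (cocop m X) x) = 0 :=
  (map_casimir m (cocop m X) 0 LinearMap.id (cosnd m X) (fun _ => rfl) x).trans
    (casimir_zero m x)

theorem cosnd_d (t : (Cotw m X).carrier) : cosnd m X ((Cotw m X).d t) = X.d (cosnd m X t) := by
  refine cotw_hom_ext m (f := (cosnd m X).comp (Cotw m X).d) (g := X.d.comp (cosnd m X))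
    (fun y => ?_) (fun y _ => ?_) t
  · rw [LinearMap.comp_apply, LinearMap.comp_apply, d_coinc, map_add, cosnd_coinc, cosnd_coinc,
      cosnd_casimir, add_zero]
  · rw [LinearMap.comp_apply, LinearMap.comp_apply, d_cocop, map_neg, cosnd_cocop, cosnd_cocop,
      map_zero, neg_zero]

variable (X) in
/-- The coevaluation `X → X ⊗ R_n (i) ⊗ P_i`. -/
def coev : X.carrier →ₗ[(Zigzag k n)ᵐᵒᵖ] (Ten m X).carrier :=
  (cofst m X).comp (casimir m (cocop m X))

theorem twist_d_cofst_cocop (x : X.carrier) : (Ten m X).d (cofst m X (cocop m X x)) =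
    cofst m X (cocop m X (X.d x)) := by
  rw [cofst_cocop, cofst_cocop]
  exact congrArg (projIdem k (m + 1) ⊗ₜ[k] ·) (Subtype.ext (X.d_smul _ _))

/-- The coevaluation is a Casimir map whose k-linear ingredient commutes with the differentials, so
`map_casimir` applies with a differential on each side. -/
theorem coev_d (x : X.carrier) : coev m X (X.d x) = (Ten m X).d (coev m X x) := by
  have h1 := casimir_lin_comp m (cocop m X) (cofst m X)
  have h2 := map_casimir m (((cofst m X).restrictScalars k).comp (cocop m X))
    (((cofst m X).restrictScalars k).comp (cocop m X)) X.d (Ten m X).d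
    (fun y => twist_d_cofst_cocop m y) x
  rw [h1, h1] at h2
  exact h2.symm

/-- Together with `cosnd_d` this exhibits the inverse twist as a cocone of the coevaluation, which
is what the proof that it preserves quasi-isomorphisms needs. -/
theorem cofst_d (t : (Cotw m X).carrier) : cofst m X ((Cotw m X).d t) =
    coev m X (cosnd m X t) - (Ten m X).d (cofst m X t) := by
  refine cotw_hom_ext m (f := (cofst m X).comp (Cotw m X).d)
    (g := (coev m X).comp (cosnd m X) - (Ten m X).d.comp (cofst m X))
    (fun y => ?_) (fun y _ => ?_) t
  · rw [LinearMap.comp_apply, LinearMap.sub_apply, LinearMap.comp_apply, LinearMap.comp_apply,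
      d_coinc, map_add, cofst_coinc, cofst_coinc, map_zero, sub_zero, zero_add, cosnd_coinc]
    rfl
  · rw [LinearMap.comp_apply, LinearMap.sub_apply, LinearMap.comp_apply, LinearMap.comp_apply,
      d_cocop, map_neg, cosnd_cocop, twist_d_cofst_cocop, map_zero, zero_sub]

end CotwMap

end DGMod

namespace DGMod

open MulOpposite Gen

variable {k : Type u} [Field k] {n : ℕ} [NeZero n] {N : ℤ}

/-! ### The inverse twist preserves quasi-isomorphisms -/

section CotwMap

variable (m : ZMod n) {X Y : DGMod k n N}

theorem cosnd_cotmap (g : X.carrier →ₗ[(Zigzag k n)ᵐᵒᵖ] Y.carrier) (t : (Cotw m X).carrier) :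
    cosnd m Y (cotmap m g t) = g (cosnd m X t) := by
  refine cotw_hom_ext m (f := (cosnd m Y).comp (cotmap m g)) (g := g.comp (cosnd m X))
    (fun y => ?_) (fun y _ => ?_) t
  · rw [LinearMap.comp_apply, LinearMap.comp_apply, cotmap_coinc, cosnd_coinc, cosnd_coinc]
  · rw [LinearMap.comp_apply, LinearMap.comp_apply, cotmap_cocop, cosnd_cocop, cosnd_cocop,
      map_zero]

/-- The map induced by `f` on `X ⊗ R_n (i) ⊗ P_i`. -/
def tenMap (f : X ⟶ Y) : Ten m X ⟶ Ten m Y := twistMap (m + 1) f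

theorem cofst_cotmap (f : X ⟶ Y) (t : (Cotw m X).carrier) :
    cofst m Y (cotmap m f.lin t) = (tenMap m f).lin (cofst m X t) := by
  refine cotw_hom_ext m (f := (cofst m Y).comp (cotmap m f.lin))
    (g := (tenMap m f).lin.comp (cofst m X)) (fun y => ?_) (fun y _ => ?_) t
  · rw [LinearMap.comp_apply, LinearMap.comp_apply, cotmap_coinc, cofst_coinc, cofst_coinc,
      map_zero]
  · rw [LinearMap.comp_apply, LinearMap.comp_apply, cotmap_cocop, cofst_cocop, cofst_cocop]
    exact congrArg (projIdem k (m + 1) ⊗ₜ[k] ·) (Subtype.ext (f.lin_smul _ _).symm)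

theorem coev_naturality (f : X ⟶ Y) (x : X.carrier) :
    (tenMap m f).lin (coev m X x) = coev m Y (f.lin x) := by
  have h := map_casimir m (cocop m X) (cocop m Y) f.lin (cotmap m f.lin)
    (fun y => cotmap_cocop m f.lin y) x
  exact (cofst_cotmap m f _).symm.trans (congrArg (cofst m Y) h)

variable (X) in
/-- The identification of `T'_i X` with a mapping cone. -/
def cotwSplit : (Cotw m X).carrier →ₗ[k] X.carrier × (Ten m X).carrier :=
  ((cosnd m X).restrictScalars k).prod ((cofst m X).restrictScalars k)

variable (X) in
/-- The inverse of `cotwSplit`. -/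
def cotwJoin : X.carrier × (Ten m X).carrier →ₗ[k] (Cotw m X).carrier :=
  ((coinc m X).restrictScalars k).coprod ((coinl m X).restrictScalars k)

theorem cotwJoin_cotwSplit (t : (Cotw m X).carrier) : cotwJoin m X (cotwSplit m X t) = t :=
  coinc_cosnd_add m t

theorem cotwSplit_cotwJoin (z : X.carrier × (Ten m X).carrier) :
    cotwSplit m X (cotwJoin m X z) = z := by
  refine Prod.ext ?_ ?_
  · change cosnd m X (coinc m X z.1 + coinl m X z.2) = z.1
    rw [map_add, cosnd_coinc, cosnd_coinl, add_zero]
  · change cofst m X (coinc m X z.1 + coinl m X z.2) = z.2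
    rw [map_add, cofst_coinc, cofst_coinl, zero_add]

/-- `coneD` changes the sign of the first differential. Taking both complexes with the differential
-d thus gives d on X and -d on the tensor summand, as in the inverse twist. -/
theorem coneD_cotwSplit (t : (Cotw m X).carrier) :
    coneD (-X.dk) (-(Ten m X).dk) ((coev m X).restrictScalars k) (cotwSplit m X t) =
      cotwSplit m X ((Cotw m X).d t) := by
  refine Prod.ext ?_ ?_
  · change - -X.d (cosnd m X t) = cosnd m X ((Cotw m X).d t)
    rw [neg_neg, cosnd_d]
  · change coev m X (cosnd m X t) + -(Ten m X).d (cofst m X t) = cofst m X ((Cotw m X).d t)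
    rw [cofst_d, sub_eq_add_neg]

/-- Through `cotwSplit` this becomes the statement for mapping cones, `ElemQuasiIso.cone`, applied
to the coevaluations. Reversing the signs of the differentials changes neither kernels nor images.
-/
theorem quasiIso_cotwMap (f : X ⟶ Y) (hf : quasiIso k n N f) : quasiIso k n N (cotwMap m f) := by
  have hT : quasiIso k n N (tenMap m f) := quasiIso_twistMap (m + 1) f hf
  rw [quasiIso_iff] at hf hT ⊢
  have h := ElemQuasiIso.cone (dV := -X.dk) (dW := -(Ten m X).dk)
    (f := (coev m X).restrictScalars k) (dV' := -Y.dk) (dW' := -(Ten m Y).dk)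
    (f' := (coev m Y).restrictScalars k) (g := Hom.link f) (h := Hom.link (tenMap m f))
    (hf.smul (-1) (by norm_num) (fun x => (neg_one_smul ℤ (X.dk x)).symm)
      (fun x => (neg_one_smul ℤ (Y.dk x)).symm))
    (hT.smul (-1) (by norm_num) (fun x => (neg_one_smul ℤ ((Ten m X).dk x)).symm)
      (fun x => (neg_one_smul ℤ ((Ten m Y).dk x)).symm))
    (fun x => by
      change coev m X (-X.d x) = -(Ten m X).d (coev m X x)
      rw [map_neg, coev_d])
    (fun x => by
      change coev m Y (-Y.d x) = -(Ten m Y).d (coev m Y x)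
      rw [map_neg, coev_d])
    (fun x => by
      change f.lin (-X.d x) = -Y.d (f.lin x)
      rw [map_neg, f.comm])
    (fun x => by
      change (tenMap m f).lin (-(Ten m X).d x) = -(Ten m Y).d ((tenMap m f).lin x)
      rw [map_neg, (tenMap m f).comm])
    (fun x => coev_naturality m f x)
  refine h.retract (cotwSplit m X) (cotwJoin m X) (cotwSplit m Y) (cotwJoin m Y)
    (cotwJoin_cotwSplit m) (cotwJoin_cotwSplit m) (coneD_cotwSplit m) (coneD_cotwSplit m)
    (fun z => ?_) (fun z => ?_) (fun t => ?_) (fun z => ?_)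
  · conv_lhs => rw [← cotwSplit_cotwJoin m z, coneD_cotwSplit, cotwJoin_cotwSplit]
    rfl
  · conv_lhs => rw [← cotwSplit_cotwJoin m z, coneD_cotwSplit, cotwJoin_cotwSplit]
    rfl
  · exact (Prod.ext (cosnd_cotmap m f.lin t) (cofst_cotmap m f t)).symm
  · change _ = cotmap m f.lin _
    rw [← cotwJoin_cotwSplit m (cotmap m f.lin _)]
    refine congrArg (cotwJoin m Y) ?_
    refine Eq.trans ?_ (Prod.ext (cosnd_cotmap m f.lin (cotwJoin m X z))
      (cofst_cotmap m f (cotwJoin m X z)) : cotwSplit m Y (cotmap m f.lin (cotwJoin m X z)) =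
        (f.lin (cosnd m X (cotwJoin m X z)), (tenMap m f).lin (cofst m X (cotwJoin m X z)))).symm
    have hz := cotwSplit_cotwJoin m z
    exact Prod.ext (congrArg f.lin (congrArg Prod.fst hz).symm)
      (congrArg (tenMap m f).lin (congrArg Prod.snd hz).symm)

end CotwMap

/-! ### The quasi-isomorphism X → T'_i T_i X -/

section Unit

variable (m : ZMod n) (X : DGMod k n N)

variable {X} in
-- The coefficient of the loop factors through the first summand of the mapping cone, where the
-- differential has a minus sign.
theorem kap_d (t : (Tw (m + 1) X).carrier) :
    kap (m + 1) X (coefLoop k (m + 1)) ((Tw (m + 1) X).d t) =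
      -X.d (kap (m + 1) X (coefLoop k (m + 1)) t) := by
  induction t using tw_induction with
  | add s t hs ht => simp only [map_add, hs, ht, neg_add]
  | inc y => rw [d_inc, kap_inc, kap_inc, map_zero, neg_zero]
  | cop r y hy =>
    rw [d_smul, d_cop, smul_sub, map_sub, kap_op_inc, kap_op_cop, kap_op_cop, zero_sub,
      k_smul_d, d_smul]

variable {X} in
theorem kap_idem_self (t : (Tw (m + 1) X).carrier) :
    kap (m + 1) X (coefLoop k (m + 1)) (op (idem k (m + 1)) • t) =
      kap (m + 1) X (coefLoop k (m + 1)) t :=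
  kap_idem (m + 1) (fun r => by
    rw [← coefLoop_corner, ← mul_assoc, mul_assoc, gen_vertex_mul_self, coefLoop_corner]) t

variable {X} in
theorem kap_cop_self (x : X.carrier) :
    kap (m + 1) X (coefLoop k (m + 1)) (cop (m + 1) X x) = 0 := by
  rw [kap_cop, coefLoop_idem, zero_smul]

variable {X} in
theorem kap_loop_cop {x : X.carrier} (hx : op (idem k (m + 1)) • x = x) :
    kap (m + 1) X (coefLoop k (m + 1)) (op (loop k (m + 1)) • cop (m + 1) X x) = x := by
  rw [kap_op_cop, idem_mul_loop, coefLoop_loop, one_smul, hx]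

/-- The map `x ↦ ∑ x w ⊗ w'` from `X` to the summand `P_i ⊗ X (i) ⊗ (i) R_n (i)` of `T'_i T_i X`. -/
def unitPsi : X.carrier →ₗ[k] (Cotw m (Tw (m + 1) X)).carrier :=
  (cocop m (Tw (m + 1) X)).comp (cop (m + 1) X)

theorem unitPsi_apply (x : X.carrier) :
    unitPsi m X x = cocop m (Tw (m + 1) X) (cop (m + 1) X x) := rfl

/-- The underlying map of the unit `X ⟶ T'_i T_i X`. -/
def unitLin : X.carrier →ₗ[(Zigzag k n)ᵐᵒᵖ] (Cotw m (Tw (m + 1) X)).carrier :=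
  (coinc m _).comp (inc (m + 1) X) + casimir m (unitPsi m X)

theorem unitLin_apply (x : X.carrier) :
    unitLin m X x = coinc m _ (inc (m + 1) X x) + casimir m (unitPsi m X) x := rfl

/-- The first summand of `unitLin` fails to commute with the differentials by the coevaluation of
`inc x`; the subtracted term here compensates for it. -/
theorem d_casimir_unitPsi (x : X.carrier) :
    (Cotw m (Tw (m + 1) X)).d (casimir m (unitPsi m X) x) =
      casimir m (unitPsi m X) (X.d x) - casimir m (cocop m _) (inc (m + 1) X x) := by
  refine (map_casimir m (unitPsi m X) ((unitPsi m X).comp (X.d.restrictScalars k) +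
    -(cocop m (Tw (m + 1) X)).comp ((inc (m + 1) X).restrictScalars k)) LinearMap.id
    (Cotw m (Tw (m + 1) X)).d (fun y => ?_) x).trans ?_
  · simp only [LinearMap.add_apply, LinearMap.neg_apply, LinearMap.comp_apply, unitPsi_apply,
      LinearMap.coe_restrictScalars, LinearMap.id_apply, d_cocop, d_cop, map_sub]
    rw [map_smul, cocop_idem, neg_sub, sub_eq_add_neg]
  · rw [LinearMap.id_apply, casimir_add, casimir_neg, casimir_comp_lin, casimir_comp_lin,
      sub_eq_add_neg]

/-- The unit `X ⟶ T'_i T_i X`. -/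
def unitHom : X ⟶ Cotw m (Tw (m + 1) X) :=
  (⟨unitLin m X, fun c x hx => add_mem (coinc_mem m (inc_mem _ hx))
    (casimir_mem m (unitPsi m X) (s := (N, 0)) (fun b y hy => cocop_mem m (cop_mem _
      (X.gr_of_eq hy (by rw [add_assoc]; congr 1; simp)))) rfl hx), fun x => by
    rw [unitLin_apply, unitLin_apply, map_add, d_coinc, d_inc, d_casimir_unitPsi,
      add_assoc, add_sub_cancel]⟩ : Hom X (Cotw m (Tw (m + 1) X)))

/-- The left inverse of the unit `X ⟶ T'_i T_i X`. -/
def unitRetraction : (Cotw m (Tw (m + 1) X)).carrier →ₗ[(Zigzag k n)ᵐᵒᵖ] X.carrier :=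
  codesc m (twSnd (m + 1) X) (-(kap (m + 1) X (coefLoop k (m + 1))))

theorem unitRetraction_coinc (t : (Tw (m + 1) X).carrier) :
    unitRetraction m X (coinc m _ t) = twSnd (m + 1) X t := codesc_coinc m _ _ t

theorem unitRetraction_cocop (t : (Tw (m + 1) X).carrier) :
    unitRetraction m X (cocop m _ t) = -kap (m + 1) X (coefLoop k (m + 1)) t := by
  rw [unitRetraction, codesc_cocop', LinearMap.neg_apply, smul_neg, kap_idem_self, idem_kap]

theorem unitRetraction_unit (x : X.carrier) :
    unitRetraction m X ((unitHom m X).lin x) = x := by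
  change unitRetraction m X (unitLin m X x) = x
  rw [unitLin_apply, map_add, unitRetraction_coinc, twSnd_inc,
    map_casimir m (unitPsi m X) (0 : X.carrier →ₗ[k] X.carrier) LinearMap.id (unitRetraction m X)
      (fun y => by
        rw [unitPsi_apply, unitRetraction_cocop, kap_cop_self, neg_zero, LinearMap.zero_apply]),
    casimir_zero, add_zero]

theorem casimir_kap_inc {Y : DGMod k n N} (φ : X.carrier →ₗ[k] Y.carrier) (x : X.carrier) :
    casimir m (φ.comp (kap (m + 1) X (coefLoop k (m + 1)))) (inc (m + 1) X x) = 0 := by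
  rw [← map_casimir m (0 : X.carrier →ₗ[k] Y.carrier) _ (inc (m + 1) X) LinearMap.id
    (fun y => by rw [LinearMap.comp_apply, kap_inc, map_zero]; rfl), casimir_zero, map_zero]

/-- The critical case is `coinc (cop x)`: the term `inc x` in the differential of `cop x` must be
offset by the loop coefficient of a coevaluation. That is the duality of bases in `casimir_kap_cop`.
-/
theorem unitRetraction_d (hn : 3 ≤ n) (t : (Cotw m (Tw (m + 1) X)).carrier) :
    unitRetraction m X ((Cotw m (Tw (m + 1) X)).d t) = X.d (unitRetraction m X t) := by
  refine cotw_hom_ext m (f := (unitRetraction m X).comp (Cotw m (Tw (m + 1) X)).d)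
    (g := X.d.comp (unitRetraction m X)) (fun t => ?_) (fun t _ => ?_) t
  · rw [LinearMap.comp_apply, LinearMap.comp_apply, d_coinc, map_add, unitRetraction_coinc,
      unitRetraction_coinc, map_casimir m (cocop m (Tw (m + 1) X))
        (-((LinearMap.id (M := X.carrier)).comp (kap (m + 1) X (coefLoop k (m + 1)))))
        LinearMap.id (unitRetraction m X) (fun y => unitRetraction_cocop m X y),
      casimir_neg, LinearMap.id_apply]
    induction t using tw_induction with
    | add s t hs ht =>
      simp only [map_add, neg_add]
      rw [← hs, ← ht]
      abel
    | inc y => rw [casimir_kap_inc, d_inc, twSnd_inc, twSnd_inc, neg_zero, add_zero]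
    | cop r y hy =>
      rw [map_smul (casimir m _), casimir_kap_cop m hn, d_smul, (twSnd (m + 1) X).map_smul,
        (twSnd (m + 1) X).map_smul, twSnd_cop, d_cop, map_sub, twSnd_inc, twSnd_cop, sub_zero,
        LinearMap.id_apply, hy, hy,
        add_neg_cancel, smul_zero, map_zero]
  · rw [LinearMap.comp_apply, LinearMap.comp_apply, d_cocop, map_neg, unitRetraction_cocop,
      unitRetraction_cocop, kap_d, map_neg, neg_neg]

/-- The value of the homotopy on the summand `P_i ⊗ (T_i X)(i)` of `T'_i T_i X`. -/
def unitZeta : (Tw (m + 1) X).carrier →ₗ[k] (Cotw m (Tw (m + 1) X)).carrier :=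
  ((coinc m _).restrictScalars k).comp ((cop (m + 1) X).comp
    (kap (m + 1) X (coefLoop k (m + 1)))) -
  (unitPsi m X).comp ((twSnd (m + 1) X).restrictScalars k)

theorem unitZeta_apply (t : (Tw (m + 1) X).carrier) : unitZeta m X t =
    coinc m _ (cop (m + 1) X (kap (m + 1) X (coefLoop k (m + 1)) t)) -
      unitPsi m X (twSnd (m + 1) X t) := rfl

theorem casimir_unitZeta (t : (Tw (m + 1) X).carrier) : casimir m (unitZeta m X) t =
    casimir m ((((coinc m (Tw (m + 1) X)).restrictScalars k).comp (cop (m + 1) X)).comp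
      (kap (m + 1) X (coefLoop k (m + 1)))) t - casimir m (unitPsi m X) (twSnd (m + 1) X t) := by
  rw [← casimir_comp_lin, sub_eq_add_neg, ← casimir_neg, ← casimir_add, ← sub_eq_add_neg]
  rfl

theorem unitZeta_inc (x : X.carrier) : unitZeta m X (inc (m + 1) X x) = -unitPsi m X x := by
  rw [unitZeta_apply, kap_inc, twSnd_inc, map_zero, map_zero, zero_sub]

theorem unitZeta_cop (x : X.carrier) : unitZeta m X (cop (m + 1) X x) = 0 := by
  rw [unitZeta_apply, kap_cop_self, twSnd_cop, map_zero, map_zero, map_zero, sub_zero]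

theorem unitZeta_loop {x : X.carrier} (hx : op (idem k (m + 1)) • x = x) :
    unitZeta m X (op (loop k (m + 1)) • cop (m + 1) X x) = coinc m _ (cop (m + 1) X x) := by
  rw [unitZeta_apply, kap_loop_cop m hx, map_smul, twSnd_cop, smul_zero, map_zero, sub_zero]

theorem idem_unitPsi (x : X.carrier) : op (idem k (m + 1)) • unitPsi m X x = unitPsi m X x :=
  idem_cocop m _

/-- The homotopy on `T'_i T_i X`. -/
def unitHomotopy : (Cotw m (Tw (m + 1) X)).carrier →ₗ[(Zigzag k n)ᵐᵒᵖ]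
    (Cotw m (Tw (m + 1) X)).carrier :=
  codesc m 0 (unitZeta m X)

theorem unitHomotopy_coinc (t : (Tw (m + 1) X).carrier) :
    unitHomotopy m X (coinc m _ t) = 0 := codesc_coinc m _ _ t

theorem unitHomotopy_cocop (t : (Tw (m + 1) X).carrier) :
    unitHomotopy m X (cocop m _ t) = unitZeta m X t := by
  rw [unitHomotopy, codesc_cocop', unitZeta_apply, unitZeta_apply, kap_idem_self, smul_sub,
    idem_unitPsi, ← map_smul, idem_cop]
  congr 1
  rw [unitPsi_apply, unitPsi_apply, map_smul, cop_idem]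

/-- Up to sign, the homotopy sends `cocop (inc x)` to the idempotent part `cocop (cop x)`, and the
loop part `cocop (cop x · loop)` to `coinc (cop x)`. This cancels the two copies of X(i)⊗P_i against
X(i)⊗(i)R(i)⊗P_i. -/
theorem unit_homotopy (hn : 3 ≤ n) (t : (Cotw m (Tw (m + 1) X)).carrier) :
    t - (unitHom m X).lin (unitRetraction m X t) = (Cotw m (Tw (m + 1) X)).d (unitHomotopy m X t) +
      unitHomotopy m X ((Cotw m (Tw (m + 1) X)).d t) := by
  refine cotw_hom_ext m (f := LinearMap.id - (unitLin m X).comp (unitRetraction m X))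
    (g := (Cotw m (Tw (m + 1) X)).d.comp (unitHomotopy m X) +
      (unitHomotopy m X).comp (Cotw m (Tw (m + 1) X)).d) (fun t => ?_) (fun t ht => ?_) t
  · rw [LinearMap.sub_apply, LinearMap.add_apply, LinearMap.comp_apply, LinearMap.comp_apply,
      LinearMap.comp_apply, unitRetraction_coinc, unitHomotopy_coinc, map_zero, zero_add, d_coinc,
      map_add, unitHomotopy_coinc, zero_add, LinearMap.id_apply,
      map_casimir m (cocop m (Tw (m + 1) X)) (unitZeta m X) LinearMap.id (unitHomotopy m X)
        (unitHomotopy_cocop m X), LinearMap.id_apply]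
    induction t using tw_induction with
    | add s t hs ht =>
      simp only [map_add]
      rw [← hs, ← ht]
      abel
    | inc y =>
      rw [casimir_unitZeta, casimir_kap_inc, twSnd_inc, unitLin_apply]
      abel
    | cop r y hy =>
      rw [map_smul (casimir m _), map_smul (coinc m _), (twSnd (m + 1) X).map_smul, twSnd_cop,
        smul_zero, map_zero, sub_zero, casimir_unitZeta, twSnd_cop, map_zero, sub_zero,
        casimir_kap_cop m hn, hy]
      change _ = op r • op (idem k (m + 1)) • coinc m _ (cop (m + 1) X y)
      rw [← map_smul (coinc m _) (op (idem k (m + 1))), idem_cop]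
  · rw [LinearMap.sub_apply, LinearMap.add_apply, LinearMap.comp_apply, LinearMap.comp_apply,
      LinearMap.comp_apply, unitRetraction_cocop, unitHomotopy_cocop, d_cocop, map_neg, map_neg,
      unitHomotopy_cocop, LinearMap.id_apply, sub_neg_eq_add]
    refine tw_induction_self (m + 1) hn (fun s t hs ht => ?_) (fun y hy => ?_) (fun y hy => ?_)
      (fun y hy => ?_) t ht
    · simp only [map_add, neg_add]
      rw [add_add_add_comm, hs, ht]
      abel
    · rw [kap_inc, map_zero, d_inc, unitZeta_inc, unitZeta_inc, unitPsi_apply, unitPsi_apply,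
        map_neg, d_cocop, d_cop, hy, map_sub]
      abel
    · rw [kap_cop_self, map_zero, unitZeta_cop, map_zero, d_cop, map_sub, unitZeta_cop,
        hy, unitZeta_inc, unitPsi_apply]
      abel
    -- Both coevaluations that occur here are taken at elements of the summand of the vertex i, so
    -- each has only two terms.
    · rw [kap_loop_cop m hy, unitZeta_loop m X hy, d_coinc, d_smul, d_cop, smul_sub, map_sub,
        map_sub (unitZeta m X), unitZeta_loop m X (by rw [← d_smul, hy]), smul_inc,
        unitZeta_inc, unitPsi_apply,
        casimir_of_idem m hn _ (idem_cop (m + 1) y), idem_cocop, hy, unitLin_apply,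
        casimir_of_idem m hn _ hy, idem_unitPsi, unitPsi_apply, unitPsi_apply]
      abel

theorem quasiIso_unitHom (hn : 3 ≤ n) : quasiIso k n N (unitHom m X) :=
  quasiIso_of_retraction _ (unitRetraction m X) (unitHomotopy m X) (unitRetraction_unit m X)
    (unitRetraction_d m X hn) (unit_homotopy m X hn) (map_zero _)

end Unit

end DGMod

namespace DGMod

open MulOpposite Gen

variable {k : Type u} [Field k] {n : ℕ} [NeZero n] {N : ℤ}

/-! ### The quasi-isomorphism X → T_i T'_i X -/

section Unit'

variable (m : ZMod n) (X : DGMod k n N)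

section

variable {X}

theorem cokap_cocop (x : X.carrier) : cokap m X (cocop m X x) = 0 := by
  rw [← idem_cocop, cokap_op_cocop, gen_vertex_mul_self, coefLoop_idem, zero_smul]

theorem cokap_loop_cocop {x : X.carrier} (hx : op (idem k (m + 1)) • x = x) :
    cokap m X (op (loop k (m + 1)) • cocop m X x) = x := by
  rw [cokap_op_cocop, idem_mul_loop, coefLoop_loop, one_smul, hx]

theorem cokap_idem (t : (Cotw m X).carrier) :
    cokap m X (op (idem k (m + 1)) • t) = cokap m X t :=
  kap_idem_self m ((cotwEquiv m X).symm t)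

theorem idem_cokap (t : (Cotw m X).carrier) :
    op (idem k (m + 1)) • cokap m X t = cokap m X t :=
  idem_kap (m + 1) _ ((cotwEquiv m X).symm t)

/-- The coevaluation of y in X(i) has loop coefficient y. Hence `cokap` contracts the projection
`cosnd` on (T'_i X)(i), and this is the datum that extends `cosnd` to T_i T'_i X. -/
theorem cokap_d (hn : 3 ≤ n) (t : (Cotw m X).carrier) (ht : op (idem k (m + 1)) • t = t) :
    cokap m X ((Cotw m X).d t) = cosnd m X t - X.d (cokap m X t) := by
  refine cotw_induction_self m hn (fun s t hs ht => ?_) (fun y hy => ?_) (fun y hy => ?_)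
    (fun y hy => ?_) t ht
  · simp only [map_add, hs, ht]
    abel
  · rw [d_coinc, map_add, cokap_coinc, cokap_coinc, casimir_of_idem m hn _ hy, map_add,
      cokap_loop_cocop m hy, idem_cocop, cokap_cocop, cosnd_coinc, map_zero, sub_zero, zero_add,
      add_zero]
  · rw [d_cocop, map_neg, cokap_cocop, cokap_cocop, cosnd_cocop, map_zero, neg_zero, sub_zero]
  · rw [d_smul, d_cocop, smul_neg, map_neg, cokap_loop_cocop m (by rw [← d_smul, hy]),
      cokap_loop_cocop m hy, map_smul, cosnd_cocop, smul_zero, zero_sub]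

end

/-- The map `x ↦ x (i) ⊗ (i) ⊗ (i)` from `X` to `T_i T'_i X`. -/
def unitPsi' : X.carrier →ₗ[k] (Tw (m + 1) (Cotw m X)).carrier :=
  (cop (m + 1) (Cotw m X)).comp (cocop m X)

theorem unitPsi'_apply (x : X.carrier) :
    unitPsi' m X x = cop (m + 1) (Cotw m X) (cocop m X x) := rfl

theorem idem_unitPsi' (x : X.carrier) : op (idem k (m + 1)) • unitPsi' m X x = unitPsi' m X x :=
  idem_cop (m + 1) _

theorem d_unitPsi' (x : X.carrier) : (Tw (m + 1) (Cotw m X)).d (unitPsi' m X x) =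
    inc (m + 1) _ (cocop m X x) + unitPsi' m X (X.d x) := by
  rw [unitPsi'_apply, d_cop, d_cocop, map_neg, idem_cocop, sub_neg_eq_add, unitPsi'_apply]

/-- The underlying map of the unit `X ⟶ T_i T'_i X`. -/
def unitLin' : X.carrier →ₗ[(Zigzag k n)ᵐᵒᵖ] (Tw (m + 1) (Cotw m X)).carrier :=
  (inc (m + 1) _).comp (coinc m X) - casimir m (unitPsi' m X)

theorem unitLin'_apply (x : X.carrier) :
    unitLin' m X x = inc (m + 1) _ (coinc m X x) - casimir m (unitPsi' m X) x := rfl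

/-- The first term is the coevaluation that appears in the differential of `coinc x`; the minus sign
in `unitLin'` makes the two cancel. -/
theorem d_casimir_unitPsi' (x : X.carrier) :
    (Tw (m + 1) (Cotw m X)).d (casimir m (unitPsi' m X) x) =
      inc (m + 1) _ (casimir m (cocop m X) x) + casimir m (unitPsi' m X) (X.d x) := by
  refine (map_casimir m (unitPsi' m X) (((inc (m + 1) (Cotw m X)).restrictScalars k).comp
    (cocop m X) + (unitPsi' m X).comp (X.d.restrictScalars k)) LinearMap.id
    (Tw (m + 1) (Cotw m X)).d (fun y => d_unitPsi' m X y) x).trans ?_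
  rw [LinearMap.id_apply, casimir_add, casimir_comp_lin, casimir_lin_comp]

/-- The unit `X ⟶ T_i T'_i X`. -/
def unitHom' : X ⟶ Tw (m + 1) (Cotw m X) :=
  (⟨unitLin' m X, fun c x hx => sub_mem (inc_mem _ (coinc_mem m hx))
    (casimir_mem m (unitPsi' m X) (s := (N, 0)) (fun b y hy => cop_mem _ (cocop_mem m
      (X.gr_of_eq hy (by rw [add_assoc]; congr 1; simp)))) rfl hx), fun x => by
    rw [unitLin'_apply, unitLin'_apply, map_sub, d_inc, d_coinc, d_casimir_unitPsi', map_add]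
    abel⟩ : Hom X (Tw (m + 1) (Cotw m X)))

/-- The left inverse of the unit `X ⟶ T_i T'_i X`. -/
def unitRetraction' : (Tw (m + 1) (Cotw m X)).carrier →ₗ[(Zigzag k n)ᵐᵒᵖ] X.carrier :=
  desc (m + 1) (cosnd m X) (cokap m X)

theorem unitRetraction'_inc (t : (Cotw m X).carrier) :
    unitRetraction' m X (inc (m + 1) _ t) = cosnd m X t := desc_inc (m + 1) _ _ t

theorem unitRetraction'_cop (t : (Cotw m X).carrier) :
    unitRetraction' m X (cop (m + 1) _ t) = cokap m X t := by
  rw [unitRetraction', desc_cop', cokap_idem, idem_cokap]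

theorem unitRetraction'_unit (x : X.carrier) :
    unitRetraction' m X ((unitHom' m X).lin x) = x := by
  change unitRetraction' m X (unitLin' m X x) = x
  rw [unitLin'_apply, map_sub, unitRetraction'_inc, cosnd_coinc,
    map_casimir m (unitPsi' m X) (0 : X.carrier →ₗ[k] X.carrier) LinearMap.id
      (unitRetraction' m X) (fun y => by
        rw [unitPsi'_apply, unitRetraction'_cop, cokap_cocop, LinearMap.zero_apply]),
    casimir_zero, sub_zero]

theorem unitRetraction'_d (hn : 3 ≤ n) (t : (Tw (m + 1) (Cotw m X)).carrier) :
    unitRetraction' m X ((Tw (m + 1) (Cotw m X)).d t) = X.d (unitRetraction' m X t) := by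
  refine tw_hom_ext (m + 1) (f := (unitRetraction' m X).comp (Tw (m + 1) (Cotw m X)).d)
    (g := X.d.comp (unitRetraction' m X)) (fun t => ?_) (fun t ht => ?_) t
  · rw [LinearMap.comp_apply, LinearMap.comp_apply, d_inc, unitRetraction'_inc,
      unitRetraction'_inc, cosnd_d]
  · rw [LinearMap.comp_apply, LinearMap.comp_apply, d_cop, map_sub, ht, unitRetraction'_inc,
      unitRetraction'_cop, unitRetraction'_cop, cokap_d m hn t ht, sub_sub_cancel]

/-- The value of the homotopy on `T'_i X`. -/
def unitXi : (Cotw m X).carrier →ₗ[(Zigzag k n)ᵐᵒᵖ] (Tw (m + 1) (Cotw m X)).carrier :=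
  codesc m 0 (unitPsi' m X)

theorem unitXi_coinc (x : X.carrier) : unitXi m X (coinc m X x) = 0 := codesc_coinc m _ _ x

theorem unitXi_cocop (x : X.carrier) : unitXi m X (cocop m X x) = unitPsi' m X x := by
  rw [unitXi, codesc_cocop', idem_unitPsi', unitPsi'_apply, cocop_idem, unitPsi'_apply]

/-- The homotopy on `T_i T'_i X`. -/
def unitHomotopy' : (Tw (m + 1) (Cotw m X)).carrier →ₗ[(Zigzag k n)ᵐᵒᵖ]
    (Tw (m + 1) (Cotw m X)).carrier :=
  desc (m + 1) (unitXi m X)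
    (-(cop (m + 1) (Cotw m X)).comp (((coinc m X).restrictScalars k).comp (cokap m X)))

theorem unitHomotopy'_inc (t : (Cotw m X).carrier) :
    unitHomotopy' m X (inc (m + 1) _ t) = unitXi m X t := desc_inc (m + 1) _ _ t

theorem unitHomotopy'_cop (t : (Cotw m X).carrier) :
    unitHomotopy' m X (cop (m + 1) _ t) = -cop (m + 1) _ (coinc m X (cokap m X t)) := by
  rw [unitHomotopy', desc_cop', LinearMap.neg_apply, smul_neg, LinearMap.comp_apply, idem_cop,
    LinearMap.comp_apply, cokap_idem]
  rfl

/-- Up to sign, the homotopy sends `inc (cocop x)` to the idempotent part `cop (cocop x)`, and the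
loop part `cop (cocop x · loop)` to `cop (coinc x)`. -/
theorem unit_homotopy' (hn : 3 ≤ n) (t : (Tw (m + 1) (Cotw m X)).carrier) :
    t - (unitHom' m X).lin (unitRetraction' m X t) =
      (Tw (m + 1) (Cotw m X)).d (unitHomotopy' m X t) +
        unitHomotopy' m X ((Tw (m + 1) (Cotw m X)).d t) := by
  refine tw_hom_ext (m + 1) (f := LinearMap.id - (unitLin' m X).comp (unitRetraction' m X))
    (g := (Tw (m + 1) (Cotw m X)).d.comp (unitHomotopy' m X) +
      (unitHomotopy' m X).comp (Tw (m + 1) (Cotw m X)).d) (fun t => ?_) (fun t ht => ?_) t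
  · rw [LinearMap.sub_apply, LinearMap.add_apply, LinearMap.comp_apply, LinearMap.comp_apply,
      LinearMap.comp_apply, unitRetraction'_inc, unitHomotopy'_inc, d_inc, unitHomotopy'_inc,
      LinearMap.id_apply]
    induction t using cotw_induction with
    | add s t hs ht =>
      simp only [map_add]
      rw [add_sub_add_comm, hs, ht]
      abel
    | inc y =>
      rw [cosnd_coinc, unitXi_coinc, map_zero, zero_add, d_coinc, map_add, unitXi_coinc, zero_add,
        map_casimir m (cocop m X) (unitPsi' m X) LinearMap.id (unitXi m X) (unitXi_cocop m X),
        LinearMap.id_apply, unitLin'_apply, sub_sub_cancel]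
    | cop r y hy =>
      rw [map_smul (inc _ _), map_smul (cosnd m X), cosnd_cocop, smul_zero, map_zero, sub_zero,
        map_smul (unitXi m X), d_smul, d_smul, map_smul (unitXi m X), d_cocop, map_neg,
        unitXi_cocop, unitXi_cocop, d_unitPsi', ← smul_add, add_neg_cancel_right]
  · rw [LinearMap.sub_apply, LinearMap.add_apply, LinearMap.comp_apply, LinearMap.comp_apply,
      LinearMap.comp_apply, unitRetraction'_cop, unitHomotopy'_cop, d_cop, map_sub, ht,
      unitHomotopy'_inc, unitHomotopy'_cop, LinearMap.id_apply]
    refine cotw_induction_self m hn (fun s t hs ht => ?_) (fun y hy => ?_) (fun y hy => ?_)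
      (fun y hy => ?_) t ht
    · simp only [map_add, neg_add]
      rw [add_sub_add_comm, hs, ht]
      abel
    · rw [cokap_coinc, map_zero, map_zero, map_zero, neg_zero, map_zero, unitXi_coinc,
        cokap_d m hn _ (by rw [← map_smul, hy]), cosnd_coinc, cokap_coinc, map_zero]
      simp
    · rw [cokap_cocop, map_zero, map_zero, map_zero, neg_zero, map_zero, unitXi_cocop,
        d_cocop, map_neg, cokap_cocop, unitPsi'_apply]
      simp
    · rw [cokap_loop_cocop m hy, d_smul, d_cocop, smul_neg, map_neg, map_neg (cokap m X),
        cokap_loop_cocop m (by rw [← d_smul, hy]), map_smul (unitXi m X), unitXi_cocop,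
        d_cop, d_coinc, ← map_smul (coinc m X), hy, unitLin'_apply,
        casimir_of_idem m hn _ hy, idem_unitPsi',
        casimir_of_idem m hn _ hy, idem_cocop, unitPsi'_apply, unitPsi'_apply]
      simp only [map_add, map_neg]
      abel

theorem quasiIso_unitHom' (hn : 3 ≤ n) : quasiIso k n N (unitHom' m X) :=
  quasiIso_of_retraction _ (unitRetraction' m X) (unitHomotopy' m X) (unitRetraction'_unit m X)
    (unitRetraction'_d m X hn) (unit_homotopy' m X hn) (map_zero _)

end Unit'

section Naturality

variable (m : ZMod n) {X Y : DGMod k n N} (f : X ⟶ Y)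

theorem unitHom_naturality :
    f ≫ unitHom m Y = unitHom m X ≫ cotwMap m (twMap (m + 1) f) := by
  apply hom_ext
  intro x
  rw [comp_lin, comp_lin]
  change unitLin m Y (f.lin x) = cotmap m (Hom.lin (twMap (m + 1) f)) (unitLin m X x)
  rw [twMap_lin, unitLin_apply, unitLin_apply, map_add, cotmap_coinc, tmap_inc]
  congr 1
  exact (map_casimir m (unitPsi m X) (unitPsi m Y) f.lin (cotmap m (tmap (m + 1) 1 f.lin))
    (fun y => by rw [unitPsi_apply, cotmap_cocop, tmap_cop, one_smul, unitPsi_apply]) x).symm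

theorem unitHom'_naturality :
    f ≫ unitHom' m Y = unitHom' m X ≫ twMap (m + 1) (cotwMap m f) := by
  apply hom_ext
  intro x
  rw [comp_lin, comp_lin, twMap_lin, cotwMap_lin]
  change unitLin' m Y (f.lin x) = tmap (m + 1) 1 (cotmap m f.lin) (unitLin' m X x)
  rw [unitLin'_apply, unitLin'_apply, map_sub, tmap_inc, cotmap_coinc]
  congr 1
  exact (map_casimir m (unitPsi' m X) (unitPsi' m Y) f.lin (tmap (m + 1) 1 (cotmap m f.lin))
    (fun y => by rw [unitPsi'_apply, tmap_cop, one_smul, cotmap_cocop, unitPsi'_apply]) x).symm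

end Naturality

end DGMod

/-! ### The twists are equivalences of the derived category -/

section Equivalence

open DGMod

variable {k : Type u} [Field k] {n : ℕ} [NeZero n] {N : ℤ}

/-- The composite of two functors on `D(R_n-mod)` is induced by the composite of the functors on
dg modules that induce them. -/
def compInducedIso {F F' : DGMod k n N ⥤ DGMod k n N} {G G' : DerivedCat k n N ⥤ DerivedCat k n N}
    (e : F ⋙ toDerived k n N ≅ toDerived k n N ⋙ G)
    (e' : F' ⋙ toDerived k n N ≅ toDerived k n N ⋙ G') :
    (F ⋙ F') ⋙ toDerived k n N ≅ toDerived k n N ⋙ G ⋙ G' :=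
  Functor.associator _ _ _ ≪≫ Functor.isoWhiskerLeft F e' ≪≫
    (Functor.associator _ _ _).symm ≪≫ Functor.isoWhiskerRight e G' ≪≫ Functor.associator _ _ _

/-- `T'_i` as a morphism of localizers. -/
def cotwistLocalizer (k : Type u) [Field k] {n : ℕ} [NeZero n] (N : ℤ) (m : ZMod n) :
    LocalizerMorphism (quasiIso k n N) (quasiIso k n N) where
  functor := cotwistFunctor k N m
  map _ _ f hf := quasiIso_cotwMap m f hf

/-- The unit `Id ⟶ T'_i T_i`. -/
def unitTrans (m : ZMod n) :
    𝟭 (DGMod k n N) ⟶ twistFunctor k N (m + 1) ⋙ cotwistFunctor k N m where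
  app X := unitHom m X
  naturality _ _ f := unitHom_naturality m f

/-- The unit `Id ⟶ T_i T'_i`. -/
def unitTrans' (m : ZMod n) :
    𝟭 (DGMod k n N) ⟶ cotwistFunctor k N m ⋙ twistFunctor k N (m + 1) where
  app X := unitHom' m X
  naturality _ _ f := unitHom'_naturality m f

/-- The two units are natural quasi-isomorphisms, so they become isomorphisms Id ≅ T'_i T_i and Id ≅
T_i T'_i. No compatibility of T'_i with the shifts is needed for this, and no triangle identity has
to be checked. -/
theorem isEquivalence_T (hn : 3 ≤ n) (N : ℤ) (i : ZMod n) : (T k N i).IsEquivalence := by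
  -- The arrows that end at m + 1 are `up m` and `down (m + 1)`, so this form avoids subtraction
  -- among the vertices.
  obtain ⟨m, rfl⟩ : ∃ m, i = m + 1 := ⟨i - 1, (sub_add_cancel i 1).symm⟩
  let T' := (cotwistLocalizer k N m).localizedFunctor (toDerived k n N) (toDerived k n N)
  let e : twistFunctor k N (m + 1) ⋙ toDerived k n N ≅ toDerived k n N ⋙ T k N (m + 1) :=
    CatCommSq.iso (twistLocalizer k N (m + 1)).functor _ _ _
  let e' : cotwistFunctor k N m ⋙ toDerived k n N ≅ toDerived k n N ⋙ T' :=
    CatCommSq.iso (cotwistLocalizer k N m).functor _ _ _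
  let e₀ : 𝟭 (DGMod k n N) ⋙ toDerived k n N ≅ toDerived k n N ⋙ 𝟭 _ :=
    Functor.leftUnitor _ ≪≫ (Functor.rightUnitor _).symm
  exact (CategoryTheory.Equivalence.mk (T k N (m + 1)) T'
    (isoOfQuasiIso e₀ (compInducedIso e e') (unitTrans m) fun X => quasiIso_unitHom m X hn)
    (isoOfQuasiIso e₀ (compInducedIso e' e) (unitTrans' m)
      fun X => quasiIso_unitHom' m X hn).symm).isEquivalence_functor

end Equivalence

/-! ### Exactness from the preservation of mapping cones -/

namespace DGMod

open MulOpposite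

variable {k : Type u} [Field k] {n : ℕ} [NeZero n] {N : ℤ}

theorem quasiIso_of_bijective {X Y : DGMod k n N} (f : X ⟶ Y)
    (hf : Function.Bijective (Hom.lin f)) : quasiIso k n N f := by
  rw [quasiIso_iff]
  refine ⟨?_, fun y hy => ?_⟩
  · rintro x - ⟨y, hy⟩
    obtain ⟨z, rfl⟩ := hf.2 y
    refine ⟨z, hf.1 ?_⟩
    have h : Hom.lin f x = Y.d (Hom.lin f z) := hy
    rw [h, ← f.comm]
    rfl
  · obtain ⟨x, rfl⟩ := hf.2 y
    refine ⟨x, hf.1 ?_, 0, ?_⟩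
    · have h : Y.d (Hom.lin f x) = 0 := hy
      rw [map_zero, ← h]
      exact f.comm x
    · rw [map_zero, add_zero]
      rfl

/-- The functor `F` on dg modules preserves mapping cones, compatibly with the standard
triangles. -/
def PreservesCones (F : DGMod k n N ⥤ DGMod k n N) [F.CommShift ℤ] : Prop :=
  ∀ ⦃X Y : DGMod k n N⦄ (f : X ⟶ Y), ∃ θ : F.obj (cone f) ⟶ cone (F.map f), quasiIso k n N θ ∧
    F.map (coneTriangle f).mor₂ ≫ θ = (coneTriangle (F.map f)).mor₂ ∧
    F.map (coneTriangle f).mor₃ ≫ (F.commShiftIso (1 : ℤ)).hom.app X =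
      θ ≫ (coneTriangle (F.map f)).mor₃

/-- The map of triangles is the identity on the first two objects and the comparison `θ` on the
third; localization inverts `θ`. -/
theorem PreservesCones.triangleIso {F : DGMod k n N ⥤ DGMod k n N} [F.CommShift ℤ]
    (hF : PreservesCones F) {X Y : DGMod k n N} (f : X ⟶ Y) :
    Nonempty ((toDerived k n N).mapTriangle.obj (F.mapTriangle.obj (coneTriangle f)) ≅
      (toDerived k n N).mapTriangle.obj (coneTriangle (F.map f))) := by
  obtain ⟨θ, hθ, h2, h3⟩ := hF f
  let φ : F.mapTriangle.obj (coneTriangle f) ⟶ coneTriangle (F.map f) :=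
    { hom₁ := 𝟙 _
      hom₂ := 𝟙 _
      hom₃ := θ
      comm₁ := (Category.comp_id _).trans (Category.id_comp _).symm
      comm₂ := h2.trans (Category.id_comp _).symm
      comm₃ := by
        refine Eq.trans ?_ h3
        refine (congrArg (_ ≫ ·) (CategoryTheory.Functor.map_id _ (F.obj X))).trans ?_
        exact Category.comp_id (F.map (coneTriangle f).mor₃ ≫
          (F.commShiftIso (1 : ℤ)).hom.app X) }
  have h1 : IsIso ((toDerived k n N).mapTriangle.map φ).hom₁ :=
    inferInstanceAs (IsIso ((toDerived k n N).map (𝟙 (F.obj X))))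
  have h2 : IsIso ((toDerived k n N).mapTriangle.map φ).hom₂ :=
    inferInstanceAs (IsIso ((toDerived k n N).map (𝟙 (F.obj Y))))
  have h3 : IsIso ((toDerived k n N).mapTriangle.map φ).hom₃ :=
    Localization.inverts (toDerived k n N) (quasiIso k n N) _ hθ
  have := Pretriangulated.Triangle.isIso_of_isIsos _ h1 h2 h3
  exact ⟨asIso ((toDerived k n N).mapTriangle.map φ)⟩

end DGMod

open DGMod

variable {k : Type u} [Field k] {n : ℕ} [NeZero n] {N : ℤ}

/-- Every distinguished triangle comes from a standard one. There the square inducing `G`, being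
compatible with [1], moves `G` past the localization functor, and `triangleIso` ends with the cone
of `F.map f`. -/
theorem IsInducedBy.mapTriangle_mem {F : DGMod k n N ⥤ DGMod k n N}
    {G : DerivedCat k n N ⥤ DerivedCat k n N} [F.CommShift ℤ] [F.CommShift Second]
    [G.CommShift ℤ] [G.CommShift Second] (h : IsInducedBy G F) (hF : PreservesCones F) :
    ∀ t ∈ distTriangles k n N, G.mapTriangle.obj t ∈ distTriangles k n N := by
  rintro t ⟨X, Y, f, ⟨e⟩⟩
  obtain ⟨i, hi, -⟩ := h
  obtain ⟨e'⟩ := hF.triangleIso f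
  exact ⟨_, _, F.map f, ⟨G.mapTriangle.mapIso e ≪≫
    ((Functor.mapTriangleCompIso (toDerived k n N) G).symm.app (coneTriangle f)) ≪≫
    ((Functor.mapTriangleIso i).symm.app (coneTriangle f)) ≪≫
    ((Functor.mapTriangleCompIso F (toDerived k n N)).app (coneTriangle f)) ≪≫ e'⟩⟩

namespace DGMod

open MulOpposite

/-! ### Twists of mapping cones -/

section Twist

variable (i : ZMod n) {X Y : DGMod k n N} (f : X ⟶ Y)

/-- The inclusion of the first summand of a mapping cone. -/
def coneInl : X.carrier →ₗ[(Zigzag k n)ᵐᵒᵖ] (cone f).carrier :=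
  LinearMap.inl (Zigzag k n)ᵐᵒᵖ X.carrier Y.carrier

/-- The inclusion of the second summand of a mapping cone. -/
def coneInr : Y.carrier →ₗ[(Zigzag k n)ᵐᵒᵖ] (cone f).carrier :=
  LinearMap.inr (Zigzag k n)ᵐᵒᵖ X.carrier Y.carrier

/-- The projection to the first summand of a mapping cone. -/
def coneFst : (cone f).carrier →ₗ[(Zigzag k n)ᵐᵒᵖ] X.carrier :=
  LinearMap.fst (Zigzag k n)ᵐᵒᵖ X.carrier Y.carrier

theorem incHom_naturality : f ≫ incHom i Y = incHom i X ≫ twMap i f := by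
  refine hom_ext _ _ fun x => ?_
  rw [comp_lin, comp_lin, twMap_lin]
  exact (tmap_inc i 1 f.lin x).symm

/-- The map `((x, y) ⊗ p, (x', y')) ↦ ((-x ⊗ p, x'), (y ⊗ p, y'))`. -/
def twistConeContraction : (cone f).carrier →ₗ[k] (cone (twMap i f)).carrier :=
  (-(cop i X)).prodMap (cop i Y)

/-- The isomorphism between the twist of a mapping cone and the mapping cone of the twist. -/
def twistConeHom : Tw i (cone f) ⟶ cone (twMap i f) :=
  descHom i (coneMap (incHom i X) (incHom i Y) (incHom_naturality i f))
    (twistConeContraction i f)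
    (fun b z hz _ => ⟨neg_mem (cop_mem i hz.1), cop_mem i hz.2⟩)
    (by
      rintro ⟨x, y⟩ h
      have hx : op (idem k i) • x = x := congrArg Prod.fst h
      have hy : op (idem k i) • y = y := congrArg Prod.snd h
      refine Prod.ext ?_ ?_
      · change -(Tw i X).d (-(cop i X x)) + -(cop i X (-(X.d x))) = inc i X x
        rw [map_neg, map_neg, neg_neg, neg_neg, d_cop, hx, sub_add_cancel]
      · change (Hom.lin (twMap i f) (-(cop i X x)) + (Tw i Y).d (cop i Y y)) +
          cop i Y (f.lin x + Y.d y) = inc i Y y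
        rw [map_neg, twMap_lin, tmap_cop, one_smul, d_cop, hy, map_add]
        abel)

theorem twistConeHom_inc (z : (cone f).carrier) :
    Hom.lin (twistConeHom i f) (inc i (cone f) z) = (inc i X z.1, inc i Y z.2) :=
  desc_inc i _ _ z

theorem twistConeHom_cop (z : (cone f).carrier) :
    Hom.lin (twistConeHom i f) (cop i (cone f) z) = (-cop i X z.1, cop i Y z.2) := by
  refine (desc_cop' i _ _ z).trans (Prod.ext ?_ ?_)
  · change op (idem k i) • -(cop i X (op (idem k i) • z.1)) = _
    rw [cop_idem, smul_neg, idem_cop]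
  · change op (idem k i) • (cop i Y (op (idem k i) • z.2)) = _
    rw [cop_idem, idem_cop]

/-- The inverse of `twistConeHom`. -/
def twistConeInv : (Tw i X).carrier × (Tw i Y).carrier →ₗ[(Zigzag k n)ᵐᵒᵖ]
    (Tw i (cone f)).carrier :=
  (tmap i (-1) (coneInl f)).coprod (tmap i 1 (coneInr f))

/-- The factor -1 cancels the sign of `twistConeContraction` on the first summand of the cone. -/
theorem twistConeHom_inl (t : (Tw i X).carrier) :
    Hom.lin (twistConeHom i f) (tmap i (-1) (coneInl f) t) = (t, 0) := by
  refine tw_hom_ext (W := cone (twMap i f)) i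
    (f := (Hom.lin (twistConeHom i f)).comp (tmap i (-1) (coneInl f)))
    (g := coneInl (twMap i f)) (fun x => ?_) (fun x _ => ?_) t
  · rw [LinearMap.comp_apply, tmap_inc, twistConeHom_inc]
    exact Prod.ext rfl (map_zero (inc i Y))
  · rw [LinearMap.comp_apply, tmap_cop, map_zsmul, twistConeHom_cop, neg_one_smul]
    exact Prod.ext (neg_neg (cop i X x)) (neg_eq_zero.2 (map_zero (cop i Y)))

theorem twistConeHom_inr (t : (Tw i Y).carrier) :
    Hom.lin (twistConeHom i f) (tmap i 1 (coneInr f) t) = (0, t) := by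
  refine tw_hom_ext (W := cone (twMap i f)) i
    (f := (Hom.lin (twistConeHom i f)).comp (tmap i 1 (coneInr f)))
    (g := coneInr (twMap i f)) (fun x => ?_) (fun x _ => ?_) t
  · rw [LinearMap.comp_apply, tmap_inc, twistConeHom_inc]
    exact Prod.ext (map_zero (inc i X)) rfl
  · rw [LinearMap.comp_apply, tmap_cop, map_zsmul, twistConeHom_cop, one_smul]
    exact Prod.ext (neg_eq_zero.2 (map_zero (cop i X))) rfl

theorem twistConeInv_hom (t : (Tw i (cone f)).carrier) :
    twistConeInv i f (Hom.lin (twistConeHom i f) t) = t := by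
  refine tw_hom_ext (W := Tw i (cone f)) i
    (f := (twistConeInv i f).comp (Hom.lin (twistConeHom i f))) (g := LinearMap.id)
    (fun x => ?_) (fun x _ => ?_) t
  · rw [LinearMap.comp_apply, twistConeHom_inc, twistConeInv, LinearMap.coprod_apply, tmap_inc,
      tmap_inc, ← map_add]
    exact congrArg (inc i (cone f)) (Prod.ext (add_zero x.1) (zero_add x.2))
  · rw [LinearMap.comp_apply, twistConeHom_cop, twistConeInv, LinearMap.coprod_apply, map_neg,
      tmap_cop, tmap_cop, neg_one_smul, neg_neg, one_smul, ← map_add]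
    exact congrArg (cop i (cone f)) (Prod.ext (add_zero x.1) (zero_add x.2))

theorem twistConeHom_inv (t : (Tw i X).carrier × (Tw i Y).carrier) :
    Hom.lin (twistConeHom i f) (twistConeInv i f t) = t := by
  rw [twistConeInv, LinearMap.coprod_apply, map_add, twistConeHom_inl, twistConeHom_inr]
  exact Prod.ext (add_zero t.1) (zero_add t.2)

/-- The factor -1 is the sign in the commutation of T_i with [1]; it makes the comparison respect
the third map of the standard triangle. -/
theorem coneFst_twistConeHom (t : (Tw i (cone f)).carrier) :
    coneFst (twMap i f) (Hom.lin (twistConeHom i f) t) = tmap i (-1) (coneFst f) t := by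
  refine tw_hom_ext (W := Tw i X) i
    (f := (coneFst (twMap i f)).comp (Hom.lin (twistConeHom i f))) (fun z => ?_) (fun z _ => ?_) t
  · rw [tmap_inc, LinearMap.comp_apply, twistConeHom_inc]
    rfl
  · rw [tmap_cop, LinearMap.comp_apply, twistConeHom_cop]
    exact (neg_one_smul ℤ (cop i X z.1)).symm

theorem preservesCones_twistFunctor : PreservesCones (twistFunctor k N i) := by
  intro X Y f
  refine ⟨twistConeHom i f, quasiIso_of_bijective _ (Function.bijective_iff_has_inverse.2
    ⟨twistConeInv i f, twistConeInv_hom i f, twistConeHom_inv i f⟩), hom_ext _ _ fun t => ?_,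
    hom_ext _ _ fun t => ?_⟩
  · exact (congrArg (Hom.lin (twistConeHom i f)) (twistFunctor_map_lin i _ t)).trans
      (twistConeHom_inr i f t)
  · refine Eq.trans ?_ (coneFst_twistConeHom i f t).symm
    refine (unshift_twistShift₁ i (firstHom 1) X _).trans ?_
    refine (congrArg _ (twistFunctor_map_lin i _ t)).trans ?_
    exact tmap_tmap i (-1) 1 (X := cone f) (unshift (firstHom 1) X) (coneFst f) t

end Twist

/-! ### Rotations of mapping cones -/

section Rot

variable (a : ZMod n) (s : ZMod n → Bideg)
  (hs : ∀ i, s i + Gen.deg N (Gen.up i) = Gen.deg N (Gen.up (i + a)) + s (i + 1))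
  {X Y : DGMod k n N} (f : X ⟶ Y)

/-- The rotation of a mapping cone. -/
def RotCone : DGMod k n N := rotObj a s hs (cone f)

/-- The mapping cone of a rotation. -/
def ConeRot : DGMod k n N := cone ((rotFunctor k N a s hs).map f)

/-- The identity map from the rotation of a mapping cone to the mapping cone of the rotation. -/
def rotConeLin : (RotCone a s hs f).carrier →ₗ[(Zigzag k n)ᵐᵒᵖ] (ConeRot a s hs f).carrier where
  toFun z := z
  map_add' _ _ := rfl
  map_smul' _ _ := rfl

theorem rotConeLin_mem (c : Bideg) (z : (RotCone a s hs f).carrier)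
    (hz : z ∈ (RotCone a s hs f).gr c) : rotConeLin a s hs f z ∈ (ConeRot a s hs f).gr c := by
  have hz := (mem_regrade (cone f) s c z).1 hz
  refine ⟨(X.mem_regrade s (c + (1, 0)) _).2 fun i => ?_, (Y.mem_regrade s c _).2 fun i => ?_⟩
  · rw [add_right_comm]
    exact (hz i).1
  · exact (hz i).2

/-- The isomorphism between the rotation of a mapping cone and the mapping cone of the
rotation. -/
def rotConeHom :
    (rotFunctor k N a s hs).obj (cone f) ⟶ cone ((rotFunctor k N a s hs).map f) :=
  (⟨rotConeLin a s hs f, rotConeLin_mem a s hs f, fun _ => rfl⟩ :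
    Hom (RotCone a s hs f) (ConeRot a s hs f))

theorem bijective_rotConeHom : Function.Bijective (Hom.lin (rotConeHom a s hs f)) :=
  ⟨fun _ _ h => h, fun y => ⟨y, rfl⟩⟩

theorem preservesCones_rhoFunctor : PreservesCones (rhoFunctor k n N) := fun _ _ f =>
  ⟨rotConeHom _ _ _ f, quasiIso_of_bijective _ (bijective_rotConeHom _ _ _ f), rfl, rfl⟩

theorem preservesCones_rhoFunctor' : PreservesCones (rhoFunctor' k n N) := fun _ _ f =>
  ⟨rotConeHom _ _ _ f, quasiIso_of_bijective _ (bijective_rotConeHom _ _ _ f), rfl, rfl⟩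

end Rot

end DGMod

/-! ### Inverse rotations and the composites of F_ρ and F'_ρ -/

section Algebra

variable {k : Type u} [Field k] {n : ℕ} [NeZero n]

theorem rotHom_idem (a i : ZMod n) : rotHom k a (idem k i) = idem k (i + a) :=
  rotHom_gen k a (Gen.vertex i)

theorem rotHom_rotHom {a b : ZMod n} (h : a + b = 0) (r : Zigzag k n) :
    rotHom k a (rotHom k b r) = r := by
  refine Submodule.span_induction (p := fun r _ => rotHom k a (rotHom k b r) = r) ?_ (by simp)
    (fun x y _ _ hx hy => by rw [map_add, map_add, hx, hy])
    (fun c x _ hx => by rw [map_smul, map_smul, hx]) (mem_span_words k r)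
  rintro x ⟨w, rfl⟩
  induction w with
  | nil => simp
  | cons g w ih =>
    simp only [List.map_cons, List.prod_cons, map_mul, ih, rotHom_gen]
    congr 2
    cases g <;> simp [Gen.rot, add_assoc, add_comm b a, h]

end Algebra

namespace DGMod

open MulOpposite

variable {k : Type u} [Field k] {n : ℕ} [NeZero n] {N : ℤ}

theorem mem_of_idem_smul_mem (X : DGMod k n N) {c : Bideg} {x : X.carrier}
    (h : ∀ i : ZMod n, op (idem k i) • x ∈ X.gr c) : x ∈ X.gr c := by
  rw [← X.sum_actK_idem x]
  exact sum_mem fun i _ => h i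

section

variable (a b : ZMod n) (s t : ZMod n → Bideg)
  (hs : ∀ i, s i + Gen.deg N (Gen.up i) = Gen.deg N (Gen.up (i + a)) + s (i + 1))
  (ht : ∀ i, t i + Gen.deg N (Gen.up i) = Gen.deg N (Gen.up (i + b)) + t (i + 1))
  (X : DGMod k n N)

/-- The rotation of `X`. -/
def Rot : DGMod k n N := rotObj a s hs X

/-- The identity map from `X` to its rotation. -/
def toRot : X.carrier ≃ₗ[k] (Rot a s hs X).carrier := LinearEquiv.refl k X.carrier

variable {X}

theorem op_smul_toRot (r : Zigzag k n) (x : X.carrier) :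
    op r • toRot a s hs X x = toRot a s hs X (op (rotHom k (-a) r) • x) := rfl

theorem d_toRot (x : X.carrier) : (Rot a s hs X).d (toRot a s hs X x) = toRot a s hs X (X.d x) :=
  rfl

theorem toRot_mem_iff (c : Bideg) (x : X.carrier) : toRot a s hs X x ∈ (Rot a s hs X).gr c ↔
    ∀ i, op (idem k i) • x ∈ X.gr (c + s i) := X.mem_regrade s c x

variable (hab : a + b = 0) (X)

/-- The identity map from a rotation of the inverse rotation of `X` to `X`. -/
def rotRotLin : (Rot a s hs (Rot b t ht X)).carrier →ₗ[(Zigzag k n)ᵐᵒᵖ] X.carrier where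
  toFun x := (toRot b t ht X).symm ((toRot a s hs (Rot b t ht X)).symm x)
  map_add' _ _ := by simp only [map_add]
  map_smul' r x := by
    obtain ⟨x, rfl⟩ := (toRot a s hs (Rot b t ht X)).surjective x
    obtain ⟨x, rfl⟩ := (toRot b t ht X).surjective x
    rw [← op_unop r, op_smul_toRot, op_smul_toRot, rotHom_rotHom
      (by rw [← neg_add, add_comm, hab, neg_zero])]
    simp only [LinearEquiv.symm_apply_apply, RingHom.id_apply]

theorem rotRotLin_mem (hst : ∀ i, s (i + b) + t i = 0) (c : Bideg)
    (x : (Rot a s hs (Rot b t ht X)).carrier)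
    (hx : x ∈ (Rot a s hs (Rot b t ht X)).gr c) : rotRotLin a b s t hs ht X hab x ∈ X.gr c := by
  obtain ⟨x, rfl⟩ := (toRot a s hs (Rot b t ht X)).surjective x
  obtain ⟨x, rfl⟩ := (toRot b t ht X).surjective x
  rw [toRot_mem_iff] at hx
  refine X.mem_of_idem_smul_mem fun i => ?_
  -- The inner rotation moves the summand of the vertex i to the vertex i + b, and there the two
  -- shifts s (i + b) and t i add up to zero.
  have h := hx (i + b)
  rw [op_smul_toRot, toRot_mem_iff, rotHom_idem, add_neg_cancel_right] at h
  have h := h i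
  rw [op_smul_op_smul, gen_vertex_mul_self, add_assoc, hst, add_zero] at h
  exact h

/-- A rotation of the inverse rotation of `X` is isomorphic to `X`. -/
def rotRotHom (hst : ∀ i, s (i + b) + t i = 0) : Rot a s hs (Rot b t ht X) ⟶ X :=
  (⟨rotRotLin a b s t hs ht X hab, rotRotLin_mem a b s t hs ht X hab hst, fun _ => rfl⟩ :
    Hom (Rot a s hs (Rot b t ht X)) X)

theorem quasiIso_rotRotHom (hst : ∀ i, s (i + b) + t i = 0) :
    quasiIso k n N (rotRotHom a b s t hs ht X hab hst) :=
  quasiIso_of_bijective _ ⟨fun _ _ h => h, fun y => ⟨y, rfl⟩⟩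

end

theorem rotRot_naturality (a b : ZMod n) (s t : ZMod n → Bideg)
    (hs : ∀ i, s i + Gen.deg N (Gen.up i) = Gen.deg N (Gen.up (i + a)) + s (i + 1))
    (ht : ∀ i, t i + Gen.deg N (Gen.up i) = Gen.deg N (Gen.up (i + b)) + t (i + 1))
    (hab : a + b = 0) (hst : ∀ i, s (i + b) + t i = 0) {X Y : DGMod k n N} (f : X ⟶ Y) :
    (rotFunctor k N b t ht ⋙ rotFunctor k N a s hs).map f ≫
      rotRotHom a b s t hs ht Y hab hst = rotRotHom a b s t hs ht X hab hst ≫ f :=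
  hom_ext _ _ fun _ => rfl

/-- A rotation of the inverse rotation is isomorphic to the identity. -/
def rotRotTrans (a b : ZMod n) (s t : ZMod n → Bideg)
    (hs : ∀ i, s i + Gen.deg N (Gen.up i) = Gen.deg N (Gen.up (i + a)) + s (i + 1))
    (ht : ∀ i, t i + Gen.deg N (Gen.up i) = Gen.deg N (Gen.up (i + b)) + t (i + 1))
    (hab : a + b = 0) (hst : ∀ i, s (i + b) + t i = 0) :
    rotFunctor k N b t ht ⋙ rotFunctor k N a s hs ⟶ 𝟭 (DGMod k n N) where
  app X := rotRotHom a b s t hs ht X hab hst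
  naturality _ _ f := rotRot_naturality a b s t hs ht hab hst f

theorem quasiIso_rotRotTrans (a b : ZMod n) (s t : ZMod n → Bideg)
    (hs : ∀ i, s i + Gen.deg N (Gen.up i) = Gen.deg N (Gen.up (i + a)) + s (i + 1))
    (ht : ∀ i, t i + Gen.deg N (Gen.up i) = Gen.deg N (Gen.up (i + b)) + t (i + 1))
    (hab : a + b = 0) (hst : ∀ i, s (i + b) + t i = 0) (X : DGMod k n N) :
    quasiIso k n N ((rotRotTrans a b s t hs ht hab hst).app X) :=
  quasiIso_rotRotHom a b s t hs ht X hab hst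

variable (k n N)

/-- The isomorphism `F_ρ F'_ρ ≅ Id`. -/
def rhoRhoTrans' : rhoFunctor' k n N ⋙ rhoFunctor k n N ⟶ 𝟭 (DGMod k n N) :=
  rotRotTrans 1 (-1) (rhoShift n N) (fun i => -rhoShift n N (i - 1)) _ _ (add_neg_cancel 1)
    (fun i => by rw [sub_eq_add_neg i 1, add_neg_cancel])

/-- The isomorphism `F'_ρ F_ρ ≅ Id`. -/
def rhoRhoTrans : rhoFunctor k n N ⋙ rhoFunctor' k n N ⟶ 𝟭 (DGMod k n N) :=
  rotRotTrans (-1) 1 (fun i => -rhoShift n N (i - 1)) (rhoShift n N) _ _ (neg_add_cancel 1)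
    (fun i => by rw [add_sub_cancel_right, neg_add_cancel])

instance : NatTrans.CommShift (rhoRhoTrans k n N) ℤ := ⟨fun a => by
  refine NatTrans.ext (funext fun X => ?_)
  rw [NatTrans.comp_app, NatTrans.comp_app, Functor.commShiftIso_comp_hom_app,
    Functor.commShiftIso_id_hom_app]
  exact hom_ext _ _ fun t => rfl⟩

instance : NatTrans.CommShift (rhoRhoTrans k n N) Second := ⟨fun a => by
  refine NatTrans.ext (funext fun X => ?_)
  rw [NatTrans.comp_app, NatTrans.comp_app, Functor.commShiftIso_comp_hom_app,
    Functor.commShiftIso_id_hom_app]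
  exact hom_ext _ _ fun t => rfl⟩

instance : NatTrans.CommShift (rhoRhoTrans' k n N) ℤ := ⟨fun a => by
  refine NatTrans.ext (funext fun X => ?_)
  rw [NatTrans.comp_app, NatTrans.comp_app, Functor.commShiftIso_comp_hom_app,
    Functor.commShiftIso_id_hom_app]
  exact hom_ext _ _ fun t => rfl⟩

instance : NatTrans.CommShift (rhoRhoTrans' k n N) Second := ⟨fun a => by
  refine NatTrans.ext (funext fun X => ?_)
  rw [NatTrans.comp_app, NatTrans.comp_app, Functor.commShiftIso_comp_hom_app,
    Functor.commShiftIso_id_hom_app]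
  exact hom_ext _ _ fun t => rfl⟩

end DGMod

open DGMod

variable (k : Type u) [Field k] (n : ℕ) [NeZero n] (N : ℤ)

theorem gradedIso_Frho_Frho' : GradedIso (Frho' k n N ⋙ Frho k n N) (𝟭 _) :=
  (isInducedBy_Frho'.comp isInducedBy_Frho).gradedIso isInducedBy_id (rhoRhoTrans' k n N)
    (quasiIso_rotRotTrans _ _ _ _ _ _ _ _)

theorem gradedIso_Frho'_Frho : GradedIso (Frho k n N ⋙ Frho' k n N) (𝟭 _) :=
  (isInducedBy_Frho.comp isInducedBy_Frho').gradedIso isInducedBy_id (rhoRhoTrans k n N)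
    (quasiIso_rotRotTrans _ _ _ _ _ _ _ _)

theorem isEquivalence_Frho : (Frho k n N).IsEquivalence := by
  obtain ⟨e, -⟩ := gradedIso_Frho_Frho' k n N
  obtain ⟨e', -⟩ := gradedIso_Frho'_Frho k n N
  exact (CategoryTheory.Equivalence.mk (Frho k n N) (Frho' k n N) e'.symm e).isEquivalence_functor

theorem isEquivalence_Frho' : (Frho' k n N).IsEquivalence := by
  obtain ⟨e, -⟩ := gradedIso_Frho_Frho' k n N
  obtain ⟨e', -⟩ := gradedIso_Frho'_Frho k n N
  exact (CategoryTheory.Equivalence.mk (Frho' k n N) (Frho k n N) e.symm e').isEquivalence_functor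

namespace DGMod

open MulOpposite

variable {k : Type u} [Field k] {n : ℕ} [NeZero n] {N : ℤ}

/-! ### Conjugation of a twist by a rotation -/

section Conj

variable (a : ZMod n) (s t : ZMod n → Bideg)
  (hs : ∀ i, s i + Gen.deg N (Gen.up i) = Gen.deg N (Gen.up (i + a)) + s (i + 1))
  (ht : ∀ i, t i + Gen.deg N (Gen.up i) = Gen.deg N (Gen.up (i + -a)) + t (i + 1))

section

variable {X Y : DGMod k n N}

theorem idem_smul_toRot (j : ZMod n) (x : X.carrier) :
    op (idem k j) • toRot a s hs X x = toRot a s hs X (op (idem k (j + -a)) • x) := by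
  rw [op_smul_toRot, rotHom_idem]

theorem op_smul_toRot_neg (r : Zigzag k n) (x : X.carrier) :
    op r • toRot (-a) t ht X x = toRot (-a) t ht X (op (rotHom k a r) • x) := by
  rw [op_smul_toRot, neg_neg]

theorem idem_smul_toRot_neg (j : ZMod n) (x : X.carrier) :
    op (idem k j) • toRot (-a) t ht X x = toRot (-a) t ht X (op (idem k (j + a)) • x) := by
  rw [op_smul_toRot_neg, rotHom_idem]

/-- An element of a single summand X(j) sees only the shift `s j`, so the conditions at the other
vertices are void. -/
theorem toRot_mem {j : ZMod n} {c : Bideg} {x : X.carrier} (hx : op (idem k j) • x = x)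
    (h : x ∈ X.gr (c + s j)) : toRot a s hs X x ∈ (Rot a s hs X).gr c := by
  rw [toRot_mem_iff]
  intro i
  rw [← hx, op_smul_op_smul]
  by_cases hij : j = i
  · rw [hij, gen_vertex_mul_self, ← hij, hx]
    exact h
  · rw [gen_vertex_mul_vertex k j i hij, op_zero, zero_smul]
    exact zero_mem _

/-- The functoriality of a rotation, for maps of modules. -/
def rotLin (g : X.carrier →ₗ[(Zigzag k n)ᵐᵒᵖ] Y.carrier) :
    (Rot a s hs X).carrier →ₗ[(Zigzag k n)ᵐᵒᵖ] (Rot a s hs Y).carrier where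
  toFun x := toRot a s hs Y (g ((toRot a s hs X).symm x))
  map_add' x y := by simp only [map_add]
  map_smul' r x := by
    obtain ⟨x, rfl⟩ := (toRot a s hs X).surjective x
    rw [← op_unop r, op_smul_toRot, LinearEquiv.symm_apply_apply, LinearEquiv.symm_apply_apply,
      g.map_smul, RingHom.id_apply, op_smul_toRot]

theorem rotLin_toRot (g : X.carrier →ₗ[(Zigzag k n)ᵐᵒᵖ] Y.carrier) (x : X.carrier) :
    rotLin a s hs g (toRot a s hs X x) = toRot a s hs Y (g x) := rfl

end

variable (i : ZMod n) (X : DGMod k n N)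

/-- The conjugate of the twist `T_i` by a rotation. -/
abbrev ConjTw : DGMod k n N := Rot a s hs (Tw i (Rot (-a) t ht X))

/-- The inclusion of `X` in the conjugate of the twist. -/
def conjInc : X.carrier →ₗ[(Zigzag k n)ᵐᵒᵖ] (ConjTw a s t hs ht i X).carrier where
  toFun x := toRot a s hs _ (inc i _ (toRot (-a) t ht X x))
  map_add' x y := by simp only [map_add]
  map_smul' r x := by
    refine Eq.trans ?_ (op_smul_toRot a s hs (unop r) _).symm
    rw [← (inc i (Rot (-a) t ht X)).map_smul, op_smul_toRot_neg, rotHom_rotHom (add_neg_cancel a),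
      op_unop]

/-- The map `x ↦ x (i + a) ⊗ (i + a)` from `X` to the conjugate of the twist. -/
def conjCop : X.carrier →ₗ[k] (ConjTw a s t hs ht i X).carrier :=
  (toRot a s hs _).toLinearMap ∘ₗ cop i _ ∘ₗ (toRot (-a) t ht X).toLinearMap

theorem conjInc_apply (x : X.carrier) : conjInc a s t hs ht i X x =
    toRot a s hs (Tw i (Rot (-a) t ht X)) (inc i _ (toRot (-a) t ht X x)) := rfl

theorem conjCop_apply (x : X.carrier) : conjCop a s t hs ht i X x =
    toRot a s hs (Tw i (Rot (-a) t ht X)) (cop i _ (toRot (-a) t ht X x)) := rfl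

/-- The summand X(j + a) is shifted by t (j + a) on its way to the vertex j, and by s j on the way
back; these cancel. -/
theorem conjInc_mem (hst : ∀ j, s j + t (j + a) = 0) {c : Bideg} {x : X.carrier}
    (hx : x ∈ X.gr c) : conjInc a s t hs ht i X x ∈ (ConjTw a s t hs ht i X).gr c := by
  rw [conjInc_apply]
  refine (toRot_mem_iff a s hs c _).2 fun j => ?_
  rw [← (inc i (Rot (-a) t ht X)).map_smul, idem_smul_toRot_neg]
  refine inc_mem i (toRot_mem (-a) t ht (j := j + a) ?_ ?_)
  · rw [op_smul_op_smul, gen_vertex_mul_self]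
  · rw [add_assoc, hst, add_zero]
    exact X.idem_smul_mem _ hx

theorem conjCop_mem (hst : ∀ j, s j + t (j + a) = 0) {c : Bideg} {x : X.carrier}
    (hx : x ∈ X.gr (c + (1, 0))) (h : op (idem k (i + a)) • x = x) :
    conjCop a s t hs ht i X x ∈ (ConjTw a s t hs ht i X).gr c := by
  rw [conjCop_apply]
  refine toRot_mem a s hs (idem_cop i _) (cop_mem i (toRot_mem (-a) t ht h ?_))
  rw [add_right_comm, add_assoc c, hst, add_zero]
  exact hx

theorem d_conjInc (x : X.carrier) : (ConjTw a s t hs ht i X).d (conjInc a s t hs ht i X x) =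
    conjInc a s t hs ht i X (X.d x) := by
  rw [conjInc_apply, conjInc_apply, ← d_toRot, ← d_inc]
  exact d_toRot a s hs _

/-- The inclusion of `X` in the conjugate of the twist. -/
def conjIncHom (hst : ∀ j, s j + t (j + a) = 0) : X ⟶ ConjTw a s t hs ht i X :=
  (⟨conjInc a s t hs ht i X, fun _ _ hx => conjInc_mem a s t hs ht i X hst hx,
    fun x => (d_conjInc a s t hs ht i X x).symm⟩ :
    Hom X (ConjTw a s t hs ht i X))

/-- This is the contraction identity of T_i carried through the two rotations. By the universal
property it extends `conjInc` to the twist at the vertex i + a. -/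
theorem d_conjCop {x : X.carrier} (h : op (idem k (i + a)) • x = x) :
    (ConjTw a s t hs ht i X).d (conjCop a s t hs ht i X x) + conjCop a s t hs ht i X (X.d x) =
      conjInc a s t hs ht i X x := by
  have h1 := d_cop i (toRot (-a) t ht X x)
  rw [idem_smul_toRot_neg, h, eq_sub_iff_add_eq] at h1
  rw [conjInc_apply, conjCop_apply, conjCop_apply, ← h1, map_add, ← d_toRot]
  exact congrArg (· + _) (d_toRot a s hs _)

theorem idem_conjCop (x : X.carrier) :
    op (idem k (i + a)) • conjCop a s t hs ht i X x = conjCop a s t hs ht i X x := by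
  rw [conjCop_apply]
  refine (idem_smul_toRot a s hs (i + a) _).trans ?_
  rw [add_neg_cancel_right, idem_cop]

/-- The isomorphism between the twist `T_{i+a}` and the conjugate of the twist `T_i` by the
rotation by `a`. -/
def conjHom (hst : ∀ j, s j + t (j + a) = 0) : Tw (i + a) X ⟶ ConjTw a s t hs ht i X :=
  descHom (i + a) (conjIncHom a s t hs ht i X hst) (conjCop a s t hs ht i X)
    (fun _ _ hx h => conjCop_mem a s t hs ht i X hst hx h)
    (fun _ h => d_conjCop a s t hs ht i X h)

variable (hst : ∀ j, s j + t (j + a) = 0)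

theorem conjHom_inc (x : X.carrier) :
    Hom.lin (conjHom a s t hs ht i X hst) (inc (i + a) X x) = conjInc a s t hs ht i X x :=
  desc_inc (i + a) _ _ x

theorem conjHom_cop {x : X.carrier} (h : op (idem k (i + a)) • x = x) :
    Hom.lin (conjHom a s t hs ht i X hst) (cop (i + a) X x) = conjCop a s t hs ht i X x :=
  desc_cop (i + a) _ _ h (idem_conjCop a s t hs ht i X x)

/-- The inverse of `conjHom`, before a rotation. -/
def conjInv : (Tw i (Rot (-a) t ht X)).carrier →ₗ[(Zigzag k n)ᵐᵒᵖ]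
    (Rot (-a) t ht (Tw (i + a) X)).carrier :=
  desc i (rotLin (-a) t ht (inc (i + a) X)) ((toRot (-a) t ht _).toLinearMap ∘ₗ
    cop (i + a) X ∘ₗ (toRot (-a) t ht X).symm.toLinearMap)

theorem conjInv_inc (x : X.carrier) : conjInv a t ht i X (inc i _ (toRot (-a) t ht X x)) =
    toRot (-a) t ht (Tw (i + a) X) (inc (i + a) X x) := desc_inc i _ _ _

theorem conjInv_cop {x : X.carrier} (h : op (idem k (i + a)) • x = x) :
    conjInv a t ht i X (cop i _ (toRot (-a) t ht X x)) =
      toRot (-a) t ht (Tw (i + a) X) (cop (i + a) X x) := by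
  refine desc_cop i _ _ ?_ ?_
  · rw [idem_smul_toRot_neg, h]
  · simp only [LinearMap.comp_apply, LinearEquiv.coe_coe, LinearEquiv.symm_apply_apply]
    rw [idem_smul_toRot_neg, idem_cop]

theorem conjInv_conjHom (z : (Tw (i + a) X).carrier) :
    conjInv a t ht i X ((toRot a s hs _).symm (Hom.lin (conjHom a s t hs ht i X hst) z)) =
      toRot (-a) t ht _ z := by
  induction z using tw_induction with
  | add x y hx hy => simp only [map_add, hx, hy]
  | inc x =>
    rw [conjHom_inc, conjInc_apply, LinearEquiv.symm_apply_apply, conjInv_inc]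
  | cop r x hx =>
    rw [(Hom.lin (conjHom a s t hs ht i X hst)).map_smul, conjHom_cop a s t hs ht i X hst hx,
      conjCop_apply, op_smul_toRot, LinearEquiv.symm_apply_apply, (conjInv a t ht i X).map_smul,
      conjInv_cop a t ht i X hx, op_smul_toRot_neg, rotHom_rotHom (add_neg_cancel a)]

theorem conjHom_conjInv (z : (Tw i (Rot (-a) t ht X)).carrier) :
    Hom.lin (conjHom a s t hs ht i X hst) ((toRot (-a) t ht _).symm (conjInv a t ht i X z)) =
      toRot a s hs _ z := by
  induction z using tw_induction with
  | add x y hx hy => simp only [map_add, hx, hy]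
  | inc x =>
    obtain ⟨x, rfl⟩ := (toRot (-a) t ht X).surjective x
    rw [conjInv_inc, LinearEquiv.symm_apply_apply, conjHom_inc, conjInc_apply]
  | cop r x hx =>
    obtain ⟨x, rfl⟩ := (toRot (-a) t ht X).surjective x
    rw [idem_smul_toRot_neg] at hx
    have hx := (toRot (-a) t ht X).injective hx
    rw [(conjInv a t ht i X).map_smul, conjInv_cop a t ht i X hx, op_smul_toRot_neg,
      LinearEquiv.symm_apply_apply, (Hom.lin (conjHom a s t hs ht i X hst)).map_smul,
      conjHom_cop a s t hs ht i X hst hx, conjCop_apply, op_smul_toRot,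
      rotHom_rotHom (neg_add_cancel a)]

theorem quasiIso_conjHom : quasiIso k n N (conjHom a s t hs ht i X hst) :=
  quasiIso_of_bijective _ (Function.bijective_iff_has_inverse.2
    ⟨fun z => (toRot (-a) t ht _).symm (conjInv a t ht i X ((toRot a s hs _).symm z)),
      fun z => (congrArg _ (conjInv_conjHom a s t hs ht i X hst z)).trans
        (LinearEquiv.symm_apply_apply _ z),
      fun z => (conjHom_conjInv a s t hs ht i X hst _).trans (LinearEquiv.apply_symm_apply _ z)⟩)

variable {X} {Y : DGMod k n N}

/-- As for the braid map, ε = 1 gives naturality and ε the sign of a shift gives compatibility with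
that shift. -/
theorem conjHom_tmap (ε : ℤ) (g : X.carrier →ₗ[(Zigzag k n)ᵐᵒᵖ] Y.carrier)
    (z : (Tw (i + a) X).carrier) :
    Hom.lin (conjHom a s t hs ht i Y hst) (tmap (i + a) ε g z) =
      rotLin a s hs (tmap i ε (rotLin (-a) t ht g)) (Hom.lin (conjHom a s t hs ht i X hst) z) := by
  refine tw_hom_ext (W := ConjTw a s t hs ht i Y) (i + a)
    (f := (Hom.lin (conjHom a s t hs ht i Y hst)).comp (tmap (i + a) ε g))
    (g := (rotLin a s hs (tmap i ε (rotLin (-a) t ht g))).comp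
      (Hom.lin (conjHom a s t hs ht i X hst))) (fun x => ?_) (fun x hx => ?_) z
  · rw [LinearMap.comp_apply, LinearMap.comp_apply, tmap_inc, conjHom_inc, conjHom_inc,
      conjInc_apply, conjInc_apply, rotLin_toRot, tmap_inc, rotLin_toRot]
  · have hg : op (idem k (i + a)) • g x = g x := by rw [← g.map_smul, hx]
    rw [LinearMap.comp_apply, LinearMap.comp_apply, tmap_cop, map_zsmul,
      conjHom_cop a s t hs ht i Y hst hg, conjHom_cop a s t hs ht i X hst hx,
      conjCop_apply, conjCop_apply, rotLin_toRot, tmap_cop, rotLin_toRot]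
    exact (map_zsmul (toRot a s hs (Tw i (Rot (-a) t ht Y))) ε _).symm

/-- The functoriality of a rotation. -/
def rotMap (g : X ⟶ Y) : Rot a s hs X ⟶ Rot a s hs Y := (rotFunctor k N a s hs).map g

theorem rotMap_lin (g : X ⟶ Y) : Hom.lin (rotMap a s hs g) = rotLin a s hs g.lin := rfl

theorem conjHom_naturality (g : X ⟶ Y) :
    twMap (i + a) g ≫ conjHom a s t hs ht i Y hst =
      conjHom a s t hs ht i X hst ≫ rotMap a s hs (twMap i (rotMap (-a) t ht g)) := by
  refine hom_ext _ _ fun z => ?_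
  rw [comp_lin, comp_lin, twMap_lin, rotMap_lin, twMap_lin, rotMap_lin, conjHom_tmap]

/-- The natural transformation `conjHom`. -/
def conjTrans : twistFunctor k N (i + a) ⟶
    rotFunctor k N (-a) t ht ⋙ twistFunctor k N i ⋙ rotFunctor k N a s hs where
  app X := conjHom a s t hs ht i X hst
  naturality _ _ g := conjHom_naturality a s t hs ht i hst g

variable (u : Bideg) (X)

/-- The compatibility of a rotation with a shift. -/
def rotShift : Rot a s hs (shiftObj u X) ⟶ shiftObj u (Rot a s hs X) :=
  (rotShiftIso a s hs u).hom.app X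

theorem unshift_rotShift (x : (Rot a s hs (shiftObj u X)).carrier) :
    unshift u _ (Hom.lin (rotShift a s hs X u) x) = rotLin a s hs (unshift u X) x := rfl

/-- The compatibility with a shift of the twist of a rotation. -/
def twistRotShift : Tw i (Rot a s hs (shiftObj u X)) ⟶ shiftObj u (Tw i (Rot a s hs X)) :=
  twMap i (rotShift a s hs X u) ≫ twistShift₁ i u (Rot a s hs X)

theorem unshift_twistRotShift (x : (Tw i (Rot a s hs (shiftObj u X))).carrier) :
    unshift u _ (Hom.lin (twistRotShift a s hs i X u) x) =
      tmap i (sgn u) (rotLin a s hs (unshift u X)) x := by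
  rw [twistRotShift, comp_lin]
  refine (unshift_twistShift₁ i u (Rot a s hs X) _).trans ?_
  rw [twMap_lin]
  refine (tmap_tmap (X := Rot a s hs (shiftObj u X)) (Y := shiftObj u (Rot a s hs X))
    (Z := Rot a s hs X) i (sgn u) 1 (unshift u _) (Hom.lin (rotShift a s hs X u)) _).trans ?_
  rw [mul_one]
  exact congrArg (fun g => tmap i (sgn u) g x)
    (LinearMap.ext fun y => unshift_rotShift a s hs X u y)

/-- The compatibility with a shift of the conjugate of a twist by a rotation. -/
def conjShift : ConjTw a s t hs ht i (shiftObj u X) ⟶ shiftObj u (ConjTw a s t hs ht i X) :=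
  rotMap a s hs (twistRotShift (-a) t ht i X u) ≫ rotShift a s hs (Tw i (Rot (-a) t ht X)) u

theorem unshift_conjShift (x : (ConjTw a s t hs ht i (shiftObj u X)).carrier) :
    unshift u _ (Hom.lin (conjShift a s t hs ht i X u) x) =
      rotLin a s hs (tmap i (sgn u) (rotLin (-a) t ht (unshift u X))) x := by
  obtain ⟨x, rfl⟩ := (toRot a s hs _).surjective x
  rw [conjShift, comp_lin, rotMap_lin, rotLin_toRot, rotLin_toRot, ← unshift_twistRotShift]
  exact unshift_rotShift a s hs (Tw i (Rot (-a) t ht X)) u _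

theorem conjHom_shift (z : (Tw (i + a) (shiftObj u X)).carrier) :
    Hom.lin (conjHom a s t hs ht i X hst)
        (unshift u _ (Hom.lin (twistShift₁ (i + a) u X) z)) =
      unshift u _ (Hom.lin (conjShift a s t hs ht i X u)
        (Hom.lin (conjHom a s t hs ht i (shiftObj u X) hst) z)) := by
  rw [unshift_twistShift₁, unshift_conjShift]
  exact conjHom_tmap a s t hs ht i hst (sgn u) (unshift u X) z

theorem conjHom_shift_comp :
    twistShift₁ (i + a) u X ≫ (shiftBy k n N u).map (conjHom a s t hs ht i X hst) =
      conjHom a s t hs ht i (shiftObj u X) hst ≫ conjShift a s t hs ht i X u :=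
  hom_ext _ _ fun z => conjHom_shift a s t hs ht i X hst u z

end Conj

variable (k n N)

theorem rhoShift_add (j : ZMod n) : rhoShift n N j + -rhoShift n N (j + 1 - 1) = 0 := by
  rw [add_sub_cancel_right, add_neg_cancel]

/-- Both sides are (N/2, 0), by the choice of `rhoShift`. -/
theorem rhoShift_up (i : ZMod n) : rhoShift n N i + Gen.deg N (Gen.up i) =
    Gen.deg N (Gen.up (i + 1)) + rhoShift n N (i + 1) := by
  simp [rhoShift]

theorem rhoShift_up' (i : ZMod n) : -rhoShift n N (i - 1) + Gen.deg N (Gen.up i) =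
    Gen.deg N (Gen.up (i + -1)) + -rhoShift n N (i + 1 - 1) := by
  simp only [rhoShift, add_sub_cancel_right, ← sub_eq_add_neg]
  abel

/-- The natural transformation `T_{i+1} ⟶ F_ρ T_i F'_ρ`. -/
def rhoConjTrans (i : ZMod n) : twistFunctor k N (i + 1) ⟶
    rhoFunctor' k n N ⋙ twistFunctor k N i ⋙ rhoFunctor k n N :=
  conjTrans 1 (rhoShift n N) (fun i => -rhoShift n N (i - 1)) (rhoShift_up n N)
    (rhoShift_up' n N) i (rhoShift_add n N)

/-- The compatibility of `F_ρ T_i F'_ρ` with a shift. -/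
def rhoConjShift (i : ZMod n) (X : DGMod k n N) (u : Bideg) :
    (rhoFunctor k n N).obj ((twistFunctor k N i).obj ((rhoFunctor' k n N).obj (shiftObj u X))) ⟶
      shiftObj u ((rhoFunctor k n N).obj ((twistFunctor k N i).obj ((rhoFunctor' k n N).obj X))) :=
  conjShift 1 (rhoShift n N) (fun i => -rhoShift n N (i - 1)) (rhoShift_up n N)
    (rhoShift_up' n N) i X u

theorem rhoConjTrans_shift (i : ZMod n) (X : DGMod k n N) (u : Bideg) :
    twistShift₁ (i + 1) u X ≫ (shiftBy k n N u).map ((rhoConjTrans k n N i).app X) =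
      (rhoConjTrans k n N i).app (shiftObj u X) ≫ rhoConjShift k n N i X u :=
  conjHom_shift_comp 1 (rhoShift n N) (fun i => -rhoShift n N (i - 1)) (rhoShift_up n N)
    (rhoShift_up' n N) i X
    (rhoShift_add n N) u

theorem commShiftIso_rhoConj (i : ZMod n) (X : DGMod k n N) (a : ℤ) :
    ((rhoFunctor' k n N ⋙ twistFunctor k N i ⋙ rhoFunctor k n N).commShiftIso a).hom.app X =
      rhoConjShift k n N i X (firstHom a) := by
  rw [Functor.commShiftIso_comp_hom_app, Functor.commShiftIso_comp_hom_app, ← Category.assoc,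
    Functor.comp_map, ← Functor.map_comp]
  rfl

theorem commShiftIso_second_rhoConj (i : ZMod n) (X : DGMod k n N) (a : Second) :
    ((rhoFunctor' k n N ⋙ twistFunctor k N i ⋙ rhoFunctor k n N).commShiftIso a).hom.app X =
      rhoConjShift k n N i X (secondHom a) := by
  rw [Functor.commShiftIso_comp_hom_app, Functor.commShiftIso_comp_hom_app, ← Category.assoc,
    Functor.comp_map, ← Functor.map_comp]
  rfl

instance (i : ZMod n) : NatTrans.CommShift (rhoConjTrans k n N i) ℤ := ⟨fun a => by
  refine NatTrans.ext (funext fun X => ?_)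
  rw [NatTrans.comp_app, NatTrans.comp_app, commShiftIso_rhoConj, Functor.whiskerLeft_app]
  exact rhoConjTrans_shift k n N i X (firstHom a)⟩

instance (i : ZMod n) : NatTrans.CommShift (rhoConjTrans k n N i) Second := ⟨fun a => by
  refine NatTrans.ext (funext fun X => ?_)
  rw [NatTrans.comp_app, NatTrans.comp_app, commShiftIso_second_rhoConj, Functor.whiskerLeft_app]
  exact rhoConjTrans_shift k n N i X (secondHom a)⟩

end DGMod

open DGMod

variable {k : Type u} [Field k] {n : ℕ} [NeZero n] {N : ℤ}

theorem GradedIso.symm {G H : DerivedCat k n N ⥤ DerivedCat k n N} [G.CommShift ℤ]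
    [G.CommShift Second] [H.CommShift ℤ] [H.CommShift Second] (h : GradedIso G H) :
    GradedIso H G := by
  obtain ⟨e, h1, h2⟩ := h
  exact ⟨e.symm, inferInstanceAs (NatTrans.CommShift e.inv ℤ),
    inferInstanceAs (NatTrans.CommShift e.inv Second)⟩

-- The universal property provides a map out of T_{i+1}, so the isomorphism is obtained in the
-- opposite direction and then inverted.
variable (k n N) in
theorem gradedIso_conj (i : ZMod n) :
    GradedIso (Frho' k n N ⋙ T k N i ⋙ Frho k n N) (T k N (i + 1)) :=
  ((isInducedBy_T (i + 1)).gradedIso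
    (isInducedBy_Frho'.comp ((isInducedBy_T i).comp isInducedBy_Frho)) (rhoConjTrans k n N i)
    fun X => quasiIso_conjHom 1 (rhoShift n N) (fun i => -rhoShift n N (i - 1)) (rhoShift_up n N)
    (rhoShift_up' n N) i X
      (rhoShift_add n N)).symm

end AffineZigzag

end

theorem mainTheorem7 (k : Type u) [Field k] [IsAlgClosed k] (n : ℕ) [NeZero n] (hn : 3 ≤ n)
    (N : ℤ) :
    (∀ i : ZMod n, AffineZigzag.IsExactEquivalence (AffineZigzag.T k N i)) ∧
    AffineZigzag.IsExactEquivalence (AffineZigzag.Frho k n N) ∧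
    AffineZigzag.IsExactEquivalence (AffineZigzag.Frho' k n N) ∧
    AffineZigzag.GradedIso (AffineZigzag.Frho' k n N ⋙ AffineZigzag.Frho k n N) (𝟭 _) ∧
    AffineZigzag.GradedIso (AffineZigzag.Frho k n N ⋙ AffineZigzag.Frho' k n N) (𝟭 _) ∧
    (∀ i : ZMod n,
      AffineZigzag.GradedIso
        (AffineZigzag.T k N i ⋙ AffineZigzag.T k N (i + 1) ⋙ AffineZigzag.T k N i)
        (AffineZigzag.T k N (i + 1) ⋙ AffineZigzag.T k N i ⋙ AffineZigzag.T k N (i + 1))) ∧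
    (∀ i j : ZMod n, j ≠ i → j ≠ i + 1 → i ≠ j + 1 →
      AffineZigzag.GradedIso
        (AffineZigzag.T k N j ⋙ AffineZigzag.T k N i)
        (AffineZigzag.T k N i ⋙ AffineZigzag.T k N j)) ∧
    (∀ i : ZMod n,
      AffineZigzag.GradedIso
        (AffineZigzag.Frho' k n N ⋙ AffineZigzag.T k N i ⋙ AffineZigzag.Frho k n N)
        (AffineZigzag.T k N (i + 1))) := by
  refine ⟨fun i => ⟨AffineZigzag.isEquivalence_T hn N i,
      (AffineZigzag.isInducedBy_T i).mapTriangle_mem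
        (AffineZigzag.DGMod.preservesCones_twistFunctor i)⟩,
    ⟨AffineZigzag.isEquivalence_Frho k n N, AffineZigzag.isInducedBy_Frho.mapTriangle_mem
      AffineZigzag.DGMod.preservesCones_rhoFunctor⟩,
    ⟨AffineZigzag.isEquivalence_Frho' k n N, AffineZigzag.isInducedBy_Frho'.mapTriangle_mem
      AffineZigzag.DGMod.preservesCones_rhoFunctor'⟩,
    AffineZigzag.gradedIso_Frho_Frho' k n N, AffineZigzag.gradedIso_Frho'_Frho k n N,
    AffineZigzag.gradedIso_braid hn N, fun i j h1 h2 h3 => ?_, AffineZigzag.gradedIso_conj k n N⟩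
  -- On the left side of the goal T_j acts first, so `gradedIso_far` is applied to the pair (j, i)
  -- and the two non-adjacency hypotheses are exchanged.
  exact AffineZigzag.gradedIso_far N ⟨h1.symm, h3, h2⟩
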